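/- **Billiard setting.** Let $r\ge 8$ and let $\Omega_0\subset\mathbb R^2$ be a strictly convex domain whose boundary is a simple closed $C^r$ curve with everywhere positive curvature, parametrized counterclockwise by arc length $s$. Let $\rho(s)$ be its radius of curvature. For an integer $q_*\ge 2$, assume that $\Omega_0$ is $q_*$-rationally integrable: for every rational $0<p/q<1/q_*$ (in lowest terms) the billiard in $\Omega_0$ has a convex caustic such that all billiard trajectories tangent to it (running counterclockwise around it) are periodic with rotation number $p/q$. Let $$x(s)=C_{\Omega_0}\int_0^s\rho(\tau)^{-2/3}d\tau,\qquad C_{\Omega_0}^{-1}=\int_0^{|\partial\Omega_0|}\rho(\tau)^{-2/3}d\tau$$ be the Lazutkin parameter and $\mu(x)=\dfrac{1}{2C_{\Omega_0}\rho(x)^{1/3}}$ the Lazutkin density. For $q>q_*$, let $x_q^k(x)$, $k\in\mathbb Z$, be the Lazutkin parameters of the impact points of the periodic billiard orbit of rotation number $1/q$ starting at $x_q^0(x)=x$, and let $\varphi_q^k(x)$ be its angle of reflection at the $k$-th impact. For a $C^1$ function $f$ on $\mathbb T=\mathbb R/\mathbb Z$ put $$\mathbb L_q(f)(x)=\frac1{2\pi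 q}\sum_{k=0}^{q-1}\Big[f'(x_q^k(x))\,\frac{dx_q^k}{dx}(x)\,\frac{\sin\varphi_q^k(x)}{\mu(x_q^k(x))}+f(x_q^k(x))\,\frac{d}{dx}\frac{\sin\varphi_q^k(x)}{\mu(x_q^k(x))}\Big],$$ that is, $\mathbb L_q(f)(x)=\frac1{2\pi q}\frac{d}{dx}\sum_{k=0}^{q-1}f(x_q^k(x))\sin\varphi_q^k(x)/\mu(x_q^k(x))$. **Spaces.** For $2<\gamma<3$ let $X^\gamma$ be the space of $f\in C^0(\mathbb T)$, with Fourier series $a_0+\sum_{j\ge1}(a_j\cos2\pi jx+b_j\sin2\pi jx)$, for which $\|f\|_{X^\gamma}=\max\{|a_0|,\ \sup_{j\ge1}j^\gamma\max(|a_j|,|b_j|)\}<\infty$, and let $h^\gamma$ be the space of real sequences $c=(c_0,c_1,d_1,c_2,d_2,\dots)$ with $\|c\|_{h^\gamma}=\max\{|c_0|,\ \sup_{j\ge1}j^\gamma\max(|c_j|,|d_j|)\}<\infty$. **Theorem.** Let $\gamma_0\approx2.788$ be the number with $\sum_{k\ge2}k^{1-\gamma_0}=0.9$, and let $\gamma_0\le\gamma<3$.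 Then every $f\in X^\gamma$ is $C^1$, and there is $q_0=q_0(\Omega_0,\gamma)$ such that the following hold. For every $q\ge q_0$, through each boundary point there is exactly one periodic orbit of rotation number $1/q$, and the functions $x_q^k$ and $\sin\varphi_q^k/\mu(x_q^k)$ are $C^1$ (so that $\mathbb L_q$ is well defined on $X^\gamma$). For every integer $\bar q\ge q_0$ the linear map $$\mathcal I^{\bar q}(f)=\Big(a_0,a_1,b_1,\dots,a_{\bar q-1},b_{\bar q-1},\ \mathbb L_{\bar q}(f)\big(\tfrac3{4\bar q}\big),\ \mathbb L_{\bar q}(f)(0),\ \dots,\ \mathbb L_q(f)\big(\tfrac3{4q}\big),\ \mathbb L_q(f)(0),\ \dots\Big)$$ is an invertible bounded linear operator from $X^\gamma$ onto $h^\gamma$, with bounded inverse. -/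

import Mathlib

noncomputable section

namespace Billiard

/-- The determinant of two vectors of the Euclidean plane `ℂ = ℝ²`. -/
def cross (z w : ℂ) : ℝ := z.re * w.im - z.im * w.re

/-- A strictly convex planar domain with `C^r` boundary, given by the counterclockwise
arc-length parametrization `Γ` of its boundary: a simple closed curve of length `L` whose
curvature is positive everywhere. -/
structure Table (r : ℕ) where
  Γ : ℝ → ℂ
  L : ℝ
  L_pos : 0 < L
  contDiff : ContDiff ℝ r Γ
  periodic : Function.Periodic Γ L
  injOn : Set.InjOn Γ (Set.Ico 0 L)
  unit_speed : ∀ s, ‖deriv Γ s‖ = 1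
  curvature_pos : ∀ s, 0 < cross (deriv Γ s) (deriv (deriv Γ) s)

namespace Table

variable {r : ℕ} (Ω : Table r)

/-- The open domain bounded by the curve `Γ`. -/
def domain : Set ℂ := interior (convexHull ℝ (Set.range Ω.Γ))

/-! ### Billiard orbits -/

/-- The angle at `Γ s` between the chord leaving towards `Γ s'` and the tangent vector. -/
def outAngle (s s' : ℝ) : ℝ := InnerProductGeometry.angle (Ω.Γ s' - Ω.Γ s) (deriv Ω.Γ s)

/-- The angle at `Γ s` between the chord arriving from `Γ s'` and the tangent vector. -/
def inAngle (s' s : ℝ) : ℝ := InnerProductGeometry.angle (Ω.Γ s - Ω.Γ s') (deriv Ω.Γ s)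

/-- A billiard orbit, as the bi-infinite sequence of its impact points. Each arc-length parameter
is lifted to `ℝ` so that one bounce advances it by an amount in `(0, L)`. At each impact the angle
of incidence equals the angle of reflection. -/
def IsOrbit (s : ℤ → ℝ) : Prop :=
  (∀ k, s k < s (k + 1) ∧ s (k + 1) < s k + Ω.L) ∧
  ∀ k, Ω.inAngle (s (k - 1)) (s k) = Ω.outAngle (s k) (s (k + 1))

/-- A periodic billiard orbit with rotation number `p / q`: after `q` bounces it closes up,
having turned `p` times around the boundary. -/
def IsPeriodicOrbit (p q : ℕ) (s : ℤ → ℝ) : Prop :=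
  Ω.IsOrbit s ∧ ∀ k, s (k + q) = s k + p * Ω.L

/-! ### Caustics -/

/-- The directed line from `z` to `w` is tangent to the convex set `K`, with `K` on its left. -/
def TangentLeft (K : Set ℂ) (z w : ℂ) : Prop :=
  (∀ u ∈ K, 0 ≤ cross (w - z) (u - z)) ∧ ∃ u ∈ K, cross (w - z) (u - z) = 0

/-- The boundary curve of the convex body `K ⊆ Ω` is a caustic: a trajectory that is tangent to
it remains tangent to it after each reflection. (Trajectories running around `K` in the
opposite direction are the time reversals of these.) -/
def IsCaustic (K : Set ℂ) : Prop :=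
  IsCompact K ∧ Convex ℝ K ∧ (interior K).Nonempty ∧ K ⊆ Ω.domain ∧
  ∀ s, Ω.IsOrbit s → TangentLeft K (Ω.Γ (s 0)) (Ω.Γ (s 1)) →
    ∀ k, TangentLeft K (Ω.Γ (s k)) (Ω.Γ (s (k + 1)))

/-- An integrable rational caustic of rotation number `p / q`: the corresponding invariant
curve, formed by the trajectories tangent to the caustic, consists of periodic points of rotation
number `p / q`. -/
def IsIntegrableRationalCaustic (p q : ℕ) (K : Set ℂ) : Prop :=
  Ω.IsCaustic K ∧
  ∀ s, Ω.IsOrbit s → TangentLeft K (Ω.Γ (s 0)) (Ω.Γ (s 1)) → Ω.IsPeriodicOrbit p q s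

/-- `Ω` is `q₀`-rationally integrable: it has integrable rational caustics of all rotation numbers
`0 < p / q < 1 / q₀` (written in lowest terms). -/
def RationallyIntegrable (q₀ : ℕ) : Prop :=
  ∀ p q : ℕ, 0 < p → p * q₀ < q → Nat.Coprime p q →
    ∃ K, Ω.IsIntegrableRationalCaustic p q K

/-! ### Lazutkin parametrization -/

/-- The radius of curvature at arc-length parameter `s`. -/
def rho (s : ℝ) : ℝ := (cross (deriv Ω.Γ s) (deriv (deriv Ω.Γ) s))⁻¹

/-- The constant `C_Ω`. -/
def lazConst : ℝ := (∫ t in (0 : ℝ)..Ω.L, Ω.rho t ^ (-(2 / 3) : ℝ))⁻¹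

/-- The Lazutkin parameter `x(s)`; it satisfies `x(s + L) = x(s) + 1`. -/
def laz (s : ℝ) : ℝ := Ω.lazConst * ∫ t in (0 : ℝ)..s, Ω.rho t ^ (-(2 / 3) : ℝ)

/-- The arc-length parameter `s(x)`, inverse of the Lazutkin parameter. -/
def arc (x : ℝ) : ℝ := Function.invFun Ω.laz x

/-- The Lazutkin density `μ(x)`. -/
def mu (x : ℝ) : ℝ := 1 / (2 * Ω.lazConst * Ω.rho (Ω.arc x) ^ (1 / 3 : ℝ))

/-! ### The periodic orbits of rotation number `1 / q` -/

/-- The periodic orbit of rotation number `1 / q` that starts at the point with Lazutkin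
parameter `x`, as a sequence of arc-length parameters. -/
def orbit (q : ℕ) (x : ℝ) : ℤ → ℝ :=
  Classical.epsilon fun s : ℤ → ℝ => Ω.IsPeriodicOrbit 1 q s ∧ s 0 = Ω.arc x

/-- `x_q^k(x)`, the Lazutkin parameter of the `k`-th impact. -/
def orbitX (q : ℕ) (k : ℤ) (x : ℝ) : ℝ := Ω.laz (Ω.orbit q x k)

/-- `φ_q^k(x)`, the angle of reflection at the `k`-th impact. -/
def orbitAngle (q : ℕ) (k : ℤ) (x : ℝ) : ℝ :=
  Ω.outAngle (Ω.orbit q x k) (Ω.orbit q x (k + 1))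

/-- `sin φ_q^k(x) / μ(x_q^k(x))`. -/
def orbitWeight (q : ℕ) (k : ℤ) (x : ℝ) : ℝ :=
  Real.sin (Ω.orbitAngle q k x) / Ω.mu (Ω.orbitX q k x)

end Table

/-! ### Function and sequence spaces -/

/-- A function on the circle `ℝ / ℤ`, seen as a `1`-periodic function on `ℝ`. -/
def lift (f : C(UnitAddCircle, ℝ)) (x : ℝ) : ℝ := f (x : UnitAddCircle)

/-- The Fourier coefficient `a₀`. -/
def coeffZero (f : C(UnitAddCircle, ℝ)) : ℝ := ∫ x in (0 : ℝ)..1, lift f x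

/-- The Fourier coefficient `a_j` of `cos 2πjx`, `j ≥ 1`. -/
def coeffCos (f : C(UnitAddCircle, ℝ)) (j : ℕ+) : ℝ :=
  2 * ∫ x in (0 : ℝ)..1, lift f x * Real.cos (2 * Real.pi * j * x)

/-- The Fourier coefficient `b_j` of `sin 2πjx`, `j ≥ 1`. -/
def coeffSin (f : C(UnitAddCircle, ℝ)) (j : ℕ+) : ℝ :=
  2 * ∫ x in (0 : ℝ)..1, lift f x * Real.sin (2 * Real.pi * j * x)

/-- Real sequences `(c₀, c₁, d₁, c₂, d₂, …)`, stored as `(c₀, j ↦ (c_j, d_j))`. -/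
abbrev RSeq : Type := ℝ × (ℕ+ → ℝ × ℝ)

theorem continuous_lift (f : C(UnitAddCircle, ℝ)) : Continuous (lift f) :=
  f.continuous.comp (AddCircle.continuous_mk' 1)

/-- The sequence `(a₀, a₁, b₁, a₂, b₂, …)` of Fourier coefficients. -/
def fourierSeq : C(UnitAddCircle, ℝ) →ₗ[ℝ] RSeq where
  toFun f := (coeffZero f, fun j => (coeffCos f j, coeffSin f j))
  map_add' f g := by
    have h : ∀ u : ℝ → ℝ, Continuous u →
        ∫ x in (0 : ℝ)..1, lift (f + g) x * u x =
          (∫ x in (0 : ℝ)..1, lift f x * u x) + ∫ x in (0 : ℝ)..1, lift g x * u x := by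
      intro u hu
      refine Eq.trans (intervalIntegral.integral_congr fun x _ => ?_)
        (intervalIntegral.integral_add
          (((continuous_lift f).mul hu).intervalIntegrable _ _)
          (((continuous_lift g).mul hu).intervalIntegrable _ _))
      simp [lift, add_mul]
    refine Prod.ext ?_ (funext fun j => Prod.ext ?_ ?_)
    · simpa [coeffZero] using h (fun _ => 1) continuous_const
    · simp only [coeffCos, Prod.snd_add, Pi.add_apply, Prod.fst_add]
      rw [h _ (by fun_prop), mul_add]
    · simp only [coeffSin, Prod.snd_add, Pi.add_apply]
      rw [h _ (by fun_prop), mul_add]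
  map_smul' c f := by
    have h : ∀ u : ℝ → ℝ, ∫ x in (0 : ℝ)..1, lift (c • f) x * u x =
        c * ∫ x in (0 : ℝ)..1, lift f x * u x := by
      intro u
      rw [← intervalIntegral.integral_const_mul]
      exact intervalIntegral.integral_congr fun x _ => by simp [lift, mul_assoc]
    refine Prod.ext ?_ (funext fun j => Prod.ext ?_ ?_)
    · simpa [coeffZero] using h (fun _ => 1)
    · simp only [coeffCos, RingHom.id_apply, Prod.smul_snd, Pi.smul_apply, Prod.smul_fst,
        smul_eq_mul]
      rw [h]
      ring
    · simp only [coeffSin, RingHom.id_apply, Prod.smul_snd, Pi.smul_apply, smul_eq_mul]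
      rw [h]
      ring

/-- The weighted size `j^γ max(|c_j|, |d_j|)` of the `j`-th pair of entries. -/
def weighted (γ : ℝ) (c : RSeq) (j : ℕ+) : ℝ :=
  (j : ℝ) ^ γ * max |(c.2 j).1| |(c.2 j).2|

/-- The space `h^γ` of sequences with finite norm. -/
def hSpace (γ : ℝ) : Submodule ℝ RSeq where
  carrier := {c | BddAbove (Set.range (weighted γ c))}
  zero_mem' := ⟨0, by
    rintro _ ⟨j, rfl⟩
    simp [weighted]⟩
  add_mem' := by
    rintro c d ⟨M, hM⟩ ⟨N, hN⟩
    refine ⟨M + N, ?_⟩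
    rintro _ ⟨j, rfl⟩
    have h1 : weighted γ c j ≤ M := hM ⟨j, rfl⟩
    have h2 : weighted γ d j ≤ N := hN ⟨j, rfl⟩
    refine le_trans ?_ (add_le_add h1 h2)
    unfold weighted
    rw [← mul_add]
    refine mul_le_mul_of_nonneg_left (max_le ?_ ?_) (by positivity)
    · exact (abs_add_le _ _).trans (add_le_add (le_max_left _ _) (le_max_left _ _))
    · exact (abs_add_le _ _).trans (add_le_add (le_max_right _ _) (le_max_right _ _))
  smul_mem' := by
    rintro t c ⟨M, hM⟩
    refine ⟨|t| * M, ?_⟩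
    rintro _ ⟨j, rfl⟩
    have h1 : weighted γ c j ≤ M := hM ⟨j, rfl⟩
    refine le_trans (le_of_eq ?_) (mul_le_mul_of_nonneg_left h1 (abs_nonneg t))
    simp only [weighted, Prod.smul_snd, Pi.smul_apply, Prod.smul_fst, smul_eq_mul, abs_mul]
    rw [← mul_max_of_nonneg _ _ (abs_nonneg t)]
    ring

/-- The norm of `h^γ`: `max(|c₀|, sup_{j ≥ 1} j^γ max(|c_j|, |d_j|))`. -/
def hNorm (γ : ℝ) (c : RSeq) : ℝ := max |c.1| (⨆ j, weighted γ c j)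

/-- The space `X^γ` of continuous functions on the circle with finite norm. -/
def XSpace (γ : ℝ) : Submodule ℝ C(UnitAddCircle, ℝ) := (hSpace γ).comap fourierSeq

/-- The norm of `X^γ`: `max(|a₀|, sup_{j ≥ 1} j^γ max(|a_j|, |b_j|))`. -/
def XNorm (γ : ℝ) (f : C(UnitAddCircle, ℝ)) : ℝ := hNorm γ (fourierSeq f)

/-! ### The operators -/

namespace Table

variable {r : ℕ} (Ω : Table r)

/-- `𝕃_q¹(f)(x) = (1 / 2πq) ∑_k f'(x_q^k(x)) (x_q^k)'(x) sin φ_q^k(x) / μ(x_q^k(x))`. -/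
def L1 (q : ℕ) (f : C(UnitAddCircle, ℝ)) (x : ℝ) : ℝ :=
  1 / (2 * Real.pi * q) * ∑ k ∈ Finset.range q,
    deriv (lift f) (Ω.orbitX q k x) * deriv (Ω.orbitX q k) x * Ω.orbitWeight q k x

/-- `𝕃_q²(f)(x) = (1 / 2πq) ∑_k f(x_q^k(x)) (d/dx) [sin φ_q^k(x) / μ(x_q^k(x))]`. -/
def L2 (q : ℕ) (f : C(UnitAddCircle, ℝ)) (x : ℝ) : ℝ :=
  1 / (2 * Real.pi * q) * ∑ k ∈ Finset.range q,
    lift f (Ω.orbitX q k x) * deriv (Ω.orbitWeight q k) x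

/-- `𝕃_q = 𝕃_q¹ + 𝕃_q²`. -/
def opL (q : ℕ) (f : C(UnitAddCircle, ℝ)) (x : ℝ) : ℝ := Ω.L1 q f x + Ω.L2 q f x

/-- The map `𝓘^{q̄}`: entry `0` is `a₀`; the pair at place `q` is `(a_q, b_q)` for `q < q̄` and
`(𝕃_q(f)(3 / 4q), 𝕃_q(f)(0))` for `q ≥ q̄`. -/
def opI (qbar : ℕ) (f : C(UnitAddCircle, ℝ)) : RSeq :=
  (coeffZero f, fun q : ℕ+ =>
    if (q : ℕ) < qbar then (coeffCos f q, coeffSin f q)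
    else (Ω.opL q f (3 / (4 * (q : ℝ))), Ω.opL q f 0))

end Table

end Billiard

end

/-! ### Size of the critical exponent; exponential sums along nearly equidistributed orbits. -/

namespace Billiard

/-! In the Lazutkin parameter the billiard map near the boundary is a rotation to high order. The
sine of the reflection angle divided by `μ`, as a function of the position `x` and the step `d` to
the next impact, extends smoothly through `d = 0` with expansion `d + O(d^3)`; the quadratic term
vanishes precisely because of the choice of parameter (`sineModel_jet`). Its even part in `d` is
then `O(d^4)`, and the reflection law says that consecutive short steps satisfy `d - d' = O(d'^4)`
(`exists_step_sub_le`). Along an orbit of rotation number `1/q` this gives `x_q^k = x + k/q +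
O(q^-2)`, steps `1/q + O(q^-3)`, derivatives `1 + O(q^-2)`, and weights `1/q + O(q^-3)` whose
derivatives are `O(q^-3)` (`exists_nearRotation`).

Consequently `𝕃_q(f)(x)` is, up to a small error, `1/(2πq)` times the mean of `f'` over `q` almost
equidistributed points. Such a mean keeps only the frequencies divisible by `q`, that is `∑_j j
(b_{jq} cos 2πjqx - a_{jq} sin 2πjqx)`. At `x = 3/(4q)` and `x = 0` the term `j = 1` is `a_q`,
respectively `b_q`, and the overtones `j ≥ 2` contribute at most `0.9 ‖f‖ q^-γ` by the definition of
`γ₀`. The other frequencies are controlled by summation by parts (`norm_average_expChar_sub_le`);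
weighted by `n^(1-γ)` they sum to `o(q^(1-γ))` when `5/2 < γ < 3`
(`exists_tendsto_sum_charBound_le`), and `5/2 < γ₀` is a numerical check. So for large `q̄` the map
differs from the Fourier isomorphism of `X^γ` with `h^γ` by an operator of norm at most `19/20`, and
a Neumann series inverts it (`exists_equiv_of_close`).

On the dynamical side, through each boundary point there is exactly one chord tangent to a caustic
with the caustic on its left. This defines a strictly increasing map of the boundary, and
monotonicity of the reflection law forces every periodic orbit with the rotation number of the
caustic to follow it (`exists_caustic_map`). Smooth dependence on the initial point comes from the
inverse function theorem applied to the system of reflection laws; the system is nondegenerate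
because a closed solution of the linearized recursion is nearly constant (`abs_variation_le`).

All of this uses global strict convexity. It is derived from positive curvature and simplicity of
the curve by showing that the tangent turns exactly once (`turning_number_eq_one`). -/

open Finset in
theorem five_halves_lt_of_hasSum {γ₀ : ℝ}
    (h : HasSum (fun k : ℕ => 1 / ((k : ℝ) + 2) ^ (γ₀ - 1)) (9 / 10)) : 5 / 2 < γ₀ := by
  by_contra hcon
  push Not at hcon
  have h1 : ∑ k ∈ range 7, 1 / ((k : ℝ) + 2) ^ (γ₀ - 1) ≤ 9 / 10 :=
    sum_le_hasSum _ (fun i _ => by positivity) h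
  have key : ∀ (n : ℕ) (b : ℝ), 1 ≤ (n : ℝ) → 0 < b → (n : ℝ) ^ 3 ≤ b ^ 2 →
      1 / b ≤ 1 / (n : ℝ) ^ (γ₀ - 1) := by
    intro n b hn hb hnb
    have h2 : (n : ℝ) ^ (γ₀ - 1) ≤ (n : ℝ) ^ (3 / 2 : ℝ) :=
      Real.rpow_le_rpow_of_exponent_le hn (by linarith)
    have h3 : ((n : ℝ) ^ (3 / 2 : ℝ)) ^ 2 = (n : ℝ) ^ 3 := by
      rw [← Real.rpow_natCast, ← Real.rpow_mul (by linarith)]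
      norm_num
    have h4 : (n : ℝ) ^ (3 / 2 : ℝ) ≤ b :=
      le_of_sq_le_sq (by rw [h3]; exact hnb) hb.le
    exact one_div_le_one_div_of_le (Real.rpow_pos_of_pos (by linarith) _) (h2.trans h4)
  simp only [sum_range_succ, range_zero, sum_empty] at h1
  -- Decimal upper bounds for `n^(3/2)`. The seven reciprocals add up to about `0.926`, which
  -- exceeds `0.9`.
  have a2 := key 2 2.83 (by norm_num) (by norm_num) (by norm_num)
  have a3 := key 3 5.2 (by norm_num) (by norm_num) (by norm_num)
  have a4 := key 4 8 (by norm_num) (by norm_num) (by norm_num)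
  have a5 := key 5 11.19 (by norm_num) (by norm_num) (by norm_num)
  have a6 := key 6 14.7 (by norm_num) (by norm_num) (by norm_num)
  have a7 := key 7 18.53 (by norm_num) (by norm_num) (by norm_num)
  have a8 := key 8 22.63 (by norm_num) (by norm_num) (by norm_num)
  norm_num at h1 a2 a3 a4 a5 a6 a7 a8
  linarith


/-- The character `t ↦ exp(2πit)` of the real line. -/
noncomputable def expChar (t : ℝ) : ℂ := Complex.exp (Complex.I * ((2 * Real.pi * t : ℝ) : ℂ))

theorem expChar_add (s t : ℝ) : expChar (s + t) = expChar s * expChar t := by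
  unfold expChar
  rw [← Complex.exp_add]
  congr 1
  push_cast
  ring

theorem norm_expChar (t : ℝ) : ‖expChar t‖ = 1 := by
  unfold expChar
  rw [mul_comm]
  exact Complex.norm_exp_ofReal_mul_I _

theorem expChar_natCast (n : ℕ) : expChar n = 1 := by
  unfold expChar
  rw [Complex.exp_eq_one_iff]
  exact ⟨n, by push_cast; ring⟩

theorem expChar_nat_mul (n : ℕ) (t : ℝ) : expChar (n * t) = expChar t ^ n := by
  unfold expChar
  rw [← Complex.exp_nat_mul]
  congr 1
  push_cast
  ring

theorem expChar_re (t : ℝ) : (expChar t).re = Real.cos (2 * Real.pi * t) := by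
  unfold expChar
  rw [mul_comm, Complex.exp_ofReal_mul_I_re]

theorem expChar_im (t : ℝ) : (expChar t).im = Real.sin (2 * Real.pi * t) := by
  unfold expChar
  rw [mul_comm, Complex.exp_ofReal_mul_I_im]

theorem norm_expChar_sub_le (s t : ℝ) : ‖expChar s - expChar t‖ ≤ 2 * Real.pi * |s - t| := by
  have h : expChar s - expChar t = expChar t * (expChar (s - t) - 1) := by
    rw [mul_sub, ← expChar_add, mul_one]
    congr 2
    ring
  rw [h, norm_mul, norm_expChar, one_mul]
  refine (Real.norm_exp_I_mul_ofReal_sub_one_le).trans ?_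
  rw [Real.norm_eq_abs, abs_mul, abs_of_pos (by positivity : (0 : ℝ) < 2 * Real.pi)]

/-- The left-over quantity is `2 sin πt`; Jordan's inequality applies on each half of the interval.
-/
theorem le_norm_expChar_sub_one {t : ℝ} (h0 : 0 ≤ t) (h1 : t ≤ 1) :
    4 * min t (1 - t) ≤ ‖expChar t - 1‖ := by
  unfold expChar
  rw [Complex.norm_exp_I_mul_ofReal_sub_one]
  have e : 2 * Real.pi * t / 2 = Real.pi * t := by ring
  have hpi := Real.pi_pos
  have hs : 0 ≤ Real.sin (Real.pi * t) :=
    Real.sin_nonneg_of_nonneg_of_le_pi (by positivity) (by nlinarith)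
  rw [e, Real.norm_eq_abs, abs_of_nonneg (by positivity)]
  rcases le_total t (1 / 2) with h | h
  · have := Real.mul_le_sin (x := Real.pi * t) (by positivity) (by nlinarith)
    have e2 : 2 / Real.pi * (Real.pi * t) = 2 * t := by field_simp
    rw [e2] at this
    have := min_le_left t (1 - t)
    linarith
  · have := Real.mul_le_sin (x := Real.pi * (1 - t)) (by nlinarith) (by nlinarith)
    have e2 : 2 / Real.pi * (Real.pi * (1 - t)) = 2 * (1 - t) := by field_simp
    have e3 : Real.sin (Real.pi * (1 - t)) = Real.sin (Real.pi * t) := by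
      rw [mul_sub, mul_one, Real.sin_pi_sub]
    rw [e2, e3] at this
    have := min_le_right t (1 - t)
    linarith

/-- Summation by parts for a slowly varying weight against powers of a root of unity. -/
theorem norm_sub_one_mul_sum_pow_mul_le (z : ℂ) (hz : ‖z‖ = 1) (u : ℕ → ℂ) (D : ℝ) (n : ℕ)
    (hu : ∀ k < n, ‖u (k + 1) - u k‖ ≤ D) :
    ‖(z - 1) * ∑ k ∈ Finset.range (n + 1), z ^ k * u k - (z ^ (n + 1) * u n - u 0)‖ ≤ n * D := by
  induction n with
  | zero => simp; ring_nf
  | succ n ih =>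
    have h := ih fun k hk => hu k (by omega)
    rw [Finset.sum_range_succ, mul_add]
    have e : (z - 1) * ∑ k ∈ Finset.range (n + 1), z ^ k * u k +
          (z - 1) * (z ^ (n + 1) * u (n + 1)) - (z ^ (n + 1 + 1) * u (n + 1) - u 0) =
        ((z - 1) * ∑ k ∈ Finset.range (n + 1), z ^ k * u k - (z ^ (n + 1) * u n - u 0)) -
          z ^ (n + 1) * (u (n + 1) - u n) := by ring
    rw [e]
    refine (norm_sub_le _ _).trans ?_
    rw [norm_mul, norm_pow, hz, one_pow, one_mul]
    have := hu n (by omega)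
    push_cast
    linarith

/-- Bound for the average of the character of frequency `n` over an almost equidistributed orbit
of length `q`. -/
noncomputable def charBound (C : ℝ) (q n : ℕ) : ℝ :=
  if n % q = 0 then min 2 (C * n / q ^ 2)
  else min 2 (C * n / q ^ 2 * (1 / ((n % q : ℕ) : ℝ) + 1 / ((q : ℝ) - (n % q : ℕ))))

/-- If `q` divides `n`, the character takes one value on all the points `x + k/q`, and only the
displacement `C/q^2` costs. Otherwise the exact rotation gives powers of a nontrivial root of unity
and the displacement a slowly varying factor, so summation by parts gains `1/|z - 1|`. -/
theorem norm_average_expChar_sub_le {q n : ℕ} (hq : 0 < q) {C x : ℝ} {y : ℕ → ℝ}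
    (h1 : ∀ k < q, |y k - x - k / q| ≤ C / q ^ 2)
    (h2 : ∀ k, k + 1 < q → |y (k + 1) - y k - 1 / q| ≤ C / q ^ 3) :
    ‖(1 / q : ℂ) * ∑ k ∈ Finset.range q, expChar (n * y k) -
        (if n % q = 0 then expChar (n * x) else 0)‖ ≤ charBound (2 * Real.pi * C) q n := by
  have hq' : (0 : ℝ) < q := by exact_mod_cast hq
  have hqc : (q : ℂ) ≠ 0 := by exact_mod_cast hq.ne'
  have hC : 0 ≤ C := by
    have := (abs_nonneg _).trans (h1 0 hq)
    rw [le_div_iff₀ (by positivity)] at this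
    linarith
  have hpi := Real.pi_pos
  have trivial_bound : ‖(1 / q : ℂ) * ∑ k ∈ Finset.range q, expChar (n * y k)‖ ≤ 1 := by
    rw [norm_mul]
    have : ‖∑ k ∈ Finset.range q, expChar (n * y k)‖ ≤ q := by
      refine (norm_sum_le _ _).trans ?_
      simp [norm_expChar]
    have h3 : ‖(1 / q : ℂ)‖ = 1 / q := by simp
    rw [h3]
    calc 1 / (q : ℝ) * _ ≤ 1 / q * q := by gcongr
      _ = 1 := by field_simp
  unfold charBound
  split_ifs with hn
  · refine le_min ?_ ?_
    · refine (norm_sub_le _ _).trans ?_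
      rw [norm_expChar]
      linarith
    · have e : (1 / q : ℂ) * ∑ k ∈ Finset.range q, expChar (n * y k) - expChar (n * x) =
          (1 / q : ℂ) * ∑ k ∈ Finset.range q, (expChar (n * y k) - expChar (n * x)) := by
        rw [Finset.sum_sub_distrib, mul_sub]
        simp only [Finset.sum_const, Finset.card_range, nsmul_eq_mul]
        field_simp
      rw [e, norm_mul]
      have h3 : ‖(1 / q : ℂ)‖ = 1 / q := by simp
      rw [h3]
      have h4 : ∀ k ∈ Finset.range q, ‖expChar (n * y k) - expChar (n * x)‖ ≤
          2 * Real.pi * (n * (C / q ^ 2)) := by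
        intro k hk
        obtain ⟨j, hj⟩ : q ∣ n := Nat.dvd_of_mod_eq_zero hn
        have h5 : expChar (n * x) = expChar (n * (x + k / q)) := by
          rw [mul_add, expChar_add]
          have : (n : ℝ) * (k / q) = ((j * k : ℕ) : ℝ) := by
            rw [hj]; push_cast; field_simp
          rw [this, expChar_natCast, mul_one]
        rw [h5]
        refine (norm_expChar_sub_le _ _).trans ?_
        gcongr
        rw [← mul_sub, abs_mul, Nat.abs_cast]
        gcongr
        rw [← sub_sub]
        exact h1 k (Finset.mem_range.1 hk)
      have h5 := norm_sum_le_of_le _ h4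
      simp only [Finset.sum_const, Finset.card_range, nsmul_eq_mul] at h5
      calc 1 / (q : ℝ) * _ ≤ 1 / q * (q * (2 * Real.pi * (n * (C / q ^ 2)))) := by gcongr
        _ = _ := by field_simp
  · rw [sub_zero]
    refine le_min (trivial_bound.trans (by norm_num)) ?_
    set r := n % q with hr
    have hrq : r < q := Nat.mod_lt _ hq
    have hr0 : 0 < r := Nat.pos_of_ne_zero hn
    have hrR : (0 : ℝ) < r := by exact_mod_cast hr0
    have hrqR : (r : ℝ) < q := by exact_mod_cast hrq
    -- Modulo `1`, `nk/q` equals `kr/q` with `r = n % q`; this splits the character into `z^k` and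
    -- the slowly varying `u k`.
    set z := expChar ((r : ℝ) / q) with hz
    set u : ℕ → ℂ := fun k => expChar (n * (y k - k / q)) with hu
    have hzk : ∀ k, expChar (n * y k) = z ^ k * u k := by
      intro k
      have e1 : (n : ℝ) * y k = ((n / q * k : ℕ) : ℝ) + (k * ((r : ℝ) / q) +
          n * (y k - k / q)) := by
        have : (n : ℝ) = q * (n / q : ℕ) + r := by
          exact_mod_cast (Nat.div_add_mod n q).symm
        have e2 : (n : ℝ) * (k / q) = ((n / q * k : ℕ) : ℝ) + k * ((r : ℝ) / q) := by
          rw [this]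
          push_cast
          field_simp
        rw [mul_sub, e2]
        ring
      rw [e1, expChar_add, expChar_add, expChar_natCast, one_mul, expChar_nat_mul]
    obtain ⟨p, rfl⟩ : ∃ p, q = p + 1 := ⟨q - 1, by omega⟩
    set q := p + 1 with hqdef
    have hzq : z ^ q = 1 := by
      rw [hz, ← expChar_nat_mul]
      have : (q : ℝ) * (r / q) = r := by field_simp
      rw [this, expChar_natCast]
    have hD : ∀ k < p, ‖u (k + 1) - u k‖ ≤ 2 * Real.pi * (n * (C / q ^ 3)) := by
      intro k hk
      refine (norm_expChar_sub_le _ _).trans ?_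
      gcongr
      rw [← mul_sub, abs_mul, Nat.abs_cast]
      gcongr
      have e : y (k + 1) - ((k + 1 : ℕ) : ℝ) / ((p + 1 : ℕ) : ℝ) - (y k - k / ((p + 1 : ℕ) : ℝ)) =
          y (k + 1) - y k - 1 / ((p + 1 : ℕ) : ℝ) := by
        rw [Nat.cast_succ k]
        ring
      rw [e]
      exact h2 k (by omega)
    have hsum := norm_sub_one_mul_sum_pow_mul_le z (norm_expChar _) u _ p hD
    have hend : ‖z ^ (p + 1) * u p - u 0‖ ≤ 2 * Real.pi * (n * (2 * (C / q ^ 2))) := by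
      rw [← hqdef, hzq, one_mul]
      refine (norm_expChar_sub_le _ _).trans ?_
      gcongr
      rw [← mul_sub, abs_mul, Nat.abs_cast]
      gcongr
      have a := h1 p (by omega)
      have b := h1 0 hq
      have e : y p - (p : ℝ) / q - (y 0 - ((0 : ℕ) : ℝ) / q) =
        (y p - x - p / q) - (y 0 - x - ((0 : ℕ) : ℝ) / q) := by ring
      rw [e]
      refine (abs_sub _ _).trans ?_
      linarith
    -- Two units of `C/q^2` come from the boundary terms and one from the accumulated increments.
    have htot : ‖(z - 1) * ∑ k ∈ Finset.range q, z ^ k * u k‖ ≤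
        2 * Real.pi * (n * (3 * (C / q ^ 2))) := by
      have := norm_add_le ((z - 1) * ∑ k ∈ Finset.range q, z ^ k * u k -
        (z ^ (p + 1) * u p - u 0)) (z ^ (p + 1) * u p - u 0)
      rw [sub_add_cancel] at this
      have hp : (p : ℝ) * (2 * Real.pi * (n * (C / q ^ 3))) ≤ 2 * Real.pi * (n * (C / q ^ 2)) := by
        have hpq : (p : ℝ) ≤ q := by exact_mod_cast Nat.le_succ p
        calc (p : ℝ) * (2 * Real.pi * (n * (C / q ^ 3))) ≤
            q * (2 * Real.pi * (n * (C / q ^ 3))) := by gcongr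
          _ = _ := by field_simp
      have hsum' := hsum
      rw [← hqdef] at hsum'
      linarith
    rw [norm_mul] at htot
    have hlow := le_norm_expChar_sub_one (t := (r : ℝ) / q) (by positivity)
      (by rw [div_le_one hq']; exact hrqR.le)
    simp_rw [hzk]
    rw [norm_mul]
    have h3 : ‖(1 / q : ℂ)‖ = 1 / q := by simp
    rw [h3]
    set S := ‖∑ k ∈ Finset.range q, z ^ k * u k‖ with hS
    have hS0 : 0 ≤ S := norm_nonneg _
    have hqr : (0 : ℝ) < q - r := by linarith
    -- `q (1/r + 1/(q-r))` dominates the inverse of the distance from `r/q` to the integers.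
    have hmin : 1 ≤ min ((r : ℝ) / q) (1 - r / q) * (q * (1 / r + 1 / (q - r))) := by
      rcases min_choice ((r : ℝ) / q) (1 - r / q) with h | h <;> rw [h]
      · have : (r : ℝ) / q * (q * (1 / r + 1 / (q - r))) = 1 + r / (q - r) := by field_simp
        rw [this]
        have : 0 ≤ (r : ℝ) / (q - r) := by positivity
        linarith
      · have : (1 - (r : ℝ) / q) * (q * (1 / r + 1 / (q - r))) = (q - r) / r + 1 := by field_simp
        rw [this]
        have : 0 ≤ ((q : ℝ) - r) / r := by positivity
        linarith
    have hw : 0 ≤ (q : ℝ) * (1 / r + 1 / (q - r)) := by positivity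
    have h6 : 4 * S ≤ 2 * Real.pi * (n * (3 * (C / q ^ 2))) * (q * (1 / r + 1 / (q - r))) := by
      calc 4 * S ≤ 4 * S * (min ((r : ℝ) / q) (1 - r / q) * (q * (1 / r + 1 / (q - r)))) := by
            nlinarith
        _ = (4 * min ((r : ℝ) / q) (1 - r / q)) * S * (q * (1 / r + 1 / (q - r))) := by ring
        _ ≤ (‖z - 1‖ * S) * (q * (1 / r + 1 / (q - r))) := by gcongr
        _ ≤ _ := by gcongr
    calc 1 / (q : ℝ) * S ≤ 1 / q *
          ((2 * Real.pi * (n * (3 * (C / q ^ 2))) * (q * (1 / r + 1 / (q - r)))) / 4) := by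
          gcongr; linarith
      -- Three units of variation over the `4` of the lower bound for `|z - 1|`; the factor is below
      -- `1` and is dropped.
      _ = 3 / 4 * (2 * Real.pi * C * n / q ^ 2 * (1 / r + 1 / (q - r))) := by field_simp
      _ ≤ _ := by
        have : 0 ≤ 2 * Real.pi * C * n / q ^ 2 * (1 / r + 1 / (q - r) : ℝ) := by positivity
        linarith

end Billiard

/-! ### Total weight of the non-resonant frequencies. -/

namespace Billiard
open Finset

theorem sum_inv_sqrt_le (q : ℕ) : ∑ r ∈ range q, 1 / ((r : ℝ) + 1) ^ (1 / 2 : ℝ) ≤ 2 * (q : ℝ) ^ (1 / 2 : ℝ) := by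
  simp_rw [← Real.sqrt_eq_rpow]
  induction q with
  | zero => simp
  | succ n ih =>
    rw [sum_range_succ]
    have h1 : 0 < √((n : ℝ) + 1) := Real.sqrt_pos.2 (by positivity)
    have h2 : √(n : ℝ) ^ 2 = n := Real.sq_sqrt (by positivity)
    have h3 : √((n : ℝ) + 1) ^ 2 = n + 1 := Real.sq_sqrt (by positivity)
    have h4 : 1 / √((n : ℝ) + 1) ≤ 2 * (√((n : ℝ) + 1) - √n) := by
      rw [div_le_iff₀ h1]
      nlinarith [sq_nonneg (√((n : ℝ) + 1) - √(n : ℝ)), Real.sqrt_nonneg (n : ℝ)]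
    push_cast
    linarith

theorem sum_inv_le (q : ℕ) : ∑ r ∈ range q, 1 / ((r : ℝ) + 1) ≤ 1 + Real.log q := by
  have := harmonic_le_one_add_log q
  rw [harmonic] at this
  push_cast at this
  simpa [one_div] using this

/-- Interpolates between the trivial bound and the bound by summation by parts. The exponent `θ` is
fixed later so that both the sum over residues and the sum over blocks of length `q` are controlled.
-/
theorem min_two_le_rpow {z θ : ℝ} (hz : 0 ≤ z) (h0 : 0 ≤ θ) (h1 : θ ≤ 1) : min 2 z ≤ 2 * z ^ θ := by
  rcases le_total 1 z with h | h
  · have := Real.one_le_rpow h h0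
    exact (min_le_left _ _).trans (by linarith)
  · have h2 : z ≤ z ^ θ := by
      rcases hz.eq_or_lt with h3 | h3
      · rw [← h3]; positivity
      · simpa using Real.rpow_le_rpow_of_exponent_ge h3 h h1
    have : 0 ≤ z ^ θ := by positivity
    exact (min_le_right _ _).trans (by linarith)

theorem charBound_nonneg {C : ℝ} (hC : 0 ≤ C) {q : ℕ} (hq : 0 < q) (n : ℕ) : 0 ≤ charBound C q n := by
  have : ((n % q : ℕ) : ℝ) < q := by exact_mod_cast Nat.mod_lt n hq
  have h2 : 0 ≤ (q : ℝ) - (n % q : ℕ) := by linarith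
  unfold charBound
  split_ifs <;> positivity

theorem sum_range_mul_eq (F : ℕ → ℝ) (M q : ℕ) :
    ∑ n ∈ range (M * q), F n = ∑ J ∈ range M, ∑ r ∈ range q, F (J * q + r) := by
  induction M with
  | zero => simp
  | succ M ih => rw [Nat.succ_mul, sum_range_add, ih, sum_range_succ]

theorem sum_range_one_div_reflect (q : ℕ) (g : ℝ → ℝ) :
    ∑ r ∈ range q, g ((((q + 1 : ℕ) : ℝ)) - ((r + 1 : ℕ) : ℝ)) = ∑ r ∈ range q, g ((r : ℝ) + 1) := by
  rw [← sum_range_reflect]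
  refine sum_congr rfl fun r hr => ?_
  have := mem_range.1 hr
  congr 1
  have h : ((q - 1 - r : ℕ) : ℝ) = q - 1 - r := by
    rw [Nat.cast_sub (by omega), Nat.cast_sub (by omega)]; simp
  push_cast
  rw [h]
  ring

/-- Below `q` a frequency is its own residue, so `n^(1-γ) · n ≤ 1` and only the harmonic sum and its
reflection remain. -/
theorem sum_first_block_le {γ C : ℝ} (h2 : 2 < γ) (hC : 0 ≤ C) {q : ℕ} (hq : 0 < q) :
    ∑ r ∈ range q, (r : ℝ) ^ (1 - γ) * charBound C q r ≤ 2 * C * (1 + Real.log q) / q ^ 2 := by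
  obtain ⟨p, rfl⟩ : ∃ p, q = p + 1 := ⟨q - 1, by omega⟩
  rw [sum_range_succ']
  -- A nonzero real power of `0` is `0`, so the frequency `0` drops out.
  have h0 : ((0 : ℕ) : ℝ) ^ (1 - γ) = 0 := by
    rw [Nat.cast_zero, Real.zero_rpow (by linarith)]
  rw [h0, zero_mul, add_zero]
  have hterm : ∀ r ∈ range p, ((r + 1 : ℕ) : ℝ) ^ (1 - γ) * charBound C (p + 1) (r + 1) ≤
      C / ((p + 1 : ℕ) : ℝ) ^ 2 * (1 / ((r : ℝ) + 1) + 1 / (((p + 1 : ℕ) : ℝ) - ((r + 1 : ℕ) : ℝ))) := by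
    intro r hr
    have hr := mem_range.1 hr
    have hmod : (r + 1) % (p + 1) = r + 1 := Nat.mod_eq_of_lt (by omega)
    have hpos : (0 : ℝ) < ((p + 1 : ℕ) : ℝ) - ((r + 1 : ℕ) : ℝ) := by
      have : ((r + 1 : ℕ) : ℝ) < ((p + 1 : ℕ) : ℝ) := by exact_mod_cast (by omega)
      linarith
    unfold charBound
    rw [hmod, if_neg (by omega)]
    set R : ℝ := ((r + 1 : ℕ) : ℝ) with hR
    have hR1 : 1 ≤ R := by rw [hR]; exact_mod_cast Nat.le_add_left 1 r
    have hR' : (r : ℝ) + 1 = R := by rw [hR]; push_cast; ring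
    rw [hR']
    set Q : ℝ := ((p + 1 : ℕ) : ℝ) with hQ
    calc R ^ (1 - γ) * min 2 (C * R / Q ^ 2 * (1 / R + 1 / (Q - R)))
        ≤ R ^ (1 - γ) * (C * R / Q ^ 2 * (1 / R + 1 / (Q - R))) := by
          gcongr; exact min_le_right _ _
      _ = C / Q ^ 2 * (R ^ (1 - γ) * R * (1 / R + 1 / (Q - R))) := by ring
      _ ≤ C / Q ^ 2 * (1 * (1 / R + 1 / (Q - R))) := by
          have : R ^ (1 - γ) * R ≤ 1 := by
            have h3 : R ^ (1 - γ) * R = R ^ (2 - γ) := by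
              rw [← Real.rpow_add_one (by positivity)]; congr 1; ring
            rw [h3]
            exact Real.rpow_le_one_of_one_le_of_nonpos hR1 (by linarith)
          gcongr
      _ = _ := by rw [one_mul]
  refine (sum_le_sum hterm).trans ?_
  rw [← mul_sum, sum_add_distrib, sum_range_one_div_reflect p (fun t => 1 / t)]
  have h3 := sum_inv_le p
  have h4 : Real.log p ≤ Real.log ((p + 1 : ℕ) : ℝ) := by
    rcases Nat.eq_zero_or_pos p with rfl | hp
    · simp
    · exact Real.log_le_log (by exact_mod_cast hp) (by push_cast; linarith)
  calc C / ((p + 1 : ℕ) : ℝ) ^ 2 * _ ≤ C / ((p + 1 : ℕ) : ℝ) ^ 2 *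
        ((1 + Real.log ((p + 1 : ℕ) : ℝ)) + (1 + Real.log ((p + 1 : ℕ) : ℝ))) := by gcongr <;> linarith
    _ = _ := by ring

/-- On the block of frequencies from `Jq` to `(J+1)q` the factors `n^(1-γ)` and `n/q^2` are replaced
by `(Jq)^(1-γ)` and `2J/q`. Since `θ > 1/2`, the power `θ` of the residue factor is at most a sum of
inverse square roots, whose total over the block is of order `q^(1/2)`. -/
theorem sum_block_le {γ θ C : ℝ} (h2 : 2 < γ) (hθ : 1 / 2 < θ) (hθ1 : θ ≤ 1) (hC : 0 ≤ C) {q : ℕ}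
    (hq : 0 < q) {J : ℕ} (hJ : 0 < J) :
    ∑ r ∈ range q, ((J * q + r : ℕ) : ℝ) ^ (1 - γ) * charBound C q (J * q + r) ≤
      10 * (2 * C) ^ θ * (J : ℝ) ^ (1 - γ + θ) * ((q : ℝ) ^ (1 - γ) * (q : ℝ) ^ (1 / 2 - θ)) := by
  have hJR : (0 : ℝ) < J := by exact_mod_cast hJ
  have hqR : (0 : ℝ) < q := by exact_mod_cast hq
  have hpow : ∀ r : ℕ, ((J * q + r : ℕ) : ℝ) ^ (1 - γ) ≤ ((J : ℝ) * q) ^ (1 - γ) := by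
    intro r
    refine Real.rpow_le_rpow_of_nonpos (by positivity) ?_ (by linarith)
    push_cast
    linarith [(Nat.cast_nonneg r : (0 : ℝ) ≤ r)]
  have hb : ∀ r < q, charBound C q (J * q + r) ≤
      if r = 0 then 2 * (2 * C * J / q) ^ θ
      else 2 * (2 * C * J / q) ^ θ *
        (1 / (r : ℝ) ^ (1 / 2 : ℝ) + 1 / ((q : ℝ) - r) ^ (1 / 2 : ℝ)) := by
    intro r hr
    have hrR : (r : ℝ) < q := by exact_mod_cast hr
    have hmod : (J * q + r) % q = r := by
      rw [Nat.mul_add_mod_self_right, Nat.mod_eq_of_lt hr]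
    have hle : C * ((J * q + r : ℕ) : ℝ) / q ^ 2 ≤ 2 * C * J / q := by
      have : ((J * q + r : ℕ) : ℝ) ≤ 2 * (J * q) := by
        push_cast
        have : (1 : ℝ) ≤ J := by exact_mod_cast hJ
        nlinarith
      calc C * ((J * q + r : ℕ) : ℝ) / q ^ 2 ≤ C * (2 * (J * q)) / q ^ 2 := by gcongr
        _ = _ := by field_simp
    unfold charBound
    rw [hmod]
    split_ifs with h0
    · refine (min_le_min_left 2 hle).trans (min_two_le_rpow (by positivity) (by linarith) hθ1)
    · have hr1 : (1 : ℝ) ≤ r := by exact_mod_cast Nat.pos_of_ne_zero h0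
      have hqr1 : (1 : ℝ) ≤ (q : ℝ) - r := by
        have : (r : ℝ) + 1 ≤ q := by exact_mod_cast hr
        linarith
      have hinv : ∀ t : ℝ, 1 ≤ t → (1 / t) ^ θ ≤ 1 / t ^ (1 / 2 : ℝ) := by
        intro t ht
        rw [Real.div_rpow (by norm_num) (by linarith), Real.one_rpow]
        refine one_div_le_one_div_of_le (Real.rpow_pos_of_pos (by linarith) _) ?_
        exact Real.rpow_le_rpow_of_exponent_le ht hθ.le
      refine (min_le_min_left 2 (mul_le_mul_of_nonneg_right hle (by positivity))).trans ?_
      refine (min_two_le_rpow (by positivity) (by linarith) hθ1).trans ?_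
      rw [Real.mul_rpow (by positivity) (by positivity), ← mul_assoc]
      gcongr
      refine (Real.rpow_add_le_add_rpow (by positivity) (by positivity) (by linarith) hθ1).trans ?_
      exact add_le_add (hinv _ hr1) (hinv _ hqr1)
  set A : ℝ := 2 * (2 * C * J / q) ^ θ with hA
  have hA0 : 0 ≤ A := by positivity
  -- The `5` is twice the constant `2` of `sum_inv_sqrt_le`, for the residues and their reflections,
  -- plus `1` for the residue zero.
  have hsum : ∑ r ∈ range q, charBound C q (J * q + r) ≤ A * (5 * (q : ℝ) ^ (1 / 2 : ℝ)) := by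
    obtain ⟨p, hp⟩ : ∃ p, q = p + 1 := ⟨q - 1, by omega⟩
    have h5 : ∑ r ∈ range q, charBound C q (J * q + r) ≤ ∑ r ∈ range q, (if r = 0 then A else
        A * (1 / (r : ℝ) ^ (1 / 2 : ℝ) + 1 / ((q : ℝ) - r) ^ (1 / 2 : ℝ))) :=
      sum_le_sum fun r hr => hb r (mem_range.1 hr)
    refine h5.trans ?_
    rw [hp, sum_range_succ']
    simp only [Nat.succ_ne_zero, if_false, if_true]
    rw [← mul_sum, sum_add_distrib,
      sum_range_one_div_reflect p (fun t => 1 / t ^ (1 / 2 : ℝ))]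
    have h6 := sum_inv_sqrt_le p
    have h7 : (p : ℝ) ^ (1 / 2 : ℝ) ≤ ((p + 1 : ℕ) : ℝ) ^ (1 / 2 : ℝ) := by
      apply Real.rpow_le_rpow (by positivity) (by push_cast; linarith) (by norm_num)
    have h8 : (1 : ℝ) ≤ ((p + 1 : ℕ) : ℝ) ^ (1 / 2 : ℝ) := by
      apply Real.one_le_rpow (by push_cast; linarith [(Nat.cast_nonneg p : (0 : ℝ) ≤ p)]) (by norm_num)
    have e : ∀ r : ℕ, ((r + 1 : ℕ) : ℝ) = (r : ℝ) + 1 := fun r => by push_cast; ring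
    simp_rw [e] at *
    nlinarith
  calc ∑ r ∈ range q, ((J * q + r : ℕ) : ℝ) ^ (1 - γ) * charBound C q (J * q + r)
      ≤ ∑ r ∈ range q, ((J : ℝ) * q) ^ (1 - γ) * charBound C q (J * q + r) := by
        refine sum_le_sum fun r _ => mul_le_mul_of_nonneg_right (hpow r) (charBound_nonneg hC hq _)
    _ = ((J : ℝ) * q) ^ (1 - γ) * ∑ r ∈ range q, charBound C q (J * q + r) := by rw [mul_sum]
    _ ≤ ((J : ℝ) * q) ^ (1 - γ) * (A * (5 * (q : ℝ) ^ (1 / 2 : ℝ))) := by gcongr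
    _ = _ := by
      rw [hA, Real.div_rpow (by positivity) hqR.le, Real.mul_rpow (by positivity) hJR.le,
        Real.mul_rpow hJR.le hqR.le, Real.rpow_add hJR, Real.rpow_sub hqR (1 / 2) θ]
      ring

/-- The total weight of the frequencies that are not seen by the average over `q` equidistributed
points is of smaller order than `q ^ (1 - γ)`. -/
theorem exists_tendsto_sum_charBound_le {γ C : ℝ} (h2 : 5 / 2 < γ) (h3 : γ < 3) (hC : 0 ≤ C) :
    ∃ ε : ℕ → ℝ, Filter.Tendsto ε Filter.atTop (nhds 0) ∧ ∀ q : ℕ, 0 < q → ∀ N : ℕ,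
      ∑ n ∈ range N, (n : ℝ) ^ (1 - γ) * charBound C q n ≤ ε q * (q : ℝ) ^ (1 - γ) := by
  -- The midpoint of `1/2` and `γ - 2`. Above `1/2`, the factor `q^(1/2-θ)` tends to zero; below `γ
  -- - 2`, the sum over blocks converges. The interval is nonempty exactly when `γ > 5/2`.
  set θ : ℝ := (γ - 3 / 2) / 2 with hθ
  have hsum : Summable fun J : ℕ => (J : ℝ) ^ (1 - γ + θ) :=
    Real.summable_nat_rpow.2 (by rw [hθ]; linarith)
  set K := ∑' J : ℕ, (J : ℝ) ^ (1 - γ + θ) with hK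
  refine ⟨fun q => 2 * C * ((1 + Real.log q) * (q : ℝ) ^ (γ - 3)) +
    10 * (2 * C) ^ θ * K * (q : ℝ) ^ (1 / 2 - θ), ?_, ?_⟩
  · have t1 : Filter.Tendsto (fun x : ℝ => x ^ (γ - 3)) Filter.atTop (nhds 0) := by
      have := tendsto_rpow_neg_atTop (y := 3 - γ) (by linarith)
      simpa using this
    have t2 : Filter.Tendsto (fun x : ℝ => Real.log x * x ^ (γ - 3)) Filter.atTop (nhds 0) := by
      have := (isLittleO_log_rpow_atTop (r := 3 - γ) (by linarith)).tendsto_div_nhds_zero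
      refine this.congr' ?_
      filter_upwards [Filter.eventually_gt_atTop 0] with x hx
      rw [div_eq_mul_inv, ← Real.rpow_neg hx.le]
      congr 2; ring
    have t3 : Filter.Tendsto (fun x : ℝ => x ^ (1 / 2 - θ)) Filter.atTop (nhds 0) := by
      have := tendsto_rpow_neg_atTop (y := θ - 1 / 2) (by rw [hθ]; linarith)
      simpa using this
    have t4 := ((t1.add t2).const_mul (2 * C)).add (t3.const_mul (10 * (2 * C) ^ θ * K))
    simp only [add_zero, mul_zero] at t4
    refine (t4.comp tendsto_natCast_atTop_atTop).congr fun q => ?_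
    simp only [Function.comp]
    ring
  · intro q hq N
    have hqR : (0 : ℝ) < q := by exact_mod_cast hq
    have hnn : ∀ n : ℕ, 0 ≤ (n : ℝ) ^ (1 - γ) * charBound C q n := fun n =>
      mul_nonneg (by positivity) (charBound_nonneg hC hq n)
    have hN : N ≤ (N + 1) * q := by nlinarith
    refine (sum_le_sum_of_subset_of_nonneg (range_subset_range.2 hN) fun n _ _ => hnn n).trans ?_
    -- The block `J = 0` is separated: it gives the logarithmic term, and `γ < 3` makes it
    -- negligible.
    rw [sum_range_mul_eq, sum_range_succ', add_comm]
    simp only [zero_mul, zero_add]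
    rw [add_mul]
    refine add_le_add ?_ ?_
    · refine (sum_first_block_le (by linarith) hC hq).trans (le_of_eq ?_)
      have : (q : ℝ) ^ (γ - 3) * (q : ℝ) ^ (1 - γ) = 1 / q ^ 2 := by
        rw [← Real.rpow_add hqR, show γ - 3 + (1 - γ) = -(2 : ℕ) by push_cast; ring,
          Real.rpow_neg hqR.le, Real.rpow_natCast, one_div]
      calc 2 * C * (1 + Real.log q) / q ^ 2 = 2 * C * (1 + Real.log q) * (1 / q ^ 2) := by ring
        _ = _ := by rw [← this]; ring
    · have h4 : ∀ J ∈ range N, ∑ r ∈ range q, (((J + 1) * q + r : ℕ) : ℝ) ^ (1 - γ) *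
          charBound C q ((J + 1) * q + r) ≤ ((J + 1 : ℕ) : ℝ) ^ (1 - γ + θ) *
            (10 * (2 * C) ^ θ * ((q : ℝ) ^ (1 - γ) * (q : ℝ) ^ (1 / 2 - θ))) := by
        intro J _
        refine (sum_block_le (by linarith) (θ := θ) (by rw [hθ]; linarith) (by rw [hθ]; linarith)
          hC hq (Nat.succ_pos J)).trans (le_of_eq ?_)
        ring
      refine (sum_le_sum h4).trans ?_
      rw [← sum_mul]
      have h5 : ∑ J ∈ range N, ((J + 1 : ℕ) : ℝ) ^ (1 - γ + θ) ≤ K := by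
        have := hsum.sum_le_tsum (range (N + 1)) (fun _ _ => by positivity)
        rw [sum_range_succ'] at this
        have h6 : 0 ≤ ((0 : ℕ) : ℝ) ^ (1 - γ + θ) := by positivity
        linarith
      calc _ ≤ K * (10 * (2 * C) ^ θ * ((q : ℝ) ^ (1 - γ) * (q : ℝ) ^ (1 / 2 - θ))) := by gcongr
        _ = _ := by ring
end Billiard

/-! ### Fourier series of functions in `X^γ`. -/

namespace Billiard
open Finset MeasureTheory

/-- The Fourier coefficient of `cos 2πnx` for `n : ℕ`, set to be zero for `n = 0`. -/
noncomputable def cosCoeff (f : C(UnitAddCircle, ℝ)) (n : ℕ) : ℝ :=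
  if h : 0 < n then coeffCos f ⟨n, h⟩ else 0

/-- The Fourier coefficient of `sin 2πnx` for `n : ℕ`, set to be zero for `n = 0`. -/
noncomputable def sinCoeff (f : C(UnitAddCircle, ℝ)) (n : ℕ) : ℝ :=
  if h : 0 < n then coeffSin f ⟨n, h⟩ else 0

theorem cosCoeff_succ (f : C(UnitAddCircle, ℝ)) (n : ℕ) :
    cosCoeff f (n + 1) = 2 * ∫ x in (0 : ℝ)..1, lift f x * Real.cos (2 * Real.pi * (n + 1 : ℕ) * x) := by
  rw [cosCoeff, dif_pos n.succ_pos]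
  rfl

theorem sinCoeff_succ (f : C(UnitAddCircle, ℝ)) (n : ℕ) :
    sinCoeff f (n + 1) = 2 * ∫ x in (0 : ℝ)..1, lift f x * Real.sin (2 * Real.pi * (n + 1 : ℕ) * x) := by
  rw [sinCoeff, dif_pos n.succ_pos]
  rfl

theorem hNorm_nonneg (γ : ℝ) (c : RSeq) : 0 ≤ hNorm γ c :=
  (abs_nonneg _).trans (le_max_left _ _)

theorem XNorm_nonneg (γ : ℝ) (f : C(UnitAddCircle, ℝ)) : 0 ≤ XNorm γ f := hNorm_nonneg _ _

theorem weighted_le_hNorm {γ : ℝ} {c : RSeq} (hc : c ∈ hSpace γ) (j : ℕ+) :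
    weighted γ c j ≤ hNorm γ c :=
  (le_ciSup (f := fun j => weighted γ c j) hc j).trans (le_max_right _ _)

theorem abs_fst_le_of_mem_hSpace {γ : ℝ} {c : RSeq} (hc : c ∈ hSpace γ) (j : ℕ+) :
    |(c.2 j).1| ≤ hNorm γ c * (j : ℝ) ^ (-γ) := by
  have h := weighted_le_hNorm hc j
  have hj : (0 : ℝ) < j := by exact_mod_cast j.pos
  rw [Real.rpow_neg hj.le, ← div_eq_mul_inv, le_div_iff₀ (by positivity), mul_comm]
  exact (mul_le_mul_of_nonneg_left (le_max_left _ _) (by positivity)).trans h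

theorem abs_snd_le_of_mem_hSpace {γ : ℝ} {c : RSeq} (hc : c ∈ hSpace γ) (j : ℕ+) :
    |(c.2 j).2| ≤ hNorm γ c * (j : ℝ) ^ (-γ) := by
  have h := weighted_le_hNorm hc j
  have hj : (0 : ℝ) < j := by exact_mod_cast j.pos
  rw [Real.rpow_neg hj.le, ← div_eq_mul_inv, le_div_iff₀ (by positivity), mul_comm]
  exact (mul_le_mul_of_nonneg_left (le_max_right _ _) (by positivity)).trans h

theorem abs_cosCoeff_le {γ : ℝ} {f : C(UnitAddCircle, ℝ)} (hf : f ∈ XSpace γ) (n : ℕ) :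
    |cosCoeff f n| ≤ XNorm γ f * (n : ℝ) ^ (-γ) := by
  unfold cosCoeff
  split_ifs with h
  · exact abs_fst_le_of_mem_hSpace (c := fourierSeq f) hf ⟨n, h⟩
  · rw [abs_zero]
    have := XNorm_nonneg γ f
    positivity

theorem abs_sinCoeff_le {γ : ℝ} {f : C(UnitAddCircle, ℝ)} (hf : f ∈ XSpace γ) (n : ℕ) :
    |sinCoeff f n| ≤ XNorm γ f * (n : ℝ) ^ (-γ) := by
  unfold sinCoeff
  split_ifs with h
  · exact abs_snd_le_of_mem_hSpace (c := fourierSeq f) hf ⟨n, h⟩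
  · rw [abs_zero]
    have := XNorm_nonneg γ f
    positivity

theorem abs_coeffZero_le_XNorm (γ : ℝ) (f : C(UnitAddCircle, ℝ)) : |coeffZero f| ≤ XNorm γ f :=
  le_max_left _ _

/-- A continuous function on the circle seen as a complex-valued function. -/
noncomputable def complexify (f : C(UnitAddCircle, ℝ)) : C(UnitAddCircle, ℂ) :=
  ⟨fun x => (f x : ℂ), by fun_prop⟩

theorem fourierCoeff_complexify (f : C(UnitAddCircle, ℝ)) (n : ℤ) :
    fourierCoeff (complexify f) n =
      ((∫ x in (0 : ℝ)..1, lift f x * Real.cos (2 * Real.pi * n * x) : ℝ) : ℂ) -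
      Complex.I * ((∫ x in (0 : ℝ)..1, lift f x * Real.sin (2 * Real.pi * n * x) : ℝ) : ℂ) := by
  rw [fourierCoeff_eq_intervalIntegral _ _ 0]
  have hc := continuous_lift f
  rw [← intervalIntegral.integral_ofReal, ← intervalIntegral.integral_ofReal,
    ← intervalIntegral.integral_const_mul, ← intervalIntegral.integral_sub]
  · simp only [zero_add, div_one, one_smul]
    refine intervalIntegral.integral_congr fun x _ => ?_
    simp only [smul_eq_mul]
    rw [fourier_coe_apply]
    have e : (2 * Real.pi * Complex.I * ((-n : ℤ) : ℂ) * x / (1 : ℝ) : ℂ) =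
        ((-(2 * Real.pi * n * x) : ℝ) : ℂ) * Complex.I := by push_cast; ring
    rw [e, Complex.exp_mul_I, ← Complex.ofReal_cos, ← Complex.ofReal_sin, Real.cos_neg, Real.sin_neg]
    change _ * ((lift f x : ℝ) : ℂ) = _
    push_cast
    ring
  · exact Continuous.intervalIntegrable (by fun_prop) _ _
  · exact Continuous.intervalIntegrable (by fun_prop) _ _

theorem fourierCoeff_complexify_zero (f : C(UnitAddCircle, ℝ)) :
    fourierCoeff (complexify f) 0 = coeffZero f := by
  rw [fourierCoeff_complexify]
  simp [coeffZero]

theorem fourierCoeff_complexify_succ (f : C(UnitAddCircle, ℝ)) (n : ℕ) :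
    fourierCoeff (complexify f) ((n : ℤ) + 1) =
      ((cosCoeff f (n + 1) : ℝ) - Complex.I * (sinCoeff f (n + 1) : ℝ)) / 2 := by
  rw [fourierCoeff_complexify, cosCoeff_succ, sinCoeff_succ]
  push_cast
  ring

theorem fourierCoeff_complexify_neg_succ (f : C(UnitAddCircle, ℝ)) (n : ℕ) :
    fourierCoeff (complexify f) (-((n : ℤ) + 1)) =
      ((cosCoeff f (n + 1) : ℝ) + Complex.I * (sinCoeff f (n + 1) : ℝ)) / 2 := by
  rw [fourierCoeff_complexify, cosCoeff_succ, sinCoeff_succ]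
  have e : ∀ x : ℝ, 2 * Real.pi * ((-((n : ℤ) + 1) : ℤ) : ℝ) * x = -(2 * Real.pi * (n + 1 : ℕ) * x) := by
    intro x; push_cast; ring
  simp_rw [e, Real.cos_neg, Real.sin_neg, mul_neg, intervalIntegral.integral_neg]
  push_cast
  ring

/-- The term of frequency `n` of the Fourier series. -/
noncomputable def fourierTerm (f : C(UnitAddCircle, ℝ)) (n : ℕ) (x : ℝ) : ℝ :=
  cosCoeff f n * Real.cos (2 * Real.pi * n * x) + sinCoeff f n * Real.sin (2 * Real.pi * n * x)

theorem fourierTerm_zero (f : C(UnitAddCircle, ℝ)) (x : ℝ) : fourierTerm f 0 x = 0 := by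
  simp [fourierTerm, cosCoeff, sinCoeff]

theorem abs_mul_add_mul_le {a b u v A : ℝ} (ha : |a| ≤ A) (hb : |b| ≤ A) (hu : |u| ≤ 1) (hv : |v| ≤ 1) :
    |a * u + b * v| ≤ 2 * A := by
  have h1 : |a * u| ≤ A * 1 := by
    rw [abs_mul]; exact mul_le_mul ha hu (abs_nonneg _) ((abs_nonneg _).trans ha)
  have h2 : |b * v| ≤ A * 1 := by
    rw [abs_mul]; exact mul_le_mul hb hv (abs_nonneg _) ((abs_nonneg _).trans hb)
  have := abs_add_le (a * u) (b * v)
  linarith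

theorem abs_fourierTerm_le {γ : ℝ} {f : C(UnitAddCircle, ℝ)} (hf : f ∈ XSpace γ) (n : ℕ) (x : ℝ) :
    |fourierTerm f n x| ≤ 2 * (XNorm γ f * (n : ℝ) ^ (-γ)) :=
  abs_mul_add_mul_le (abs_cosCoeff_le hf n) (abs_sinCoeff_le hf n) (Real.abs_cos_le_one _)
    (Real.abs_sin_le_one _)

theorem summable_rpow_neg {γ : ℝ} (hγ : 1 < γ) (M : ℝ) :
    Summable fun n : ℕ => M * (n : ℝ) ^ (-γ) :=
  (Real.summable_nat_rpow.2 (by linarith)).mul_left _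

/-- For `γ > 1` the complex Fourier coefficients are absolutely summable, so the series converges
pointwise to the function; pairing the frequencies `n` and `-n` and taking real parts gives the real
form. -/
theorem hasSum_fourierTerm {γ : ℝ} (hγ : 1 < γ) {f : C(UnitAddCircle, ℝ)} (hf : f ∈ XSpace γ) (x : ℝ) :
    HasSum (fun n => fourierTerm f n x) (lift f x - coeffZero f) := by
  have hs : Summable fun n : ℕ => 2 * (XNorm γ f * ((n + 1 : ℕ) : ℝ) ^ (-γ)) :=
    ((summable_nat_add_iff 1).2 (summable_rpow_neg hγ (XNorm γ f))).mul_left 2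
  have hbound : ∀ n : ℕ, ∀ s : ℂ, ‖s‖ ≤ 1 → ‖((cosCoeff f (n + 1) : ℝ) + s * (sinCoeff f (n + 1) : ℝ) : ℂ) / 2‖ ≤
      2 * (XNorm γ f * ((n + 1 : ℕ) : ℝ) ^ (-γ)) := by
    intro n s hs
    rw [norm_div]
    have h1 := norm_add_le ((cosCoeff f (n + 1) : ℝ) : ℂ) (s * (sinCoeff f (n + 1) : ℝ) : ℂ)
    rw [norm_mul, Complex.norm_real, Complex.norm_real, Real.norm_eq_abs, Real.norm_eq_abs] at h1
    have h2 := abs_cosCoeff_le hf (n + 1)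
    have h3 := abs_sinCoeff_le hf (n + 1)
    have h4 := mul_le_of_le_one_left (abs_nonneg (sinCoeff f (n + 1))) hs
    have h5 : ‖(2 : ℂ)‖ = 2 := by norm_num
    rw [h5]
    have h6 := abs_nonneg (cosCoeff f (n + 1))
    linarith
  have hsum : Summable (fourierCoeff (complexify f)) := by
    refine Summable.of_nat_of_neg_add_one ?_ ?_
    · rw [← summable_nat_add_iff 1]
      refine Summable.of_norm_bounded hs fun n => ?_
      push_cast
      rw [fourierCoeff_complexify_succ]
      have := hbound n (-Complex.I) (by simp)
      rw [neg_mul, ← sub_eq_add_neg] at this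
      simpa using this
    · refine Summable.of_norm_bounded hs fun n => ?_
      rw [fourierCoeff_complexify_neg_succ]
      exact hbound n Complex.I (by simp)
  have h1 := has_pointwise_sum_fourier_series_of_summable hsum (x : UnitAddCircle)
  have h2 := (HasSum.nat_add_neg h1)
  rw [fourierCoeff_complexify_zero] at h2
  have h3 := (hasSum_nat_add_iff' 1).2 h2
  have h4 := Complex.hasSum_re h3
  rw [← hasSum_nat_add_iff' 1]
  simp only [range_one, sum_singleton, fourierTerm_zero, sub_zero]
  convert! h4 using 1
  · funext n
    rw [Nat.cast_add, Nat.cast_one, fourierCoeff_complexify_succ, fourierCoeff_complexify_neg_succ]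
    rw [fourier_coe_apply, fourier_coe_apply]
    have e1 : (2 * Real.pi * Complex.I * (((n : ℤ) + 1 : ℤ) : ℂ) * x / (1 : ℝ) : ℂ) =
        ((2 * Real.pi * (n + 1 : ℕ) * x : ℝ) : ℂ) * Complex.I := by push_cast; ring
    have e2 : (2 * Real.pi * Complex.I * ((-((n : ℤ) + 1) : ℤ) : ℂ) * x / (1 : ℝ) : ℂ) =
        ((-(2 * Real.pi * (n + 1 : ℕ) * x) : ℝ) : ℂ) * Complex.I := by push_cast; ring
    rw [e1, e2, Complex.exp_mul_I, Complex.exp_mul_I, ← Complex.ofReal_cos, ← Complex.ofReal_sin,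
      ← Complex.ofReal_cos, ← Complex.ofReal_sin, Real.cos_neg, Real.sin_neg, fourierTerm]
    generalize 2 * Real.pi * ((n + 1 : ℕ) : ℝ) * x = t
    simp [-Complex.ofReal_cos, -Complex.ofReal_sin]
    ring
  · simp only [range_one, sum_singleton, Nat.cast_zero, neg_zero, fourierCoeff_complexify_zero]
    simp [complexify, lift]

end Billiard

/-! ### Termwise differentiation and the resonant part of an orbit average. -/

namespace Billiard
open Finset MeasureTheory

/-- The derivative of the term of frequency `n` of the Fourier series. -/
noncomputable def fourierTermDeriv (f : C(UnitAddCircle, ℝ)) (n : ℕ) (x : ℝ) : ℝ :=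
  2 * Real.pi * n * (-(cosCoeff f n) * Real.sin (2 * Real.pi * n * x) +
    sinCoeff f n * Real.cos (2 * Real.pi * n * x))

theorem hasDerivAt_fourierTerm (f : C(UnitAddCircle, ℝ)) (n : ℕ) (x : ℝ) :
    HasDerivAt (fourierTerm f n) (fourierTermDeriv f n x) x := by
  have h0 : HasDerivAt (fun x : ℝ => 2 * Real.pi * n * x) (2 * Real.pi * n) x := by
    simpa using (hasDerivAt_id x).const_mul (2 * Real.pi * n)
  have h := (h0.cos.const_mul (cosCoeff f n)).add (h0.sin.const_mul (sinCoeff f n))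
  refine h.congr_deriv ?_
  unfold fourierTermDeriv
  ring

theorem rpow_neg_mul_self {γ : ℝ} (hγ : 1 < γ) (n : ℕ) :
    (n : ℝ) * (n : ℝ) ^ (-γ) = (n : ℝ) ^ (1 - γ) := by
  rcases Nat.eq_zero_or_pos n with rfl | hn
  -- At frequency zero both sides vanish because `1 - γ ≠ 0`.
  · rw [Nat.cast_zero, zero_mul, Real.zero_rpow (by linarith)]
  · rw [mul_comm, ← Real.rpow_add_one (by positivity)]
    congr 1; ring

theorem abs_fourierTermDeriv_le {γ : ℝ} (hγ : 1 < γ) {f : C(UnitAddCircle, ℝ)} (hf : f ∈ XSpace γ)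
    (n : ℕ) (x : ℝ) :
    |fourierTermDeriv f n x| ≤ 4 * Real.pi * XNorm γ f * (n : ℝ) ^ (1 - γ) := by
  unfold fourierTermDeriv
  have h := abs_mul_add_mul_le (a := -(cosCoeff f n)) (by rw [abs_neg]; exact abs_cosCoeff_le hf n)
    (abs_sinCoeff_le hf n) (Real.abs_sin_le_one (2 * Real.pi * n * x))
    (Real.abs_cos_le_one (2 * Real.pi * n * x))
  have hpi := Real.pi_pos
  rw [abs_mul, abs_of_nonneg (by positivity), ← rpow_neg_mul_self hγ]
  calc 2 * Real.pi * n * _ ≤ 2 * Real.pi * n * (2 * (XNorm γ f * (n : ℝ) ^ (-γ))) := by gcongr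
    _ = _ := by ring

theorem summable_rpow_one_sub {γ : ℝ} (hγ : 2 < γ) (M : ℝ) :
    Summable fun n : ℕ => M * (n : ℝ) ^ (1 - γ) :=
  (Real.summable_nat_rpow.2 (by linarith)).mul_left _

/-- The differentiated series is dominated by multiples of `n^(1-γ)`, and `γ > 2` makes these
summable. -/
theorem hasDerivAt_lift {γ : ℝ} (hγ : 2 < γ) {f : C(UnitAddCircle, ℝ)} (hf : f ∈ XSpace γ) (x : ℝ) :
    HasDerivAt (lift f) (∑' n, fourierTermDeriv f n x) x := by
  have h := hasDerivAt_tsum (summable_rpow_one_sub hγ (4 * Real.pi * XNorm γ f))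
    (fun n y => hasDerivAt_fourierTerm f n y)
    (fun n y => abs_fourierTermDeriv_le (by linarith) hf n y)
    (hasSum_fourierTerm (by linarith) hf 0).summable x
  refine (h.add_const (coeffZero f)).congr_of_eventuallyEq (Filter.Eventually.of_forall fun y => ?_)
  simp only []
  rw [(hasSum_fourierTerm (by linarith) hf y).tsum_eq]
  ring

theorem contDiff_lift {γ : ℝ} (hγ : 2 < γ) {f : C(UnitAddCircle, ℝ)} (hf : f ∈ XSpace γ) :
    ContDiff ℝ 1 (lift f) := by
  rw [contDiff_one_iff_deriv]
  refine ⟨fun x => (hasDerivAt_lift hγ hf x).differentiableAt, ?_⟩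
  have : deriv (lift f) = fun x => ∑' n, fourierTermDeriv f n x :=
    funext fun x => (hasDerivAt_lift hγ hf x).deriv
  rw [this]
  refine continuous_tsum (fun n => ?_) (summable_rpow_one_sub hγ (4 * Real.pi * XNorm γ f))
    (fun n y => abs_fourierTermDeriv_le (by linarith) hf n y)
  unfold fourierTermDeriv
  fun_prop

/-- The constant depends on `γ` alone: the perturbation argument needs every error to be
proportional to the norm of `f`. -/
theorem exists_abs_deriv_lift_le {γ : ℝ} (hγ : 2 < γ) : ∃ K, 0 ≤ K ∧ ∀ f ∈ XSpace γ, ∀ x,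
    |deriv (lift f) x| ≤ K * XNorm γ f := by
  refine ⟨4 * Real.pi * ∑' n : ℕ, (n : ℝ) ^ (1 - γ), ?_, fun f hf x => ?_⟩
  · have : 0 ≤ ∑' n : ℕ, (n : ℝ) ^ (1 - γ) := tsum_nonneg fun n => by positivity
    have := Real.pi_pos
    positivity
  · rw [(hasDerivAt_lift hγ hf x).deriv]
    have hs := summable_rpow_one_sub hγ (4 * Real.pi * XNorm γ f)
    refine (tsum_of_norm_bounded (f := fun n => fourierTermDeriv f n x) hs.hasSum
      (fun n => abs_fourierTermDeriv_le (by linarith) hf n x)).trans (le_of_eq ?_)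
    rw [tsum_mul_left]
    ring

theorem exists_abs_lift_le {γ : ℝ} (hγ : 2 < γ) : ∃ K, 0 ≤ K ∧ ∀ f ∈ XSpace γ, ∀ x,
    |lift f x| ≤ K * XNorm γ f := by
  refine ⟨1 + 2 * ∑' n : ℕ, (n : ℝ) ^ (-γ), ?_, fun f hf x => ?_⟩
  · have : 0 ≤ ∑' n : ℕ, (n : ℝ) ^ (-γ) := tsum_nonneg fun n => by positivity
    positivity
  · have h := hasSum_fourierTerm (by linarith) hf x
    have hs := (summable_rpow_neg (γ := γ) (by linarith) (XNorm γ f)).mul_left 2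
    have h2 : |lift f x - coeffZero f| ≤ ∑' n : ℕ, 2 * (XNorm γ f * (n : ℝ) ^ (-γ)) := by
      rw [← h.tsum_eq]
      exact tsum_of_norm_bounded (f := fun n => fourierTerm f n x) hs.hasSum (fun n => abs_fourierTerm_le hf n x)
    rw [tsum_mul_left, tsum_mul_left] at h2
    have h3 := abs_coeffZero_le_XNorm γ f
    have h4 := abs_add_le (lift f x - coeffZero f) (coeffZero f)
    rw [sub_add_cancel] at h4
    linarith

/-- The part of the Fourier series of `f' / 2πq` whose frequencies are multiples of `q`. -/
noncomputable def resonantPart (q : ℕ) (f : C(UnitAddCircle, ℝ)) (x : ℝ) : ℝ :=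
  ∑' n : ℕ, if n % q = 0 then 1 / (2 * Real.pi * q) * fourierTermDeriv f n x else 0

/-- Reduces the orbit average of a single mode to the average of a character, where
`norm_average_expChar_sub_le` applies. -/
theorem sum_fourierTermDeriv_eq (f : C(UnitAddCircle, ℝ)) (n q : ℕ) (y : ℕ → ℝ) :
    1 / (2 * Real.pi * q) * ∑ k ∈ range q, fourierTermDeriv f n (y k) * (1 / q) =
      1 / q * (n * (-(cosCoeff f n) * ((1 / q : ℂ) * ∑ k ∈ range q, expChar (n * y k)).im +
        sinCoeff f n * ((1 / q : ℂ) * ∑ k ∈ range q, expChar (n * y k)).re)) := by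
  have hpi := Real.pi_pos
  have e : (1 / q : ℂ) = ((1 / q : ℝ) : ℂ) := by push_cast; rfl
  rw [e, Complex.re_ofReal_mul, Complex.im_ofReal_mul, Complex.re_sum, Complex.im_sum]
  simp only [expChar_re, expChar_im]
  have e2 : ∀ k, fourierTermDeriv f n (y k) * (1 / q) =
      2 * Real.pi * n * (-(cosCoeff f n)) * (1 / q) * Real.sin (2 * Real.pi * (n * y k)) +
      2 * Real.pi * n * sinCoeff f n * (1 / q) * Real.cos (2 * Real.pi * (n * y k)) := by
    intro k
    unfold fourierTermDeriv
    rw [show 2 * Real.pi * n * y k = 2 * Real.pi * (n * y k) by ring]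
    ring
  simp_rw [e2]
  rw [sum_add_distrib, ← mul_sum, ← mul_sum]
  field_simp

/-- The comparison is made mode by mode. A coefficient of size `n^-γ`, the factor `n` from
differentiation and the character bound multiply to the general term of the series controlled by
`B`. -/
theorem abs_average_deriv_sub_resonantPart_le {γ : ℝ} (hγ : 2 < γ) {C B x : ℝ} {q : ℕ} (hq : 0 < q)
    {y : ℕ → ℝ} (h1 : ∀ k < q, |y k - x - k / q| ≤ C / q ^ 2)
    (h2 : ∀ k, k + 1 < q → |y (k + 1) - y k - 1 / q| ≤ C / q ^ 3)
    (hB : ∀ N : ℕ, ∑ n ∈ range N, (n : ℝ) ^ (1 - γ) * charBound (2 * Real.pi * C) q n ≤ B)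
    {f : C(UnitAddCircle, ℝ)} (hf : f ∈ XSpace γ) :
    |1 / (2 * Real.pi * q) * ∑ k ∈ range q, deriv (lift f) (y k) * (1 / q) - resonantPart q f x| ≤
      1 / q * (2 * XNorm γ f * B) := by
  have hpi := Real.pi_pos
  have hqR : (0 : ℝ) < q := by exact_mod_cast hq
  have hM := XNorm_nonneg γ f
  have hC : 0 ≤ C := by
    have := (abs_nonneg _).trans (h1 0 hq)
    rw [le_div_iff₀ (by positivity)] at this
    linarith
  have hsd : ∀ t, Summable fun n => fourierTermDeriv f n t := fun t =>
    Summable.of_norm_bounded (summable_rpow_one_sub hγ (4 * Real.pi * XNorm γ f))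
      (fun n => abs_fourierTermDeriv_le (by linarith) hf n t)
  have hnn : ∀ n : ℕ, 0 ≤ (n : ℝ) ^ (1 - γ) * charBound (2 * Real.pi * C) q n := fun n =>
    mul_nonneg (by positivity) (charBound_nonneg (by positivity) hq n)
  -- The bound uniform in `N` provides summability as well as an estimate of the sum.
  have hsB : Summable fun n : ℕ => (n : ℝ) ^ (1 - γ) * charBound (2 * Real.pi * C) q n :=
    summable_of_sum_range_le hnn hB
  have hBt : ∑' n : ℕ, (n : ℝ) ^ (1 - γ) * charBound (2 * Real.pi * C) q n ≤ B :=
    Real.tsum_le_of_sum_range_le hnn hB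
  have hres : Summable fun n : ℕ =>
      if n % q = 0 then 1 / (2 * Real.pi * q) * fourierTermDeriv f n x else 0 := by
    refine Summable.of_norm_bounded (((hsd x).norm).mul_left (1 / (2 * Real.pi * q))) fun n => ?_
    split_ifs
    · rw [norm_mul, Real.norm_of_nonneg (by positivity : (0 : ℝ) ≤ 1 / (2 * Real.pi * q))]
    · rw [norm_zero]; positivity
  have hswap : 1 / (2 * Real.pi * q) * ∑ k ∈ range q, deriv (lift f) (y k) * (1 / q) =
      ∑' n, 1 / (2 * Real.pi * q) * ∑ k ∈ range q, fourierTermDeriv f n (y k) * (1 / q) := by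
    rw [tsum_mul_left, Summable.tsum_finsetSum (fun k _ => (hsd (y k)).mul_right _)]
    congr 1
    refine sum_congr rfl fun k _ => ?_
    rw [(hasDerivAt_lift hγ hf (y k)).deriv, tsum_mul_right]
  have hsum1 : Summable fun n => 1 / (2 * Real.pi * q) *
      ∑ k ∈ range q, fourierTermDeriv f n (y k) * (1 / q) :=
    (summable_sum fun k _ => (hsd (y k)).mul_right _).mul_left _
  rw [hswap, resonantPart, ← hsum1.tsum_sub hres]
  have hterm : ∀ n : ℕ, ‖1 / (2 * Real.pi * q) * ∑ k ∈ range q, fourierTermDeriv f n (y k) * (1 / q) -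
      (if n % q = 0 then 1 / (2 * Real.pi * q) * fourierTermDeriv f n x else 0)‖ ≤
      1 / q * (2 * XNorm γ f) * ((n : ℝ) ^ (1 - γ) * charBound (2 * Real.pi * C) q n) := by
    intro n
    set S := (1 / q : ℂ) * ∑ k ∈ range q, expChar (n * y k) with hS
    set E : ℂ := if n % q = 0 then expChar (n * x) else 0 with hE
    have hb : ‖S - E‖ ≤ charBound (2 * Real.pi * C) q n := norm_average_expChar_sub_le hq h1 h2
    have e1 : (if n % q = 0 then 1 / (2 * Real.pi * q) * fourierTermDeriv f n x else 0) =
        1 / q * (n * (-(cosCoeff f n) * E.im + sinCoeff f n * E.re)) := by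
      rw [hE]
      split_ifs
      · rw [expChar_re, expChar_im, fourierTermDeriv,
          show 2 * Real.pi * n * x = 2 * Real.pi * (n * x) by ring]
        field_simp
      · simp
    rw [sum_fourierTermDeriv_eq, ← hS, e1]
    have e2 : 1 / (q : ℝ) * (n * (-(cosCoeff f n) * S.im + sinCoeff f n * S.re)) -
        1 / q * (n * (-(cosCoeff f n) * E.im + sinCoeff f n * E.re)) =
        1 / q * (n * (-(cosCoeff f n) * (S - E).im + sinCoeff f n * (S - E).re)) := by
      rw [Complex.sub_im, Complex.sub_re]; ring
    rw [e2, Real.norm_eq_abs, abs_mul, abs_mul, abs_of_nonneg (by positivity : (0 : ℝ) ≤ 1 / q),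
      Nat.abs_cast, ← rpow_neg_mul_self (by linarith)]
    have hcb := charBound_nonneg (C := 2 * Real.pi * C) (by positivity) hq n
    have a1 : |-(cosCoeff f n) * (S - E).im| ≤ XNorm γ f * (n : ℝ) ^ (-γ) * charBound (2 * Real.pi * C) q n := by
      rw [abs_mul, abs_neg]
      gcongr
      · exact abs_cosCoeff_le hf n
      · exact (Complex.abs_im_le_norm _).trans hb
    have a2 : |sinCoeff f n * (S - E).re| ≤ XNorm γ f * (n : ℝ) ^ (-γ) * charBound (2 * Real.pi * C) q n := by
      rw [abs_mul]
      gcongr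
      · exact abs_sinCoeff_le hf n
      · exact (Complex.abs_re_le_norm _).trans hb
    have a3 := abs_add_le (-(cosCoeff f n) * (S - E).im) (sinCoeff f n * (S - E).re)
    calc 1 / (q : ℝ) * (n * |-(cosCoeff f n) * (S - E).im + sinCoeff f n * (S - E).re|) ≤
        1 / q * (n * (2 * (XNorm γ f * (n : ℝ) ^ (-γ) * charBound (2 * Real.pi * C) q n))) := by
          gcongr; linarith
      _ = _ := by ring
  refine (tsum_of_norm_bounded (hsB.mul_left _).hasSum hterm).trans ?_
  rw [tsum_mul_left]
  calc 1 / (q : ℝ) * (2 * XNorm γ f) * _ ≤ 1 / q * (2 * XNorm γ f) * B := by gcongr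
    _ = _ := by ring

/-- The effect on an orbit average of perturbing the weights. -/
theorem abs_average_perturb_le {γ : ℝ} (K K' C : ℝ) {q : ℕ} (hq : 0 < q)
    {f : C(UnitAddCircle, ℝ)} (hK : 0 ≤ K) (hK' : 0 ≤ K')
    (hd : ∀ t, |deriv (lift f) t| ≤ K * XNorm γ f) (h0 : ∀ t, |lift f t| ≤ K' * XNorm γ f)
    {y v w' : ℕ → ℝ} (hv : ∀ k < q, |v k - 1 / q| ≤ C / q ^ 3) (hw : ∀ k < q, |w' k| ≤ C / q ^ 3) :
    |1 / (2 * Real.pi * q) * ∑ k ∈ range q, deriv (lift f) (y k) * v k +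
      1 / (2 * Real.pi * q) * ∑ k ∈ range q, lift f (y k) * w' k -
      1 / (2 * Real.pi * q) * ∑ k ∈ range q, deriv (lift f) (y k) * (1 / q)| ≤
      (K + K') * C * XNorm γ f / q ^ 3 := by
  have hpi := Real.pi_gt_three
  have hqR : (0 : ℝ) < q := by exact_mod_cast hq
  have hM := XNorm_nonneg γ f
  have hC : 0 ≤ C := by
    have := (abs_nonneg _).trans (hw 0 hq)
    rw [le_div_iff₀ (by positivity)] at this
    linarith
  have e : 1 / (2 * Real.pi * q) * ∑ k ∈ range q, deriv (lift f) (y k) * v k +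
      1 / (2 * Real.pi * q) * ∑ k ∈ range q, lift f (y k) * w' k -
      1 / (2 * Real.pi * q) * ∑ k ∈ range q, deriv (lift f) (y k) * (1 / q) =
      1 / (2 * Real.pi * q) * ∑ k ∈ range q,
        (deriv (lift f) (y k) * (v k - 1 / q) + lift f (y k) * w' k) := by
    simp_rw [mul_sub, sum_add_distrib, sum_sub_distrib]
    ring
  rw [e, abs_mul, abs_of_nonneg (by positivity : (0 : ℝ) ≤ 1 / (2 * Real.pi * q))]
  have hk : ∀ k ∈ range q, |deriv (lift f) (y k) * (v k - 1 / q) + lift f (y k) * w' k| ≤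
      (K + K') * C * XNorm γ f / q ^ 3 := by
    intro k hk
    have hk := mem_range.1 hk
    refine (abs_add_le _ _).trans ?_
    rw [abs_mul, abs_mul]
    have a := mul_le_mul (hd (y k)) (hv k hk) (abs_nonneg _) (by positivity)
    have b := mul_le_mul (h0 (y k)) (hw k hk) (abs_nonneg _) (by positivity)
    refine (add_le_add a b).trans (le_of_eq ?_)
    ring
  have hs := (abs_sum_le_sum_abs _ _).trans (sum_le_sum hk)
  simp only [sum_const, card_range, nsmul_eq_mul] at hs
  have hR : 0 ≤ (K + K') * C * XNorm γ f / q ^ 3 := by positivity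
  calc 1 / (2 * Real.pi * q) * _ ≤ 1 / (2 * Real.pi * q) * (q * ((K + K') * C * XNorm γ f / q ^ 3)) := by
        gcongr
    _ = 1 / (2 * Real.pi) * ((K + K') * C * XNorm γ f / q ^ 3) := by field_simp
    _ ≤ 1 * ((K + K') * C * XNorm γ f / q ^ 3) := by
        gcongr
        rw [div_le_one (by positivity)]
        linarith
    _ = _ := one_mul _

/-- The resonant part, indexed by the multiples of `q`. -/
theorem resonantPart_eq (q : ℕ) (hq : 0 < q) (f : C(UnitAddCircle, ℝ)) (x : ℝ) :
    resonantPart q f x = ∑' j : ℕ, j * (-(cosCoeff f (j * q)) * Real.sin (2 * Real.pi * (j * (q * x))) +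
      sinCoeff f (j * q) * Real.cos (2 * Real.pi * (j * (q * x)))) := by
  have hpi := Real.pi_pos
  have hqR : (0 : ℝ) < q := by exact_mod_cast hq
  have hinj : Function.Injective fun j : ℕ => j * q := fun a b h => Nat.eq_of_mul_eq_mul_right hq h
  rw [resonantPart, ← hinj.tsum_eq]
  · refine tsum_congr fun j => ?_
    rw [if_pos (Nat.mul_mod_left j q), fourierTermDeriv,
      show 2 * Real.pi * ((j * q : ℕ) : ℝ) * x = 2 * Real.pi * (j * (q * x)) by push_cast; ring]
    push_cast
    field_simp
  · intro n hn
    by_cases h : n % q = 0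
    · exact ⟨n / q, Nat.div_mul_cancel (Nat.dvd_of_mod_eq_zero h)⟩
    · simp [h] at hn

/-- The condition on `x` means that in each overtone either the sine or the cosine vanishes. Hence
the overtone `j` costs only one coefficient, `j (jq)^-γ ‖f‖`, and the defining series of `γ₀` sums
these to `9/10`. -/
theorem abs_resonantPart_sub_le {γ₀ γ : ℝ} (hγ : 2 < γ) (hle : γ₀ ≤ γ)
    (h : HasSum (fun k : ℕ => 1 / ((k : ℝ) + 2) ^ (γ₀ - 1)) (9 / 10))
    {q : ℕ} (hq : 0 < q) {f : C(UnitAddCircle, ℝ)} (hf : f ∈ XSpace γ) {x : ℝ}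
    (hx : ∀ j : ℕ, |Real.sin (2 * Real.pi * (j * (q * x)))| + |Real.cos (2 * Real.pi * (j * (q * x)))| = 1) :
    |resonantPart q f x - (-(cosCoeff f q) * Real.sin (2 * Real.pi * (q * x)) +
      sinCoeff f q * Real.cos (2 * Real.pi * (q * x)))| ≤ 9 / 10 * XNorm γ f * (q : ℝ) ^ (-γ) := by
  have hqR : (0 : ℝ) < q := by exact_mod_cast hq
  have hM := XNorm_nonneg γ f
  set u : ℕ → ℝ := fun j => j * (-(cosCoeff f (j * q)) * Real.sin (2 * Real.pi * (j * (q * x))) +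
      sinCoeff f (j * q) * Real.cos (2 * Real.pi * (j * (q * x)))) with hu
  have hbound : ∀ j, |u j| ≤ XNorm γ f * (q : ℝ) ^ (-γ) * (j : ℝ) ^ (1 - γ) := by
    intro j
    have a1 : |-(cosCoeff f (j * q)) * Real.sin (2 * Real.pi * (j * (q * x)))| ≤
        XNorm γ f * ((j * q : ℕ) : ℝ) ^ (-γ) * |Real.sin (2 * Real.pi * (j * (q * x)))| := by
      rw [abs_mul, abs_neg]
      exact mul_le_mul_of_nonneg_right (abs_cosCoeff_le hf _) (abs_nonneg _)
    have a2 : |sinCoeff f (j * q) * Real.cos (2 * Real.pi * (j * (q * x)))| ≤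
        XNorm γ f * ((j * q : ℕ) : ℝ) ^ (-γ) * |Real.cos (2 * Real.pi * (j * (q * x)))| := by
      rw [abs_mul]
      exact mul_le_mul_of_nonneg_right (abs_sinCoeff_le hf _) (abs_nonneg _)
    have a3 := (abs_add_le _ _).trans (add_le_add a1 a2)
    rw [← mul_add, hx j, mul_one] at a3
    rw [hu]
    simp only []
    rw [abs_mul, Nat.abs_cast, ← rpow_neg_mul_self (by linarith)]
    refine (mul_le_mul_of_nonneg_left a3 (by positivity)).trans (le_of_eq ?_)
    rw [Nat.cast_mul, Real.mul_rpow (by positivity) (by positivity)]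
    ring
  have hsu : Summable u := Summable.of_norm_bounded
    (summable_rpow_one_sub hγ (XNorm γ f * (q : ℝ) ^ (-γ))) hbound
  rw [resonantPart_eq q hq]
  -- The term `j = 0` vanishes because of the factor `j`, and `j = 1` is the main term.
  have h2 := hsu.sum_add_tsum_nat_add 2
  have h3 : ∑ i ∈ range 2, u i = -(cosCoeff f q) * Real.sin (2 * Real.pi * (q * x)) +
      sinCoeff f q * Real.cos (2 * Real.pi * (q * x)) := by
    simp [hu, sum_range_succ]
  rw [h3] at h2
  rw [← h2, add_sub_cancel_left]
  have h4 : ∀ i : ℕ, ‖u (i + 2)‖ ≤ XNorm γ f * (q : ℝ) ^ (-γ) * (1 / ((i : ℝ) + 2) ^ (γ₀ - 1)) := by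
    intro i
    refine (hbound (i + 2)).trans ?_
    have e : ((i + 2 : ℕ) : ℝ) = (i : ℝ) + 2 := by push_cast; ring
    rw [e]
    have h1 : (1 : ℝ) ≤ (i : ℝ) + 2 := by linarith [(Nat.cast_nonneg i : (0 : ℝ) ≤ i)]
    gcongr
    rw [one_div, ← Real.rpow_neg (by positivity)]
    exact Real.rpow_le_rpow_of_exponent_le h1 (by linarith)
  refine (tsum_of_norm_bounded (h.mul_left _) h4).trans (le_of_eq ?_)
  ring

end Billiard

/-! ### The Fourier isomorphism between `X^γ` and `h^γ` and its perturbations. -/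

namespace Billiard
open Finset MeasureTheory

/-- The real trigonometric polynomial `cos 2πnx` on the circle. -/
noncomputable def cosMode (n : ℕ) : C(UnitAddCircle, ℝ) :=
  ⟨fun x => (fourier (n : ℤ) x).re, Complex.continuous_re.comp (fourier (n : ℤ)).continuous⟩

/-- The real trigonometric polynomial `sin 2πnx` on the circle. -/
noncomputable def sinMode (n : ℕ) : C(UnitAddCircle, ℝ) :=
  ⟨fun x => (fourier (n : ℤ) x).im, Complex.continuous_im.comp (fourier (n : ℤ)).continuous⟩

theorem fourier_natCast_coe (n : ℕ) (x : ℝ) :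
    fourier (n : ℤ) (x : UnitAddCircle) = Complex.exp (((2 * Real.pi * n * x : ℝ) : ℂ) * Complex.I) := by
  rw [fourier_coe_apply]
  congr 1
  push_cast
  ring

theorem lift_cosMode (n : ℕ) (x : ℝ) : lift (cosMode n) x = Real.cos (2 * Real.pi * n * x) := by
  change (fourier (n : ℤ) (x : UnitAddCircle)).re = _
  rw [fourier_natCast_coe, Complex.exp_ofReal_mul_I_re]

theorem lift_sinMode (n : ℕ) (x : ℝ) : lift (sinMode n) x = Real.sin (2 * Real.pi * n * x) := by
  change (fourier (n : ℤ) (x : UnitAddCircle)).im = _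
  rw [fourier_natCast_coe, Complex.exp_ofReal_mul_I_im]

theorem norm_cosMode_le (n : ℕ) : ‖cosMode n‖ ≤ 1 := by
  refine (ContinuousMap.norm_le _ zero_le_one).2 fun x => ?_
  refine (Complex.abs_re_le_norm _).trans ?_
  rw [fourier_apply]
  exact (Circle.norm_coe _).le

theorem norm_sinMode_le (n : ℕ) : ‖sinMode n‖ ≤ 1 := by
  refine (ContinuousMap.norm_le _ zero_le_one).2 fun x => ?_
  refine (Complex.abs_im_le_norm _).trans ?_
  rw [fourier_apply]
  exact (Circle.norm_coe _).le

theorem integral_cos_two_pi (k : ℤ) :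
    ∫ x in (0 : ℝ)..1, Real.cos (2 * Real.pi * k * x) = if k = 0 then 1 else 0 := by
  split_ifs with h
  · simp [h]
  · have hk : 2 * Real.pi * k ≠ 0 := by
      have : (k : ℝ) ≠ 0 := by exact_mod_cast h
      have := Real.pi_ne_zero
      positivity
    rw [intervalIntegral.integral_comp_mul_left _ hk, integral_cos]
    have : Real.sin (2 * Real.pi * k * 1) = 0 := by
      have := Real.sin_int_mul_pi (2 * k)
      rw [← this]; congr 1; push_cast; ring
    rw [this]
    simp

theorem integral_sin_two_pi (k : ℤ) :
    ∫ x in (0 : ℝ)..1, Real.sin (2 * Real.pi * k * x) = 0 := by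
  by_cases h : k = 0
  · simp [h]
  · have hk : 2 * Real.pi * k ≠ 0 := by
      have : (k : ℝ) ≠ 0 := by exact_mod_cast h
      have := Real.pi_ne_zero
      positivity
    rw [intervalIntegral.integral_comp_mul_left _ hk, integral_sin]
    have : Real.cos (2 * Real.pi * k * 1) = 1 :=
      (congrArg Real.cos (by ring)).trans (Real.cos_int_mul_two_pi k)
    rw [this]
    simp

theorem integral_cos_mul_cos (n j : ℕ) (hj : 0 < j) :
    2 * ∫ x in (0 : ℝ)..1, Real.cos (2 * Real.pi * n * x) * Real.cos (2 * Real.pi * j * x) =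
      if n = j then 1 else 0 := by
  rw [← intervalIntegral.integral_const_mul]
  have e : ∀ x : ℝ, 2 * (Real.cos (2 * Real.pi * n * x) * Real.cos (2 * Real.pi * j * x)) =
      Real.cos (2 * Real.pi * ((n - j : ℤ) : ℝ) * x) + Real.cos (2 * Real.pi * ((n + j : ℤ) : ℝ) * x) := by
    intro x
    rw [← mul_assoc, Real.two_mul_cos_mul_cos]
    congr 2 <;> (push_cast; ring)
  simp_rw [e]
  rw [intervalIntegral.integral_add (Continuous.intervalIntegrable (by fun_prop) _ _)
    (Continuous.intervalIntegrable (by fun_prop) _ _), integral_cos_two_pi, integral_cos_two_pi,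
    if_neg (by omega : ¬ ((n : ℤ) + j = 0)), add_zero]
  simp [sub_eq_zero]

theorem integral_sin_mul_sin (n j : ℕ) (hj : 0 < j) :
    2 * ∫ x in (0 : ℝ)..1, Real.sin (2 * Real.pi * n * x) * Real.sin (2 * Real.pi * j * x) =
      if n = j then 1 else 0 := by
  rw [← intervalIntegral.integral_const_mul]
  have e : ∀ x : ℝ, 2 * (Real.sin (2 * Real.pi * n * x) * Real.sin (2 * Real.pi * j * x)) =
      Real.cos (2 * Real.pi * ((n - j : ℤ) : ℝ) * x) - Real.cos (2 * Real.pi * ((n + j : ℤ) : ℝ) * x) := by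
    intro x
    rw [← mul_assoc, Real.two_mul_sin_mul_sin]
    congr 2 <;> (push_cast; ring)
  simp_rw [e]
  rw [intervalIntegral.integral_sub (Continuous.intervalIntegrable (by fun_prop) _ _)
    (Continuous.intervalIntegrable (by fun_prop) _ _), integral_cos_two_pi, integral_cos_two_pi,
    if_neg (by omega : ¬ ((n : ℤ) + j = 0)), sub_zero]
  simp [sub_eq_zero]

theorem integral_sin_mul_cos (n j : ℕ) :
    ∫ x in (0 : ℝ)..1, Real.sin (2 * Real.pi * n * x) * Real.cos (2 * Real.pi * j * x) = 0 := by
  have e : ∀ x : ℝ, Real.sin (2 * Real.pi * n * x) * Real.cos (2 * Real.pi * j * x) =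
      (1 / 2) * Real.sin (2 * Real.pi * ((n - j : ℤ) : ℝ) * x) +
        (1 / 2) * Real.sin (2 * Real.pi * ((n + j : ℤ) : ℝ) * x) := by
    intro x
    have := Real.two_mul_sin_mul_cos (2 * Real.pi * n * x) (2 * Real.pi * j * x)
    rw [show 2 * Real.pi * ((n - j : ℤ) : ℝ) * x = 2 * Real.pi * n * x - 2 * Real.pi * j * x by
      push_cast; ring, show 2 * Real.pi * ((n + j : ℤ) : ℝ) * x =
      2 * Real.pi * n * x + 2 * Real.pi * j * x by push_cast; ring]
    linarith
  simp_rw [e]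
  rw [intervalIntegral.integral_add (Continuous.intervalIntegrable (by fun_prop) _ _)
    (Continuous.intervalIntegrable (by fun_prop) _ _), intervalIntegral.integral_const_mul,
    intervalIntegral.integral_const_mul, integral_sin_two_pi, integral_sin_two_pi]
  simp

theorem abs_integral_lift_mul_le (f : C(UnitAddCircle, ℝ)) {u : ℝ → ℝ} (hu : ∀ x, |u x| ≤ 1) :
    |∫ x in (0 : ℝ)..1, lift f x * u x| ≤ ‖f‖ := by
  have := intervalIntegral.norm_integral_le_of_norm_le_const (a := 0) (b := 1) (C := ‖f‖)
    (f := fun x => lift f x * u x) fun x _ => by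
      rw [norm_mul, Real.norm_eq_abs (u x)]
      exact (mul_le_of_le_one_right (norm_nonneg _) (hu x)).trans (f.norm_coe_le_norm _)
  simpa using this

/-- The coefficient `a₀` as a continuous functional. -/
noncomputable def coeffZeroCLM : C(UnitAddCircle, ℝ) →L[ℝ] ℝ :=
  ((LinearMap.fst ℝ ℝ (ℕ+ → ℝ × ℝ)).comp fourierSeq).mkContinuous 1 fun f => by
    rw [one_mul]
    have := abs_integral_lift_mul_le f (u := fun _ => 1) (by simp)
    simpa [fourierSeq, coeffZero] using this

/-- The coefficient `a_j` as a continuous functional. -/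
noncomputable def coeffCosCLM (j : ℕ+) : C(UnitAddCircle, ℝ) →L[ℝ] ℝ :=
  ((LinearMap.fst ℝ ℝ ℝ).comp ((LinearMap.proj j).comp
    ((LinearMap.snd ℝ ℝ (ℕ+ → ℝ × ℝ)).comp fourierSeq))).mkContinuous 2 fun f => by
    have := abs_integral_lift_mul_le f (u := fun x => Real.cos (2 * Real.pi * j * x))
      (fun x => Real.abs_cos_le_one _)
    simpa [fourierSeq, coeffCos, abs_mul] using this

/-- The coefficient `b_j` as a continuous functional. -/
noncomputable def coeffSinCLM (j : ℕ+) : C(UnitAddCircle, ℝ) →L[ℝ] ℝ :=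
  ((LinearMap.snd ℝ ℝ ℝ).comp ((LinearMap.proj j).comp
    ((LinearMap.snd ℝ ℝ (ℕ+ → ℝ × ℝ)).comp fourierSeq))).mkContinuous 2 fun f => by
    have := abs_integral_lift_mul_le f (u := fun x => Real.sin (2 * Real.pi * j * x))
      (fun x => Real.abs_sin_le_one _)
    simpa [fourierSeq, coeffSin, abs_mul] using this

theorem coeffZeroCLM_apply (f : C(UnitAddCircle, ℝ)) : coeffZeroCLM f = coeffZero f := rfl
theorem coeffCosCLM_apply (j : ℕ+) (f : C(UnitAddCircle, ℝ)) : coeffCosCLM j f = coeffCos f j := rfl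
theorem coeffSinCLM_apply (j : ℕ+) (f : C(UnitAddCircle, ℝ)) : coeffSinCLM j f = coeffSin f j := rfl

theorem coeffZero_const : coeffZero (1 : C(UnitAddCircle, ℝ)) = 1 := by
  simp [coeffZero, lift]

theorem coeffCos_const (j : ℕ+) : coeffCos (1 : C(UnitAddCircle, ℝ)) j = 0 := by
  have h := integral_cos_two_pi (j : ℕ)
  rw [if_neg (by exact_mod_cast j.pos.ne')] at h
  push_cast at h
  simp [coeffCos, lift, h]

theorem coeffSin_const (j : ℕ+) : coeffSin (1 : C(UnitAddCircle, ℝ)) j = 0 := by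
  have h := integral_sin_two_pi (j : ℕ)
  push_cast at h
  simp [coeffSin, lift, h]

theorem coeffZero_cosMode (n : ℕ+) : coeffZero (cosMode n) = 0 := by
  have h := integral_cos_two_pi (n : ℕ)
  rw [if_neg (by exact_mod_cast n.pos.ne')] at h
  push_cast at h
  simp [coeffZero, lift_cosMode, h]

theorem coeffZero_sinMode (n : ℕ+) : coeffZero (sinMode n) = 0 := by
  have h := integral_sin_two_pi (n : ℕ)
  push_cast at h
  simp [coeffZero, lift_sinMode, h]

theorem coeffCos_cosMode (n j : ℕ+) : coeffCos (cosMode n) j = if n = j then 1 else 0 := by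
  simp_rw [coeffCos, lift_cosMode]
  rw [integral_cos_mul_cos n j j.pos]
  simp

theorem coeffCos_sinMode (n j : ℕ+) : coeffCos (sinMode n) j = 0 := by
  simp_rw [coeffCos, lift_sinMode]
  rw [integral_sin_mul_cos n j, mul_zero]

theorem coeffSin_sinMode (n j : ℕ+) : coeffSin (sinMode n) j = if n = j then 1 else 0 := by
  simp_rw [coeffSin, lift_sinMode]
  rw [integral_sin_mul_sin n j j.pos]
  simp

theorem coeffSin_cosMode (n j : ℕ+) : coeffSin (cosMode n) j = 0 := by
  simp_rw [coeffSin, lift_cosMode]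
  have h := integral_sin_mul_cos j n
  simp_rw [mul_comm (Real.sin _)] at h
  rw [h, mul_zero]

/-- The trigonometric series with the given coefficients converges absolutely in the uniform norm.
The coefficient functionals are continuous there, so they pass through the sum and orthogonality
identifies the coefficients. -/
theorem exists_fourierSeq_eq {γ : ℝ} (hγ : 1 < γ) {c : RSeq} (hc : c ∈ hSpace γ) :
    ∃ f, fourierSeq f = c := by
  have hs : Summable fun n : ℕ+ => hNorm γ c * (n : ℝ) ^ (-γ) :=
    (summable_rpow_neg hγ (hNorm γ c)).comp_injective PNat.coe_injective
  set u : ℕ+ → C(UnitAddCircle, ℝ) := fun n => (c.2 n).1 • cosMode n + (c.2 n).2 • sinMode n with hu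
  have hsu : Summable u := by
    refine Summable.of_norm_bounded (hs.mul_left 2) fun n => ?_
    refine (norm_add_le _ _).trans ?_
    rw [norm_smul, norm_smul, Real.norm_eq_abs, Real.norm_eq_abs]
    have h1 := mul_le_of_le_one_right (abs_nonneg (c.2 n).1) (norm_cosMode_le n)
    have h2 := mul_le_of_le_one_right (abs_nonneg (c.2 n).2) (norm_sinMode_le n)
    have h3 := abs_fst_le_of_mem_hSpace hc n
    have h4 := abs_snd_le_of_mem_hSpace hc n
    linarith
  refine ⟨c.1 • 1 + ∑' n, u n, Prod.ext ?_ (funext fun j => Prod.ext ?_ ?_)⟩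
  · change coeffZeroCLM _ = _
    rw [map_add, map_smul, ContinuousLinearMap.map_tsum _ hsu]
    simp only [hu, map_add, map_smul]
    simp [coeffZeroCLM_apply, coeffZero_const, coeffZero_cosMode, coeffZero_sinMode]
  · change coeffCosCLM j _ = _
    rw [map_add, map_smul, ContinuousLinearMap.map_tsum _ hsu]
    simp only [hu, map_add, map_smul]
    simp [coeffCosCLM_apply, coeffCos_const, coeffCos_cosMode, coeffCos_sinMode]
  · change coeffSinCLM j _ = _
    rw [map_add, map_smul, ContinuousLinearMap.map_tsum _ hsu]
    simp only [hu, map_add, map_smul]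
    simp [coeffSinCLM_apply, coeffSin_const, coeffSin_cosMode, coeffSin_sinMode]

theorem eq_zero_of_fourierSeq_eq_zero {f : C(UnitAddCircle, ℝ)} (h : fourierSeq f = 0) : f = 0 := by
  have h1 : ∀ n, fourierTerm f n = 0 := by
    intro n
    funext x
    unfold fourierTerm cosCoeff sinCoeff
    split_ifs with hn
    · have a : coeffCos f ⟨n, hn⟩ = 0 := by
        have := congrFun (congrArg Prod.snd h) ⟨n, hn⟩
        exact congrArg Prod.fst this
      have b : coeffSin f ⟨n, hn⟩ = 0 := by
        have := congrFun (congrArg Prod.snd h) ⟨n, hn⟩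
        exact congrArg Prod.snd this
      simp [a, b]
    · simp
  -- The exponent `2` is arbitrary: any exponent above `1` makes the Fourier series represent the
  -- function.
  have hmem : f ∈ XSpace 2 := by
    change fourierSeq f ∈ hSpace 2
    rw [h]
    exact zero_mem _
  ext x
  obtain ⟨t, rfl⟩ := QuotientAddGroup.mk_surjective x
  have h2 := (hasSum_fourierTerm one_lt_two hmem t).tsum_eq
  simp only [h1, Pi.zero_apply, tsum_zero] at h2
  have h3 : coeffZero f = 0 := congrArg Prod.fst h
  change lift f t = 0
  linarith

/-- The identification of `X^γ` and `h^γ` by the Fourier coefficients. -/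
noncomputable def fourierEquiv {γ : ℝ} (hγ : 1 < γ) : XSpace γ ≃ₗ[ℝ] hSpace γ :=
  LinearEquiv.ofBijective (fourierSeq.restrict fun _ hf => hf) ⟨by
    rw [← LinearMap.ker_eq_bot, LinearMap.ker_eq_bot']
    intro f hf
    exact Subtype.ext (eq_zero_of_fourierSeq_eq_zero (congrArg Subtype.val hf)), by
    rintro ⟨c, hc⟩
    obtain ⟨f, rfl⟩ := exists_fourierSeq_eq hγ hc
    exact ⟨⟨f, hc⟩, rfl⟩⟩

/-- The Banach space that models `h^γ`. -/
abbrev BoundedSeq : Type := ℝ × BoundedContinuousFunction ℕ+ (ℝ × ℝ)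

theorem norm_weight_smul (γ : ℝ) (c : RSeq) (j : ℕ+) : ‖(j : ℝ) ^ γ • c.2 j‖ = weighted γ c j := by
  rw [norm_smul, Real.norm_of_nonneg (by positivity), Prod.norm_def]
  rfl

/-- Multiplication by the weights `j ^ γ` identifies `h^γ` with a space of bounded sequences. -/
noncomputable def weightEquiv (γ : ℝ) : hSpace γ ≃ₗ[ℝ] BoundedSeq where
  toFun c := (c.1.1, BoundedContinuousFunction.ofNormedAddCommGroupDiscrete
    (fun j => (j : ℝ) ^ γ • c.1.2 j) (hNorm γ c) fun j => by
      rw [norm_weight_smul]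
      exact weighted_le_hNorm c.2 j)
  map_add' c d := by
    ext <;> simp
  map_smul' t c := by
    ext <;> simp [mul_left_comm]
  invFun e := ⟨(e.1, fun j => (j : ℝ) ^ (-γ) • e.2 j), by
    refine ⟨‖e.2‖, ?_⟩
    rintro _ ⟨j, rfl⟩
    have hj : (0 : ℝ) < j := by exact_mod_cast j.pos
    rw [← norm_weight_smul, smul_smul, ← Real.rpow_add hj, add_neg_cancel, Real.rpow_zero, one_smul]
    exact e.2.norm_coe_le_norm j⟩
  left_inv c := by
    refine Subtype.ext (Prod.ext rfl (funext fun j => ?_))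
    have hj : (0 : ℝ) < j := by exact_mod_cast j.pos
    change (j : ℝ) ^ (-γ) • ((j : ℝ) ^ γ • c.1.2 j) = _
    rw [smul_smul, ← Real.rpow_add hj, neg_add_cancel, Real.rpow_zero, one_smul]
  right_inv e := by
    refine Prod.ext rfl (BoundedContinuousFunction.ext fun j => ?_)
    have hj : (0 : ℝ) < j := by exact_mod_cast j.pos
    change (j : ℝ) ^ γ • ((j : ℝ) ^ (-γ) • e.2 j) = _
    rw [smul_smul, ← Real.rpow_add hj, add_neg_cancel, Real.rpow_zero, one_smul]

theorem norm_weightEquiv (γ : ℝ) (c : hSpace γ) : ‖weightEquiv γ c‖ = hNorm γ c := by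
  rw [Prod.norm_def, BoundedContinuousFunction.norm_eq_iSup_norm, hNorm]
  congr 1
  refine iSup_congr fun j => ?_
  exact norm_weight_smul γ c j

theorem hNorm_le_of_forall {γ M : ℝ} {c : RSeq} (h0 : |c.1| ≤ M) (h : ∀ j, weighted γ c j ≤ M) :
    hNorm γ c ≤ M :=
  max_le h0 (ciSup_le h)

/-- A linear map `X^γ → h^γ` that is close to the map of Fourier coefficients is invertible. -/
theorem exists_equiv_of_close {γ θ : ℝ} (hγ : 1 < γ) (hθ0 : 0 ≤ θ) (hθ : θ < 1)
    (A : XSpace γ →ₗ[ℝ] RSeq)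
    (hA0 : ∀ f : XSpace γ, (A f).1 = (fourierSeq (f : C(UnitAddCircle, ℝ))).1)
    (hA : ∀ (f : XSpace γ) (j : ℕ+), weighted γ (A f - fourierSeq (f : C(UnitAddCircle, ℝ))) j ≤
      θ * XNorm γ (f : C(UnitAddCircle, ℝ))) :
    ∃ T : XSpace γ ≃ₗ[ℝ] hSpace γ, (∀ f, (T f : RSeq) = A f) ∧
      (∃ C : ℝ, ∀ f, hNorm γ (T f) ≤ C * XNorm γ f) ∧
      ∃ C : ℝ, ∀ c, XNorm γ (T.symm c) ≤ C * hNorm γ c := by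
  set F := fourierEquiv hγ with hF
  set Λ := weightEquiv γ with hΛ
  have hFn : ∀ f : XSpace γ, hNorm γ (F f) = XNorm γ f := fun f => rfl
  -- The deviation from the Fourier map; the hypothesis `hA` also shows that it takes values in
  -- `h^γ`.
  set D : XSpace γ →ₗ[ℝ] hSpace γ :=
    LinearMap.codRestrict (hSpace γ) (A - fourierSeq.comp (XSpace γ).subtype) (fun f => by
      refine ⟨θ * XNorm γ f, ?_⟩
      rintro _ ⟨j, rfl⟩
      exact hA f j) with hD
  have hDn : ∀ f, hNorm γ (D f) ≤ θ * XNorm γ f := by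
    intro f
    refine hNorm_le_of_forall ?_ (hA f)
    have h : ((D f : RSeq)).1 = 0 := by
      change (A f).1 - _ = 0
      rw [hA0 f]
      exact sub_self _
    rw [h, abs_zero]
    exact mul_nonneg hθ0 (XNorm_nonneg _ _)
  -- The deviation is transported to the Banach space `BoundedSeq`, because `X^γ` and `h^γ` occur
  -- here as bare submodules with `XNorm` and `hNorm` as plain functions. Its operator norm is at
  -- most `θ < 1`.
  set P : BoundedSeq →L[ℝ] BoundedSeq :=
    (Λ.toLinearMap ∘ₗ D ∘ₗ F.symm.toLinearMap ∘ₗ Λ.symm.toLinearMap).mkContinuous θ (by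
      intro e
      change ‖Λ (D (F.symm (Λ.symm e)))‖ ≤ _
      rw [norm_weightEquiv]
      refine (hDn _).trans (le_of_eq ?_)
      rw [← hFn, F.apply_symm_apply, ← norm_weightEquiv, ← hΛ, Λ.apply_symm_apply]) with hP
  have hPn : ‖P‖ < 1 := (LinearMap.mkContinuous_norm_le _ hθ0 _).trans_lt hθ
  -- The geometric series of `-P` inverts `1 + P`, with a bounded inverse.
  set U := ContinuousLinearEquiv.unitsEquiv ℝ BoundedSeq (Units.oneSub (-P) ((norm_neg P).trans_lt hPn)) with hU
  have hUa : ∀ e, U e = e + P e := by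
    intro e
    change ((1 : BoundedSeq →L[ℝ] BoundedSeq) - -P) e = _
    simp
  refine ⟨F ≪≫ₗ Λ ≪≫ₗ U.toLinearEquiv ≪≫ₗ Λ.symm, ?_, ⟨‖(U : BoundedSeq →L[ℝ] BoundedSeq)‖, ?_⟩,
    ⟨‖(U.symm : BoundedSeq →L[ℝ] BoundedSeq)‖, ?_⟩⟩
  · intro f
    change ((Λ.symm (U (Λ (F f))) : hSpace γ) : RSeq) = _
    rw [hUa, map_add, Λ.symm_apply_apply]
    have : P (Λ (F f)) = Λ (D f) := by
      change Λ (D (F.symm (Λ.symm (Λ (F f))))) = _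
      rw [Λ.symm_apply_apply, F.symm_apply_apply]
    rw [this, Λ.symm_apply_apply]
    change fourierSeq (f : C(UnitAddCircle, ℝ)) + (A f - fourierSeq (f : C(UnitAddCircle, ℝ))) = _
    abel
  · intro f
    change hNorm γ (Λ.symm (U (Λ (F f))) : hSpace γ) ≤ _
    rw [← norm_weightEquiv, ← hΛ, Λ.apply_symm_apply, ← hFn, ← norm_weightEquiv]
    exact (U : BoundedSeq →L[ℝ] BoundedSeq).le_opNorm _
  · intro c
    change XNorm γ (F.symm (Λ.symm (U.symm (Λ c))) : XSpace γ) ≤ _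
    rw [← hFn, F.apply_symm_apply, ← norm_weightEquiv, ← hΛ, Λ.apply_symm_apply,
      ← norm_weightEquiv]
    exact (U.symm : BoundedSeq →L[ℝ] BoundedSeq).le_opNorm _

end Billiard

/-! ### From nearly rigid orbits to the invertibility of the operator. -/

namespace Billiard
open Finset MeasureTheory

theorem sin_add_three_quarters (t : ℝ) :
    Real.sin (2 * Real.pi * (t + 3 / 4)) = -Real.cos (2 * Real.pi * t) := by
  rw [show 2 * Real.pi * (t + 3 / 4) = 2 * Real.pi * t - Real.pi / 2 + 2 * Real.pi by ring,
    Real.sin_add_two_pi, Real.sin_sub_pi_div_two]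

theorem cos_add_three_quarters (t : ℝ) :
    Real.cos (2 * Real.pi * (t + 3 / 4)) = Real.sin (2 * Real.pi * t) := by
  rw [show 2 * Real.pi * (t + 3 / 4) = 2 * Real.pi * t - Real.pi / 2 + 2 * Real.pi by ring,
    Real.cos_add_two_pi, Real.cos_sub_pi_div_two]

/-- A shift by three quarters of a period exchanges sine and cosine up to sign, so the sum keeps its
value at `j = 0`. -/
theorem abs_sin_add_abs_cos_three_quarters (j : ℕ) :
    |Real.sin (2 * Real.pi * (j * (3 / 4)))| + |Real.cos (2 * Real.pi * (j * (3 / 4)))| = 1 := by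
  induction j with
  | zero => simp
  | succ j ih =>
    rw [show ((j + 1 : ℕ) : ℝ) * (3 / 4) = j * (3 / 4) + 3 / 4 by push_cast; ring,
      sin_add_three_quarters, cos_add_three_quarters, abs_neg, add_comm]
    exact ih

namespace Table

variable {r : ℕ} (Ω : Table r)

/-- Uniform closeness of the periodic orbits of rotation number `1 / q` to the rigid rotation, for
one value of `q`. -/
structure NearRotation (C : ℝ) (q : ℕ) : Prop where
  orbitX_sub : ∀ x, ∀ k < q, |Ω.orbitX q (k : ℕ) x - x - k / q| ≤ C / q ^ 2
  step_sub : ∀ x, ∀ k : ℕ, k + 1 < q →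
    |Ω.orbitX q ((k + 1 : ℕ) : ℤ) x - Ω.orbitX q (k : ℕ) x - 1 / q| ≤ C / q ^ 3
  deriv_mul_weight_sub : ∀ x, ∀ k < q,
    |deriv (Ω.orbitX q (k : ℕ)) x * Ω.orbitWeight q (k : ℕ) x - 1 / q| ≤ C / q ^ 3
  deriv_weight : ∀ x, ∀ k < q, |deriv (Ω.orbitWeight q (k : ℕ)) x| ≤ C / q ^ 3

variable {Ω}

/-- Replacing the true weights by `1/q` costs `O(q^-3)`, and replacing the average by its resonant
part costs `o(q^-γ)`. Both are `o(q^-γ)` since `γ < 3`. -/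
theorem exists_opL_sub_resonantPart_le {γ C : ℝ} (h2 : 5 / 2 < γ) (h3 : γ < 3) (hC : 0 ≤ C) :
    ∃ η : ℕ → ℝ, Filter.Tendsto η Filter.atTop (nhds 0) ∧ ∀ q : ℕ, 0 < q → Ω.NearRotation C q →
      ∀ f ∈ XSpace γ, ∀ x, |Ω.opL q f x - resonantPart q f x| ≤ η q * XNorm γ f * (q : ℝ) ^ (-γ) := by
  have hpi := Real.pi_pos
  obtain ⟨K, hK, hd⟩ := exists_abs_deriv_lift_le (γ := γ) (by linarith)
  obtain ⟨K', hK', h0⟩ := exists_abs_lift_le (γ := γ) (by linarith)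
  obtain ⟨ε, hε, hsum⟩ := exists_tendsto_sum_charBound_le h2 h3 (C := 2 * Real.pi * C) (by positivity)
  refine ⟨fun q => 2 * ε q + (K + K') * C * (q : ℝ) ^ (γ - 3), ?_, ?_⟩
  · have t1 : Filter.Tendsto (fun x : ℝ => x ^ (γ - 3)) Filter.atTop (nhds 0) := by
      have := tendsto_rpow_neg_atTop (y := 3 - γ) (by linarith)
      simpa using this
    have := (hε.const_mul 2).add ((t1.comp tendsto_natCast_atTop_atTop).const_mul ((K + K') * C))
    simpa using this
  · intro q hq hN f hf x
    have hqR : (0 : ℝ) < q := by exact_mod_cast hq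
    have a := abs_average_deriv_sub_resonantPart_le (by linarith : 2 < γ) hq (hN.orbitX_sub x)
      (hN.step_sub x) (hsum q hq) hf
    have b := abs_average_perturb_le K K' C hq (f := f) hK hK' (hd f hf) (h0 f hf)
      (y := fun k => Ω.orbitX q (k : ℕ) x) (hN.deriv_mul_weight_sub x) (hN.deriv_weight x)
    have e1 : Ω.opL q f x = 1 / (2 * Real.pi * q) * ∑ k ∈ range q, deriv (lift f) (Ω.orbitX q k x) *
        (deriv (Ω.orbitX q k) x * Ω.orbitWeight q k x) + 1 / (2 * Real.pi * q) * ∑ k ∈ range q,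
        lift f (Ω.orbitX q k x) * deriv (Ω.orbitWeight q k) x := by
      simp only [opL, L1, L2, mul_assoc]
    rw [← e1] at b
    have c := (abs_sub_le _ _ _).trans (add_le_add b a)
    refine c.trans (le_of_eq ?_)
    have e2 : (q : ℝ) ^ (1 - γ) = q * (q : ℝ) ^ (-γ) := by
      rw [sub_eq_add_neg, Real.rpow_add hqR, Real.rpow_one]
    have e3 : (q : ℝ) ^ (γ - 3) * (q : ℝ) ^ (-γ) = 1 / q ^ 3 := by
      rw [← Real.rpow_add hqR, show γ - 3 + -γ = -(3 : ℕ) by push_cast; ring,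
        Real.rpow_neg hqR.le, Real.rpow_natCast, one_div]
    have e4 : (K + K') * C * XNorm γ f / q ^ 3 = (K + K') * C * XNorm γ f *
      ((q : ℝ) ^ (γ - 3) * (q : ℝ) ^ (-γ)) := by rw [e3]; ring
    rw [e4, e2]
    field_simp
    ring

/-- Membership in `X^γ` matters: `deriv` takes the default value `0` where a function is not
differentiable, so it is not additive in general. Multiplication by scalars needs no such care. -/
theorem opL_add {γ : ℝ} (hγ : 2 < γ) {f g : C(UnitAddCircle, ℝ)} (hf : f ∈ XSpace γ)
    (hg : g ∈ XSpace γ) (q : ℕ) (x : ℝ) : Ω.opL q (f + g) x = Ω.opL q f x + Ω.opL q g x := by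
  have h1 : ∀ t, lift (f + g) t = lift f t + lift g t := fun t => rfl
  have h2 : ∀ t, deriv (lift (f + g)) t = deriv (lift f) t + deriv (lift g) t := fun t =>
    ((hasDerivAt_lift hγ hf t).add (hasDerivAt_lift hγ hg t)).deriv.trans (by
      rw [(hasDerivAt_lift hγ hf t).deriv, (hasDerivAt_lift hγ hg t).deriv])
  simp only [opL, L1, L2, h1, h2, add_mul, sum_add_distrib]
  ring

theorem opL_smul (t : ℝ) (f : C(UnitAddCircle, ℝ)) (q : ℕ) (x : ℝ) :
    Ω.opL q (t • f) x = t * Ω.opL q f x := by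
  have h1 : ∀ y, lift (t • f) y = t * lift f y := fun y => rfl
  have h2 : ∀ y, deriv (lift (t • f)) y = t * deriv (lift f) y := fun y => by
    rw [← deriv_const_mul_field]
    rfl
  simp only [opL, L1, L2, h1, h2, mul_assoc, ← mul_sum]
  ring

/-- The map `𝓘^{q̄}` as a linear map on `X^γ`. -/
noncomputable def opILinear {γ : ℝ} (hγ : 2 < γ) (Ω : Table r) (qbar : ℕ) : XSpace γ →ₗ[ℝ] RSeq where
  toFun f := Ω.opI qbar f
  map_add' f g := by
    have h := map_add fourierSeq (f : C(UnitAddCircle, ℝ)) g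
    refine Prod.ext (by exact (congrArg Prod.fst h :)) (funext fun j => ?_)
    simp only [opI, Prod.snd_add, Pi.add_apply]
    split_ifs
    · exact congrFun (congrArg Prod.snd h) j
    · change (Ω.opL j ((f : C(UnitAddCircle, ℝ)) + g) _, Ω.opL j ((f : C(UnitAddCircle, ℝ)) + g) _) = _
      rw [opL_add hγ f.2 g.2, opL_add hγ f.2 g.2]
      rfl
  map_smul' t f := by
    have h := map_smul fourierSeq t (f : C(UnitAddCircle, ℝ))
    refine Prod.ext (by exact (congrArg Prod.fst h :)) (funext fun j => ?_)
    simp only [opI, Prod.smul_snd, Pi.smul_apply, RingHom.id_apply]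
    split_ifs
    · exact congrFun (congrArg Prod.snd h) j
    · change (Ω.opL j (t • (f : C(UnitAddCircle, ℝ))) _, Ω.opL j (t • (f : C(UnitAddCircle, ℝ))) _) = _
      rw [opL_smul, opL_smul]
      rfl

/-- Below `q̄` the entries are the Fourier coefficients themselves. From `q̄` on they differ by the
overtones, at most `9/10`, and by the orbit error, at most `1/20`, in units of `‖f‖ q^-γ`; the total
`19/20` is below `1`. -/
theorem exists_forall_opI_invertible {γ₀ γ C : ℝ}
    (h : HasSum (fun k : ℕ => 1 / ((k : ℝ) + 2) ^ (γ₀ - 1)) (9 / 10)) (hle : γ₀ ≤ γ) (h3 : γ < 3)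
    (hC : 0 ≤ C) {q₁ : ℕ} (hN : ∀ q, q₁ ≤ q → Ω.NearRotation C q) :
    ∃ q₀ : ℕ, ∀ qbar : ℕ, q₀ ≤ qbar → ∃ T : XSpace γ ≃ₗ[ℝ] hSpace γ,
      (∀ f, (T f : RSeq) = Ω.opI qbar f) ∧
      (∃ C : ℝ, ∀ f, hNorm γ (T f) ≤ C * XNorm γ f) ∧
      ∃ C : ℝ, ∀ c, XNorm γ (T.symm c) ≤ C * hNorm γ c := by
  have h2 : 5 / 2 < γ := (five_halves_lt_of_hasSum h).trans_le hle
  obtain ⟨η, hη, hη2⟩ := exists_opL_sub_resonantPart_le (Ω := Ω) h2 h3 hC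
  -- Any number below `1/10` would do in place of `1/20`.
  obtain ⟨q₂, hq₂⟩ := Filter.eventually_atTop.1 (hη.eventually (gt_mem_nhds (by norm_num : (0 : ℝ) < 1 / 20)))
  refine ⟨max q₁ q₂, fun qbar hqbar => ?_⟩
  refine exists_equiv_of_close (by linarith) (by norm_num : (0 : ℝ) ≤ 19 / 20) (by norm_num)
    (opILinear (by linarith) Ω qbar) (fun f => rfl) ?_
  intro f j
  have hM := XNorm_nonneg γ (f : C(UnitAddCircle, ℝ))
  have hj : (0 : ℝ) < j := by exact_mod_cast j.pos
  by_cases hjq : (j : ℕ) < qbar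
  · have e : (opILinear (by linarith) Ω qbar f - fourierSeq (f : C(UnitAddCircle, ℝ))).2 j = 0 := by
      change (if (j : ℕ) < qbar then _ else _) - (coeffCos (f : C(UnitAddCircle, ℝ)) j, coeffSin (f : C(UnitAddCircle, ℝ)) j) = 0
      rw [if_pos hjq, sub_self]
    rw [← norm_weight_smul, e, smul_zero, norm_zero]
    positivity
  · have hqj : max q₁ q₂ ≤ (j : ℕ) := hqbar.trans (not_lt.1 hjq)
    have hNj := hN j ((le_max_left _ _).trans hqj)
    have hηj : η j ≤ 1 / 20 := (hq₂ j ((le_max_right _ _).trans hqj)).le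
    have e : (opILinear (by linarith) Ω qbar f - fourierSeq (f : C(UnitAddCircle, ℝ))).2 j =
        (Ω.opL j f (3 / (4 * ((j : ℕ) : ℝ))) - coeffCos (f : C(UnitAddCircle, ℝ)) j, Ω.opL j f 0 - coeffSin (f : C(UnitAddCircle, ℝ)) j) := by
      change (if (j : ℕ) < qbar then _ else _) - (coeffCos (f : C(UnitAddCircle, ℝ)) j, coeffSin (f : C(UnitAddCircle, ℝ)) j) = _
      rw [if_neg hjq]
      rfl
    have hcos : cosCoeff f (j : ℕ) = coeffCos (f : C(UnitAddCircle, ℝ)) j := by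
      rw [cosCoeff, dif_pos j.pos]
      rfl
    have hsin : sinCoeff f (j : ℕ) = coeffSin (f : C(UnitAddCircle, ℝ)) j := by
      rw [sinCoeff, dif_pos j.pos]
      rfl
    have key : ∀ x A : ℝ, |resonantPart j f x - A| ≤ 9 / 10 * XNorm γ (f : C(UnitAddCircle, ℝ)) * (j : ℝ) ^ (-γ) →
        (j : ℝ) ^ γ * |Ω.opL j f x - A| ≤ 19 / 20 * XNorm γ (f : C(UnitAddCircle, ℝ)) := by
      intro x A hA
      have h5 := (abs_sub_le _ _ _).trans (add_le_add (hη2 j j.pos hNj f f.2 x) hA)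
      have h6 : η j * XNorm γ (f : C(UnitAddCircle, ℝ)) ≤ 1 / 20 * XNorm γ (f : C(UnitAddCircle, ℝ)) := by gcongr
      have h7 : (j : ℝ) ^ γ * (j : ℝ) ^ (-γ) = 1 := by
        rw [← Real.rpow_add hj, add_neg_cancel, Real.rpow_zero]
      calc (j : ℝ) ^ γ * |Ω.opL j f x - A| ≤ (j : ℝ) ^ γ *
            (η j * XNorm γ (f : C(UnitAddCircle, ℝ)) * (j : ℝ) ^ (-γ) + 9 / 10 * XNorm γ (f : C(UnitAddCircle, ℝ)) * (j : ℝ) ^ (-γ)) := by gcongr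
        _ = (η j * XNorm γ (f : C(UnitAddCircle, ℝ)) + 9 / 10 * XNorm γ (f : C(UnitAddCircle, ℝ))) * ((j : ℝ) ^ γ * (j : ℝ) ^ (-γ)) := by ring
        _ ≤ _ := by rw [h7]; linarith
    unfold weighted
    rw [e, mul_max_of_nonneg _ _ (by positivity)]
    refine max_le (key _ _ ?_) (key _ _ ?_)
    · have hx : ((j : ℕ) : ℝ) * (3 / (4 * ((j : ℕ) : ℝ))) = 3 / 4 := by
        have : ((j : ℕ) : ℝ) ≠ 0 := hj.ne'
        field_simp
      have h8 := abs_resonantPart_sub_le (by linarith) hle h j.pos f.2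
        (x := 3 / (4 * ((j : ℕ) : ℝ))) (by rw [hx]; exact abs_sin_add_abs_cos_three_quarters)
      -- At phase `3/4` the sine is `-1` and the cosine is `0`, so the first harmonic contributes
      -- exactly the cosine coefficient.
      have s := sin_add_three_quarters 0
      have c := cos_add_three_quarters 0
      simp only [zero_add, mul_zero, Real.cos_zero, Real.sin_zero] at s c
      rw [hx, s, c, hcos] at h8
      simpa using h8
    -- At phase `0` only the cosine survives, which leaves the sine coefficient.
    · have h8 := abs_resonantPart_sub_le (by linarith) hle h j.pos f.2 (x := 0) (by simp)
      rw [hsin] at h8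
      simpa using h8

end Table
end Billiard

/-! ### A simple closed locally convex curve turns once. -/

namespace Billiard
open Set Filter Topology

theorem surjective_of_add_period {f : ℝ → ℝ} (hf : Continuous f) {L c : ℝ} (hc : 0 < c)
    (h : ∀ x, f (x + L) = f x + c) : Function.Surjective f := by
  have hn : ∀ n : ℕ, ∀ x, f (x + n * L) = f x + n * c := by
    intro n
    induction n with
    | zero => simp
    | succ n ih =>
      intro x
      rw [show x + ((n + 1 : ℕ) : ℝ) * L = x + n * L + L by push_cast; ring, h, ih]
      push_cast
      ring
  intro y
  obtain ⟨n, hn1⟩ := exists_nat_ge ((y - f 0) / c)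
  obtain ⟨k, hk1⟩ := exists_nat_ge ((f 0 - y) / c)
  rw [div_le_iff₀ hc] at hn1 hk1
  have h1 := hn n 0
  have h2 := hn k (-(k * L))
  rw [neg_add_cancel] at h2
  exact mem_range_of_exists_le_of_exists_ge hf ⟨-(k * L), by linarith⟩ ⟨0 + n * L, by linarith⟩

/-- A periodic function cannot cross zero upwards only. -/
theorem false_of_forall_zero_deriv_pos {D D' : ℝ → ℝ} {p : ℝ} (hp : 0 < p)
    (hper : Function.Periodic D p) (hD : ∀ t, HasDerivAt D (D' t) t) {z : ℝ} (hz : D z = 0)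
    (hpos : ∀ t, D t = 0 → 0 < D' t) : False := by
  -- A fencing argument: `-D` starts at zero and would have a strictly negative derivative whenever
  -- it touched zero, so it cannot become positive during the period after `z`.
  have hnonneg : ∀ t ∈ Icc z (z + p), -D t ≤ 0 :=
    image_le_of_deriv_right_lt_deriv_boundary (f := fun t => -D t) (f' := fun t => -D' t)
      (B := fun _ => 0) (B' := fun _ => 0)
      (fun t _ => ((hD t).neg.continuousAt).continuousWithinAt)
      (fun t _ => (hD t).neg.hasDerivWithinAt) (by simp [hz]) (fun t => hasDerivAt_const _ _)
      (fun t _ ht => by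
        have := hpos t (by linarith)
        linarith)
  -- Periodicity moves the inequality to the left of `z` as well, so the zero is a minimum and the
  -- derivative there must vanish.
  have hmin : IsLocalMin D z := by
    filter_upwards [Ioo_mem_nhds (by linarith : z - p < z) (by linarith : z < z + p)] with t ht
    rw [hz]
    rcases le_total z t with h | h
    · have := hnonneg t ⟨h, ht.2.le⟩
      linarith
    · have := hnonneg (t + p) ⟨by linarith [ht.1], by linarith⟩
      rw [hper t] at this
      linarith
  have h0 := hmin.hasDerivAt_eq_zero (hD z)
  have := hpos z hz
  linarith

/-- A planar arc whose tangent turns left from angle `0` to angle `2π` and that ends on its initial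
tangent line in front of its initial point crosses itself. -/
theorem exists_self_crossing {x y ρ : ℝ → ℝ} (hρ : ∀ t, 0 < ρ t)
    (hx : ∀ t, HasDerivAt x (ρ t * Real.cos t) t) (hy : ∀ t, HasDerivAt y (ρ t * Real.sin t) t)
    (hy0 : y 0 = y (2 * Real.pi)) (hx0 : x 0 < x (2 * Real.pi)) :
    ∃ u v, 0 ≤ u ∧ u < v ∧ v ≤ 2 * Real.pi ∧ x u = x v ∧ y u = y v := by
  have hpi := Real.pi_pos
  have hyc : Continuous y := continuous_iff_continuousAt.2 fun t => (hy t).continuousAt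
  have hxc : Continuous x := continuous_iff_continuousAt.2 fun t => (hx t).continuousAt
  have hmono : StrictMonoOn y (Icc 0 Real.pi) := by
    refine strictMonoOn_of_deriv_pos (convex_Icc _ _) hyc.continuousOn fun t ht => ?_
    rw [interior_Icc] at ht
    rw [(hy t).deriv]
    exact mul_pos (hρ t) (Real.sin_pos_of_mem_Ioo ht)
  have hanti : StrictAntiOn y (Icc Real.pi (2 * Real.pi)) := by
    refine strictAntiOn_of_deriv_neg (convex_Icc _ _) hyc.continuousOn fun t ht => ?_
    rw [interior_Icc] at ht
    rw [(hy t).deriv]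
    refine mul_neg_of_pos_of_neg (hρ t) ?_
    have := Real.sin_pos_of_mem_Ioo (x := t - Real.pi) ⟨by linarith [ht.1], by linarith [ht.2]⟩
    rw [Real.sin_sub_pi] at this
    linarith
  have hxanti : StrictAntiOn x (Icc (Real.pi / 2) (Real.pi + Real.pi / 2)) := by
    refine strictAntiOn_of_deriv_neg (convex_Icc _ _) hxc.continuousOn fun t ht => ?_
    rw [interior_Icc] at ht
    rw [(hx t).deriv]
    exact mul_neg_of_pos_of_neg (hρ t) (Real.cos_neg_of_pi_div_two_lt_of_lt ht.1 ht.2)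
  -- The height increases up to the angle `π` and decreases afterwards, so each point of the
  -- ascending half has a partner of equal height on the descending half.
  have hex : ∀ u : Icc (0 : ℝ) Real.pi, ∃ v : Icc Real.pi (2 * Real.pi), y v = y u := by
    intro u
    have h1 : y u ∈ Icc (y (2 * Real.pi)) (y Real.pi) := by
      rw [← hy0]
      exact ⟨hmono.monotoneOn ⟨le_rfl, hpi.le⟩ u.2 u.2.1, hmono.monotoneOn u.2 ⟨hpi.le, le_rfl⟩ u.2.2⟩
    obtain ⟨v, hv, hv2⟩ := intermediate_value_Icc' (by linarith : Real.pi ≤ 2 * Real.pi)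
      hyc.continuousOn h1
    exact ⟨⟨v, hv⟩, hv2⟩
  choose ψ hψ using hex
  -- The height is an embedding of the descending half, which makes the choice of partner
  -- continuous.
  have hemb : IsClosedEmbedding fun v : Icc Real.pi (2 * Real.pi) => y v :=
    Continuous.isClosedEmbedding (hyc.comp continuous_subtype_val)
      fun a b hab => Subtype.ext (hanti.injOn a.2 b.2 hab)
  have hψc : Continuous ψ := by
    rw [hemb.isEmbedding.continuous_iff]
    have : (fun v : Icc Real.pi (2 * Real.pi) => y v) ∘ ψ = fun u : Icc (0 : ℝ) Real.pi => y u :=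
      funext hψ
    rw [this]
    exact hyc.comp continuous_subtype_val
  have hψ_eq : ∀ u v, y v = y u → (hv : v ∈ Icc Real.pi (2 * Real.pi)) → (hu : u ∈ Icc (0 : ℝ) Real.pi) →
      (ψ ⟨u, hu⟩ : ℝ) = v := fun u v h hv hu =>
    hanti.injOn (ψ ⟨u, hu⟩).2 hv ((hψ ⟨u, hu⟩).trans h.symm)
  -- The signed horizontal gap between the two halves at equal height; a zero is a self-crossing. It
  -- is negative at the start by `hx0`.
  set F : ℝ → ℝ := fun t => x t - x (ψ (projIcc 0 Real.pi hpi.le t)) with hF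
  have hFc : Continuous F := hxc.sub (hxc.comp (continuous_subtype_val.comp
    (hψc.comp continuous_projIcc)))
  have hF0 : F 0 < 0 := by
    have : (ψ (projIcc 0 Real.pi hpi.le 0) : ℝ) = 2 * Real.pi := by
      rw [projIcc_left]
      exact hψ_eq 0 _ hy0.symm ⟨by linarith, le_rfl⟩ _
    rw [hF]
    simp only [this]
    linarith
  -- Just before the top, both partners have tangent angles in `(π/2, 3π/2)`, where the abscissa
  -- decreases; there the gap is positive.
  obtain ⟨u₁, hu₁, hu₁'⟩ : ∃ u₁ ∈ Ioo (Real.pi / 2) Real.pi,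
      (ψ (projIcc 0 Real.pi hpi.le u₁) : ℝ) < Real.pi + Real.pi / 2 := by
    have hπ : (ψ (projIcc 0 Real.pi hpi.le Real.pi) : ℝ) = Real.pi := by
      rw [projIcc_right]
      exact hψ_eq Real.pi _ rfl ⟨le_rfl, by linarith⟩ _
    have hcont : Continuous fun t => (ψ (projIcc 0 Real.pi hpi.le t) : ℝ) :=
      continuous_subtype_val.comp (hψc.comp continuous_projIcc)
    have h1 : ∀ᶠ t in 𝓝 Real.pi, (ψ (projIcc 0 Real.pi hpi.le t) : ℝ) < Real.pi + Real.pi / 2 :=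
      hcont.continuousAt.eventually (gt_mem_nhds (by simp only [hπ]; linarith))
    have h2 : ∀ᶠ t in 𝓝[<] Real.pi, t ∈ Ioo (Real.pi / 2) Real.pi :=
      Ioo_mem_nhdsLT (by linarith)
    obtain ⟨t, ht1, ht2⟩ := (h2.and (h1.filter_mono nhdsWithin_le_nhds)).exists
    exact ⟨t, ht1, ht2⟩
  have hF1 : 0 < F u₁ := by
    have hge := (ψ (projIcc 0 Real.pi hpi.le u₁)).2.1
    have := hxanti ⟨hu₁.1.le, by linarith [hu₁.2]⟩ ⟨by linarith, hu₁'.le⟩ (hu₁.2.trans_le hge)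
    rw [hF]
    simp only []
    linarith
  obtain ⟨c, hc, hc0⟩ := intermediate_value_Icc (by linarith [hu₁.1] : (0 : ℝ) ≤ u₁)
    hFc.continuousOn (show (0 : ℝ) ∈ Icc (F 0) (F u₁) from ⟨hF0.le, hF1.le⟩)
  have hcI : c ∈ Icc (0 : ℝ) Real.pi := ⟨hc.1, hc.2.trans hu₁.2.le⟩
  rw [hF] at hc0
  simp only [projIcc_of_mem hpi.le hcI] at hc0
  refine ⟨c, ψ ⟨c, hcI⟩, hc.1, ?_, (ψ _).2.2, by linarith, (hψ ⟨c, hcI⟩).symm⟩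
  exact (hc.2.trans_lt hu₁.2).trans_le (ψ _).2.1

/-- A simple closed locally convex curve, parametrized by the angle of its tangent, turns once. -/
theorem turning_number_eq_one {P : ℝ → ℂ} {ρ : ℝ → ℝ} (hρ : ∀ t, 0 < ρ t)
    (hP : ∀ t, HasDerivAt P (ρ t * Complex.exp (t * Complex.I)) t) {m : ℕ} (hm : 0 < m)
    (hper : Function.Periodic P (m * (2 * Real.pi)))
    (hinj : ∀ t t', t < t' → t' < t + m * (2 * Real.pi) → P t ≠ P t') : m = 1 := by
  by_contra hm1
  have hpi := Real.pi_pos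
  have hm2 : (2 : ℝ) ≤ m := by exact_mod_cast (by omega : 2 ≤ m)
  -- The displacement after one full turn of the tangent, seen in the frame rotating with the
  -- tangent. In this frame the derivative of the imaginary part is minus the real part.
  set W : ℝ → ℂ := fun t => (P (t + 2 * Real.pi) - P t) * Complex.exp (-(t * Complex.I)) with hW
  have hexp : ∀ t : ℝ, Complex.exp (t * Complex.I) * Complex.exp (-(t * Complex.I)) = 1 := by
    intro t
    rw [← Complex.exp_add, add_neg_cancel, Complex.exp_zero]
  have hexp2 : ∀ t : ℝ, Complex.exp (((t + 2 * Real.pi : ℝ) : ℂ) * Complex.I) = Complex.exp (t * Complex.I) := by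
    intro t
    push_cast
    rw [add_mul, Complex.exp_add, Complex.exp_two_pi_mul_I, mul_one]
  have hWd : ∀ t, HasDerivAt W (((ρ (t + 2 * Real.pi) - ρ t : ℝ) : ℂ) - Complex.I * W t) t := by
    intro t
    have h1 : HasDerivAt (fun t => P (t + 2 * Real.pi)) (ρ (t + 2 * Real.pi) * Complex.exp (t * Complex.I)) t := by
      have := (hP (t + 2 * Real.pi)).comp_add_const t (2 * Real.pi)
      rwa [hexp2] at this
    have h2 : HasDerivAt (fun t : ℝ => Complex.exp (-(t * Complex.I)))
        (Complex.exp (-(t * Complex.I)) * (-(1 * Complex.I))) t :=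
      (((Complex.ofRealCLM.hasDerivAt (x := t)).mul_const Complex.I).neg).cexp
    refine ((h1.sub (hP t)).mul h2).congr_deriv ?_
    rw [hW]
    simp only [Pi.sub_apply]
    push_cast
    linear_combination ((ρ (t + 2 * Real.pi) : ℂ) - ρ t) * hexp t
  have hDd : ∀ t, HasDerivAt (fun t => (W t).im) (-(W t).re) t := by
    intro t
    have := (Complex.imCLM.hasFDerivAt.comp_hasDerivAt t (hWd t))
    refine this.congr_deriv ?_
    simp
  have hWper : Function.Periodic W (m * (2 * Real.pi)) := by
    intro t
    rw [hW]
    simp only []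
    rw [show t + m * (2 * Real.pi) + 2 * Real.pi = t + 2 * Real.pi + m * (2 * Real.pi) by ring,
      hper, hper]
    congr 1
    have e : -(((t + m * (2 * Real.pi) : ℝ) : ℂ) * Complex.I) = -(t * Complex.I) - (m : ℤ) * (2 * Real.pi * Complex.I) := by
      push_cast; ring
    rw [e, Complex.exp_sub, Complex.exp_int_mul_two_pi_mul_I, div_one]
  -- A displacement along the tangent cannot vanish, since for `m ≥ 2` a single turn is not a full
  -- period. It cannot point forward either, since `exists_self_crossing` would give a double point.
  -- So it points backward, and the imaginary part crosses zero only upwards.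
  have hneg : ∀ t, (W t).im = 0 → 0 < -(W t).re := by
    intro t ht
    by_contra hcon
    push Not at hcon
    have hbne : (W t).re ≠ 0 := by
      intro h0
      have hW0 : W t = 0 := Complex.ext h0 ht
      rw [hW] at hW0
      have := (mul_eq_zero.1 hW0).resolve_right (Complex.exp_ne_zero _)
      refine hinj t (t + 2 * Real.pi) (by linarith) (by nlinarith) (sub_eq_zero.1 this).symm
    have hb : 0 < (W t).re := lt_of_le_of_ne (by linarith) hbne.symm
    set Z : ℝ → ℂ := fun s => P (t + s) * Complex.exp (-(t * Complex.I)) with hZ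
    have hZd : ∀ s, HasDerivAt Z (ρ (t + s) * Complex.exp (s * Complex.I)) s := by
      intro s
      refine (((hP (t + s)).comp_const_add t s).mul_const _).congr_deriv ?_
      push_cast
      rw [add_mul, Complex.exp_add]
      linear_combination (ρ (t + s) : ℂ) * Complex.exp (s * Complex.I) * hexp t
    have hZW : Z (2 * Real.pi) - Z 0 = W t := by
      rw [hZ, hW]
      simp only [add_zero]
      ring
    have hxd : ∀ s, HasDerivAt (fun s => (Z s).re) (ρ (t + s) * Real.cos s) s := by
      intro s
      refine (Complex.reCLM.hasFDerivAt.comp_hasDerivAt s (hZd s)).congr_deriv ?_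
      simp [Complex.exp_ofReal_mul_I_re]
    have hyd : ∀ s, HasDerivAt (fun s => (Z s).im) (ρ (t + s) * Real.sin s) s := by
      intro s
      refine (Complex.imCLM.hasFDerivAt.comp_hasDerivAt s (hZd s)).congr_deriv ?_
      simp [Complex.exp_ofReal_mul_I_im]
    have e1 := congrArg Complex.re hZW
    have e2 := congrArg Complex.im hZW
    rw [Complex.sub_re] at e1
    rw [Complex.sub_im] at e2
    obtain ⟨u, v, hu, huv, hv, h1, h2⟩ := exists_self_crossing (fun s => hρ (t + s)) hxd hyd
      (by linarith) (by linarith)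
    have h3 : Z u = Z v := Complex.ext h1 h2
    refine hinj (t + u) (t + v) (by linarith) (by nlinarith) ?_
    exact mul_right_cancel₀ (Complex.exp_ne_zero _) h3
  -- The `m` displacements over one period add up to zero, so the imaginary part takes both signs or
  -- vanishes; hence it has a zero.
  have hsum : ∑ j ∈ Finset.range m, (W (j * (2 * Real.pi))).im = 0 := by
    have h1 : ∀ j : ℕ, W (j * (2 * Real.pi)) = P ((j + 1 : ℕ) * (2 * Real.pi)) - P (j * (2 * Real.pi)) := by
      intro j
      rw [hW]
      simp only []
      have e : -(((j * (2 * Real.pi) : ℝ) : ℂ) * Complex.I) = ((-j : ℤ) : ℂ) * (2 * Real.pi * Complex.I) := by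
        push_cast; ring
      rw [e, Complex.exp_int_mul_two_pi_mul_I, mul_one]
      congr 2
      push_cast; ring
    rw [← Complex.im_sum]
    simp_rw [h1]
    rw [Finset.sum_range_sub (fun j : ℕ => P (j * (2 * Real.pi)))]
    have := hper 0
    rw [zero_add] at this
    simp [this]
  have hne : (Finset.range m).Nonempty := Finset.nonempty_range_iff.2 hm.ne'
  obtain ⟨j₁, -, hj₁⟩ := Finset.exists_le_of_sum_le hne (hsum.trans (Finset.sum_const_zero (s := Finset.range m)).symm).le
  obtain ⟨j₂, -, hj₂⟩ := Finset.exists_le_of_sum_le hne ((Finset.sum_const_zero (s := Finset.range m)).trans hsum.symm).le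
  have hc : Continuous fun t => (W t).im := continuous_iff_continuousAt.2 fun t => (hDd t).continuousAt
  obtain ⟨z, hz⟩ := mem_range_of_exists_le_of_exists_ge hc ⟨_, hj₁⟩ ⟨_, hj₂⟩
  exact false_of_forall_zero_deriv_pos (p := m * (2 * Real.pi)) (by positivity)
    (fun t => congrArg Complex.im (hWper t)) hDd hz hneg

end Billiard

/-! ### The boundary curve: tangent angle, total curvature, supporting tangents. -/

namespace Billiard
open Set Filter Topology

theorem cross_eq_im (z w : ℂ) : cross z w = ((starRingEnd ℂ) z * w).im := by
  simp [cross]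
  ring

theorem cross_add_right (z w w' : ℂ) : cross z (w + w') = cross z w + cross z w' := by
  simp [cross]; ring

theorem cross_sub_right (z w w' : ℂ) : cross z (w - w') = cross z w - cross z w' := by
  simp [cross]; ring

theorem cross_real_mul_right (z w : ℂ) (t : ℝ) : cross z (t * w) = t * cross z w := by
  simp [cross]; ring

theorem cross_real_mul_left (z w : ℂ) (t : ℝ) : cross (t * z) w = t * cross z w := by
  simp [cross]; ring

theorem cross_self (z : ℂ) : cross z z = 0 := by
  simp [cross]; ring

theorem cross_swap (z w : ℂ) : cross w z = -cross z w := by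
  simp [cross]; ring

theorem HasDerivAt.cross {f g : ℝ → ℂ} {f' g' : ℂ} {t : ℝ} (hf : HasDerivAt f f' t)
    (hg : HasDerivAt g g' t) :
    HasDerivAt (fun t => cross (f t) (g t)) (cross f' (g t) + cross (f t) g') t := by
  have h1 := Complex.reCLM.hasFDerivAt.comp_hasDerivAt t hf
  have h2 := Complex.imCLM.hasFDerivAt.comp_hasDerivAt t hf
  have h3 := Complex.reCLM.hasFDerivAt.comp_hasDerivAt t hg
  have h4 := Complex.imCLM.hasFDerivAt.comp_hasDerivAt t hg
  refine ((h1.mul h4).sub (h2.mul h3)).congr_deriv ?_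
  simp [Billiard.cross]
  ring

theorem contDiff_cross {n : WithTop ℕ∞} : ContDiff ℝ n fun p : ℂ × ℂ => cross p.1 p.2 := by
  have h1 : ContDiff ℝ n fun z : ℂ => z.re := Complex.reCLM.contDiff
  have h2 : ContDiff ℝ n fun z : ℂ => z.im := Complex.imCLM.contDiff
  exact ((h1.comp contDiff_fst).mul (h2.comp contDiff_snd)).sub
    ((h2.comp contDiff_fst).mul (h1.comp contDiff_snd))

theorem continuous_cross : Continuous fun p : ℂ × ℂ => cross p.1 p.2 :=
  (contDiff_cross (n := 0)).continuous

namespace Table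

variable {r : ℕ} (Ω : Table r)

/-- The curvature at arc-length parameter `s`. -/
noncomputable def curv (s : ℝ) : ℝ := cross (deriv Ω.Γ s) (deriv (deriv Ω.Γ) s)

variable {Ω}

theorem curv_pos (s : ℝ) : 0 < Ω.curv s := Ω.curvature_pos s

theorem contDiff_eight (hr : 8 ≤ r) : ContDiff ℝ 8 Ω.Γ :=
  Ω.contDiff.of_le (by exact_mod_cast hr)

theorem contDiff_tangent (hr : 8 ≤ r) : ContDiff ℝ 7 (deriv Ω.Γ) := by
  have h := contDiff_eight (Ω := Ω) hr
  rw [show (8 : WithTop ℕ∞) = 7 + 1 by norm_num] at h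
  exact (contDiff_succ_iff_deriv.1 h).2.2

theorem contDiff_deriv_tangent (hr : 8 ≤ r) : ContDiff ℝ 6 (deriv (deriv Ω.Γ)) := by
  have h := contDiff_tangent (Ω := Ω) hr
  rw [show (7 : WithTop ℕ∞) = 6 + 1 by norm_num] at h
  exact (contDiff_succ_iff_deriv.1 h).2.2

theorem contDiff_curv (hr : 8 ≤ r) : ContDiff ℝ 6 Ω.curv :=
  contDiff_cross.comp (((contDiff_tangent hr).of_le (by norm_num)).prodMk (contDiff_deriv_tangent hr))

theorem continuous_curv (hr : 8 ≤ r) : Continuous Ω.curv := (contDiff_curv hr).continuous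

theorem hasDerivAt_boundary (hr : 8 ≤ r) (s : ℝ) : HasDerivAt Ω.Γ (deriv Ω.Γ s) s :=
  ((contDiff_eight hr).differentiable (by norm_num) s).hasDerivAt

theorem continuous_boundary (hr : 8 ≤ r) : Continuous Ω.Γ := (contDiff_eight hr).continuous

theorem tangent_add_period (s : ℝ) : deriv Ω.Γ (s + Ω.L) = deriv Ω.Γ s := by
  have h : (fun x => Ω.Γ (x + Ω.L)) = Ω.Γ := funext Ω.periodic
  rw [← deriv_comp_add_const, h]

theorem curv_add_period (s : ℝ) : Ω.curv (s + Ω.L) = Ω.curv s := by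
  have h : (fun x => deriv Ω.Γ (x + Ω.L)) = deriv Ω.Γ := funext tangent_add_period
  rw [curv, tangent_add_period, ← deriv_comp_add_const, h]
  rfl

/-- Differentiating the unit-speed relation shows that the acceleration is orthogonal to the
tangent, and the curvature is its normal component. -/
theorem hasDerivAt_tangent (hr : 8 ≤ r) (s : ℝ) :
    HasDerivAt (deriv Ω.Γ) (Ω.curv s * Complex.I * deriv Ω.Γ s) s := by
  have h := ((contDiff_tangent (Ω := Ω) hr).differentiable (by norm_num) s).hasDerivAt
  refine h.congr_deriv ?_
  have hn : ∀ t, (deriv Ω.Γ t).re * (deriv Ω.Γ t).re + (deriv Ω.Γ t).im * (deriv Ω.Γ t).im = 1 := by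
    intro t
    rw [← Complex.normSq_apply, Complex.normSq_eq_norm_sq, Ω.unit_speed, one_pow]
  have h1 := Complex.reCLM.hasFDerivAt.comp_hasDerivAt s h
  have h2 := Complex.imCLM.hasFDerivAt.comp_hasDerivAt s h
  have h3 := ((h1.mul h1).add (h2.mul h2)).congr_of_eventuallyEq
    (f₁ := fun _ => (1 : ℝ)) (Eventually.of_forall fun t => (hn t).symm)
  have h4 := h3.unique (hasDerivAt_const s 1)
  simp only [Complex.reCLM_apply, Complex.imCLM_apply, Function.comp] at h4
  have hs := hn s
  apply Complex.ext <;> simp [curv, cross]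
  · linear_combination (-(deriv (deriv Ω.Γ) s).re) * hs + 1 / 2 * (deriv Ω.Γ s).re * h4
  · linear_combination (-(deriv (deriv Ω.Γ) s).im) * hs + 1 / 2 * (deriv Ω.Γ s).im * h4

variable (Ω) in
/-- A continuous choice of the angle of the tangent. -/
noncomputable def tangentAngle (s : ℝ) : ℝ := Complex.arg (deriv Ω.Γ 0) + ∫ t in (0 : ℝ)..s, Ω.curv t

theorem hasDerivAt_tangentAngle (hr : 8 ≤ r) (s : ℝ) :
    HasDerivAt Ω.tangentAngle (Ω.curv s) s :=
  (intervalIntegral.integral_hasDerivAt_right ((continuous_curv hr).intervalIntegrable _ _)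
    (continuous_curv hr).aestronglyMeasurable.stronglyMeasurableAtFilter
    (continuous_curv hr).continuousAt).const_add _

theorem continuous_tangentAngle (hr : 8 ≤ r) : Continuous Ω.tangentAngle :=
  continuous_iff_continuousAt.2 fun s => (hasDerivAt_tangentAngle hr s).continuousAt

theorem strictMono_tangentAngle (hr : 8 ≤ r) : StrictMono Ω.tangentAngle :=
  strictMono_of_hasDerivAt_pos (fun s => hasDerivAt_tangentAngle hr s) curv_pos

/-- Undoing the rotation by the angle leaves a vector with zero derivative; the initial argument is
chosen to match at `s = 0`. -/
theorem tangent_eq_exp (hr : 8 ≤ r) (s : ℝ) :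
    deriv Ω.Γ s = Complex.exp (Ω.tangentAngle s * Complex.I) := by
  have hd : ∀ t, HasDerivAt (fun t => deriv Ω.Γ t * Complex.exp (-(Ω.tangentAngle t * Complex.I))) 0 t := by
    intro t
    have h2 := (((hasDerivAt_tangentAngle (Ω := Ω) hr t).ofReal_comp.mul_const Complex.I).neg).cexp
    refine ((hasDerivAt_tangent hr t).mul h2).congr_deriv ?_
    ring
  have hc := is_const_of_deriv_eq_zero (fun t => (hd t).differentiableAt) (fun t => (hd t).deriv) s 0
  have h0 : deriv Ω.Γ 0 = Complex.exp (Ω.tangentAngle 0 * Complex.I) := by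
    have := Complex.norm_mul_exp_arg_mul_I (deriv Ω.Γ 0)
    rw [Ω.unit_speed] at this
    simpa [tangentAngle] using this.symm
  have hexp : ∀ t : ℝ, Complex.exp (-(t * Complex.I)) * Complex.exp (t * Complex.I) = 1 := by
    intro t
    rw [← Complex.exp_add, neg_add_cancel, Complex.exp_zero]
  rw [h0, mul_comm (Complex.exp _), hexp] at hc
  linear_combination Complex.exp (Ω.tangentAngle s * Complex.I) * hc -
    deriv Ω.Γ s * hexp (Ω.tangentAngle s)

/-- Injectivity is given on one fundamental interval only; after translating by periods, the two
parameters lie in the same interval or in consecutive ones. -/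
theorem boundary_ne (s s' : ℝ) (h : s < s') (h' : s' < s + Ω.L) : Ω.Γ s ≠ Ω.Γ s' := by
  intro heq
  set n := ⌊s / Ω.L⌋ with hn
  have hL := Ω.L_pos
  have hper : ∀ (k : ℤ) t, Ω.Γ (t - k * Ω.L) = Ω.Γ t := fun k t => Ω.periodic.sub_int_mul_eq k
  have h1 : n * Ω.L ≤ s := by
    have := Int.floor_le (s / Ω.L)
    rwa [le_div_iff₀ hL] at this
  have h2 : s < (n + 1) * Ω.L := by
    have := Int.lt_floor_add_one (s / Ω.L)
    rwa [div_lt_iff₀ hL] at this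
  have ha : s - n * Ω.L ∈ Ico 0 Ω.L := ⟨by linarith, by linarith⟩
  rcases lt_or_ge s' ((n + 1) * Ω.L) with h3 | h3
  · have := Ω.injOn ha (show s' - n * Ω.L ∈ Ico 0 Ω.L from ⟨by linarith, by linarith⟩)
      (by rw [hper, hper, heq])
    linarith
  · have := Ω.injOn ha (show s' - ((n + 1 : ℤ) : ℝ) * Ω.L ∈ Ico 0 Ω.L from
      ⟨by push_cast; linarith, by push_cast; linarith⟩) (by rw [hper, hper, heq])
    push_cast at this
    linarith

/-- The increment is constant because the curvature is periodic, a multiple of `2π` because the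
tangent is periodic, and positive. That the multiple is `1` is the global input: it uses simplicity
of the curve, through `turning_number_eq_one`. -/
theorem tangentAngle_add_period (hr : 8 ≤ r) (s : ℝ) :
    Ω.tangentAngle (s + Ω.L) = Ω.tangentAngle s + 2 * Real.pi := by
  have hpi := Real.pi_pos
  have hL := Ω.L_pos
  have hd : ∀ t, HasDerivAt (fun t => Ω.tangentAngle (t + Ω.L) - Ω.tangentAngle t) 0 t := by
    intro t
    refine (((hasDerivAt_tangentAngle hr (t + Ω.L)).comp_add_const t Ω.L).sub
      (hasDerivAt_tangentAngle hr t)).congr_deriv ?_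
    rw [curv_add_period, sub_self]
  have hconst : ∀ t, Ω.tangentAngle (t + Ω.L) - Ω.tangentAngle t =
      Ω.tangentAngle (0 + Ω.L) - Ω.tangentAngle 0 := fun t =>
    is_const_of_deriv_eq_zero (fun t => (hd t).differentiableAt) (fun t => (hd t).deriv) t 0
  have hexp : Complex.exp (Ω.tangentAngle (0 + Ω.L) * Complex.I) =
      Complex.exp (Ω.tangentAngle 0 * Complex.I) := by
    rw [← tangent_eq_exp hr, ← tangent_eq_exp hr, tangent_add_period]
  obtain ⟨k, hk⟩ := Complex.exp_eq_exp_iff_exists_int.1 hexp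
  have hk' : Ω.tangentAngle (0 + Ω.L) - Ω.tangentAngle 0 = k * (2 * Real.pi) := by
    have := congrArg Complex.im hk
    simp at this
    rw [zero_add]
    linarith
  have hpos : 0 < Ω.tangentAngle (0 + Ω.L) - Ω.tangentAngle 0 :=
    sub_pos.2 (strictMono_tangentAngle hr (by linarith))
  have hk0 : 0 < k := by
    rw [hk'] at hpos
    exact_mod_cast (pos_iff_pos_of_mul_pos hpos).2 (by positivity)
  obtain ⟨m, rfl⟩ : ∃ m : ℕ, k = m := ⟨k.toNat, by omega⟩
  have hstep : ∀ t, Ω.tangentAngle (t + Ω.L) = Ω.tangentAngle t + m * (2 * Real.pi) := by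
    intro t
    have := hconst t
    rw [hk'] at this
    push_cast at this
    linarith
  have hm0 : 0 < m := by exact_mod_cast hk0
  have hmR : (0 : ℝ) < m := by exact_mod_cast hm0
  have hsurj := surjective_of_add_period (continuous_tangentAngle (Ω := Ω) hr)
    (c := m * (2 * Real.pi)) (by positivity) hstep
  -- The tangent angle becomes the parameter, as `turning_number_eq_one` requires; the speed is then
  -- the inverse of the curvature.
  set S : ℝ ≃o ℝ := (strictMono_tangentAngle (Ω := Ω) hr).orderIsoOfSurjective _ hsurj with hS
  have hSa : ∀ t, Ω.tangentAngle (S.symm t) = t := fun t => S.apply_symm_apply t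
  have hSd : ∀ t, HasDerivAt S.symm (Ω.curv (S.symm t))⁻¹ t := fun t =>
    HasDerivAt.of_local_left_inverse S.symm.continuous.continuousAt
      (hasDerivAt_tangentAngle hr (S.symm t)) (curv_pos _).ne' (Eventually.of_forall hSa)
  have hSp : ∀ t, S.symm (t + m * (2 * Real.pi)) = S.symm t + Ω.L := by
    intro t
    rw [OrderIso.symm_apply_eq]
    change _ = Ω.tangentAngle (S.symm t + Ω.L)
    rw [hstep, hSa]
  have hm1 := turning_number_eq_one (P := fun t => Ω.Γ (S.symm t))
    (ρ := fun t => (Ω.curv (S.symm t))⁻¹) (fun t => inv_pos.2 (curv_pos _)) (fun t => by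
      have := (hasDerivAt_boundary (Ω := Ω) hr (S.symm t)).scomp t (hSd t)
      refine this.congr_deriv ?_
      rw [tangent_eq_exp hr, hSa]
      simp) hm0 (fun t => by simp only [hSp]; exact Ω.periodic _) (fun t t' h h' =>
      boundary_ne _ _ (S.symm.strictMono h) (by rw [← hSp]; exact S.symm.strictMono h'))
  rw [hstep s, hm1]
  simp

theorem cross_tangent_tangent (hr : 8 ≤ r) (s t : ℝ) :
    cross (deriv Ω.Γ s) (deriv Ω.Γ t) = Real.sin (Ω.tangentAngle t - Ω.tangentAngle s) := by
  rw [tangent_eq_exp hr, tangent_eq_exp hr t, cross, Complex.exp_ofReal_mul_I_re,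
    Complex.exp_ofReal_mul_I_re, Complex.exp_ofReal_mul_I_im, Complex.exp_ofReal_mul_I_im,
    Real.sin_sub]
  ring

/-- The boundary lies strictly to the left of each of its tangents. -/
theorem cross_tangent_chord_pos (hr : 8 ≤ r) {s t : ℝ} (h : s < t) (h' : t < s + Ω.L) :
    0 < cross (deriv Ω.Γ s) (Ω.Γ t - Ω.Γ s) := by
  have hpi := Real.pi_pos
  set f : ℝ → ℝ := fun t => cross (deriv Ω.Γ s) (Ω.Γ t - Ω.Γ s) with hf
  have hfd : ∀ t, HasDerivAt f (Real.sin (Ω.tangentAngle t - Ω.tangentAngle s)) t := by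
    intro t
    have := HasDerivAt.cross (hasDerivAt_const t (deriv Ω.Γ s))
      ((hasDerivAt_boundary (Ω := Ω) hr t).sub_const (Ω.Γ s))
    refine this.congr_deriv ?_
    rw [cross_tangent_tangent hr]
    simp [cross]
  have hfc : Continuous f := continuous_iff_continuousAt.2 fun t => (hfd t).continuousAt
  have hmono := strictMono_tangentAngle (Ω := Ω) hr
  have hθL := tangentAngle_add_period (Ω := Ω) hr s
  -- At `c` the tangent has turned by `π`. The height above the tangent line rises up to `c` and
  -- then falls back to zero at `s + L`, so it is positive in between.
  obtain ⟨c, hc⟩ : ∃ c, Ω.tangentAngle c = Ω.tangentAngle s + Real.pi :=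
    surjective_of_add_period (continuous_tangentAngle hr) (by positivity)
      (tangentAngle_add_period hr) _
  have hf0 : f s = 0 := by simp [hf, cross]
  have hfL : f (s + Ω.L) = 0 := by simp [hf, Ω.periodic s, cross]
  rcases le_total t c with htc | htc
  · have hm : StrictMonoOn f (Icc s c) := by
      refine strictMonoOn_of_deriv_pos (convex_Icc _ _) hfc.continuousOn fun u hu => ?_
      rw [interior_Icc] at hu
      rw [(hfd u).deriv]
      have h1 := hmono hu.1
      have h2 := hmono hu.2
      exact Real.sin_pos_of_mem_Ioo ⟨by linarith, by linarith⟩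
    have := hm ⟨le_rfl, by linarith⟩ ⟨h.le, htc⟩ h
    rw [hf0] at this
    exact this
  · have hm : StrictAntiOn f (Icc c (s + Ω.L)) := by
      refine strictAntiOn_of_deriv_neg (convex_Icc _ _) hfc.continuousOn fun u hu => ?_
      rw [interior_Icc] at hu
      rw [(hfd u).deriv]
      have h1 := hmono hu.1
      have h2 := hmono hu.2
      have h3 := Real.sin_pos_of_mem_Ioo
        (x := Ω.tangentAngle u - Ω.tangentAngle s - Real.pi) ⟨by linarith, by linarith⟩
      rw [Real.sin_sub_pi] at h3
      linarith
    have := hm ⟨htc, h'.le⟩ ⟨by linarith, le_rfl⟩ h'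
    rw [hfL] at this
    exact this

end Table
end Billiard

/-! ### Orientation of chords, reflection angles and the billiard map. -/

namespace Billiard
open Set Filter Topology
namespace Table

variable {r : ℕ} {Ω : Table r}

theorem cross_chord_tangent_pos (hr : 8 ≤ r) {s t : ℝ} (h : s < t) (h' : t < s + Ω.L) :
    0 < cross (Ω.Γ t - Ω.Γ s) (deriv Ω.Γ t) := by
  have := cross_tangent_chord_pos (Ω := Ω) hr h' (by linarith : s + Ω.L < t + Ω.L)
  rw [Ω.periodic s] at this
  rw [cross_swap]
  have e : cross (deriv Ω.Γ t) (Ω.Γ t - Ω.Γ s) = -cross (deriv Ω.Γ t) (Ω.Γ s - Ω.Γ t) := by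
    simp [cross]; ring
  rw [e]
  linarith

/-- Three consecutive boundary points are positively oriented. -/
theorem cross_chord_chord_pos (hr : 8 ≤ r) {s t u : ℝ} (h1 : s < t) (h2 : t < u)
    (h3 : u < s + Ω.L) : 0 < cross (Ω.Γ t - Ω.Γ s) (Ω.Γ u - Ω.Γ s) := by
  set f : ℝ → ℝ := fun u => cross (Ω.Γ t - Ω.Γ s) (Ω.Γ u - Ω.Γ s) with hf
  have hfd : ∀ u, HasDerivAt f (cross (Ω.Γ t - Ω.Γ s) (deriv Ω.Γ u)) u := by
    intro u
    refine (HasDerivAt.cross (hasDerivAt_const u (Ω.Γ t - Ω.Γ s))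
      ((hasDerivAt_boundary (Ω := Ω) hr u).sub_const (Ω.Γ s))).congr_deriv ?_
    simp [cross]
  have hfc : Continuous f := continuous_iff_continuousAt.2 fun u => (hfd u).continuousAt
  have hft : f t = 0 := cross_self _
  -- Suppose the three points are collinear and compare the heights of the second and third above
  -- the tangent at the first. The supporting tangent at the second point makes the second strictly
  -- higher; the supporting tangent at the third makes the third strictly higher.
  have hne : ∀ v ∈ Ioo t (s + Ω.L), f v ≠ 0 := by
    intro v hv h0
    have a1 := cross_tangent_chord_pos (Ω := Ω) hr h1 (hv.1.trans hv.2)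
    have a2 := cross_tangent_chord_pos (Ω := Ω) hr (h1.trans hv.1) hv.2
    have b1 := cross_tangent_chord_pos (Ω := Ω) hr hv.1 (by linarith [hv.2] : v < t + Ω.L)
    have b2 := cross_chord_tangent_pos (Ω := Ω) hr h1 (hv.1.trans hv.2)
    have c1 := cross_chord_tangent_pos (Ω := Ω) hr (h1.trans hv.1) hv.2
    have c2 := cross_chord_tangent_pos (Ω := Ω) hr hv.1 (by linarith [hv.2] : v < t + Ω.L)
    have ev : Ω.Γ v - Ω.Γ t = (Ω.Γ v - Ω.Γ s) - (Ω.Γ t - Ω.Γ s) := by ring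
    replace h0 : cross (Ω.Γ t - Ω.Γ s) (Ω.Γ v - Ω.Γ s) = 0 := h0
    rw [ev] at b1 c2
    generalize Ω.Γ v - Ω.Γ s = V at *
    generalize Ω.Γ t - Ω.Γ s = W at *
    generalize deriv Ω.Γ s = S at *
    generalize deriv Ω.Γ t = T at *
    generalize deriv Ω.Γ v = U at *
    simp only [cross, Complex.sub_re, Complex.sub_im] at *
    have hS1 : (S.re * W.im - S.im * W.re) * (T.re * V.im - T.im * V.re) =
        -(S.re * V.im - S.im * V.re) * (W.re * T.im - W.im * T.re) := by
      linear_combination (S.re * T.im - S.im * T.re) * h0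
    have hS2 : (S.re * W.im - S.im * W.re) * (V.re * U.im - V.im * U.re) =
        (S.re * V.im - S.im * V.re) * (W.re * U.im - W.im * U.re) := by
      linear_combination (-(S.re * U.im - S.im * U.re)) * h0
    set α := S.re * W.im - S.im * W.re
    set β := S.re * V.im - S.im * V.re
    set p := W.re * T.im - W.im * T.re
    set q := V.re * U.im - V.im * U.re
    set q' := W.re * U.im - W.im * U.re
    have b1' : 0 < (T.re * V.im - T.im * V.re) + p := by simp only [p]; linarith
    have c2' : 0 < q - q' := by simp only [q, q']; linarith
    have e1 : 0 < α * (T.re * V.im - T.im * V.re) + α * p := by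
      have := mul_pos a1 b1'
      linarith
    have e2 : 0 < (α - β) * p := by linarith
    have e3 : 0 < α - β := (pos_iff_pos_of_mul_pos e2).2 b2
    have e4 : 0 < (β - α) * q := by
      have := mul_pos a2 c2'
      linarith
    have e5 : 0 < β - α := (pos_iff_pos_of_mul_pos e4).2 c1
    linarith
  -- The sign is read off from the derivative just after `t`; having no zeros, the function keeps
  -- it.
  have hpos : ∃ v ∈ Ioo t (s + Ω.L), 0 < f v := by
    have hd := hfd t
    have hp := cross_chord_tangent_pos (Ω := Ω) hr h1 (by linarith)
    have h5 : ∀ᶠ v in 𝓝[>] t, 0 < slope f t v :=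
      ((hasDerivWithinAt_iff_tendsto_slope' (by simp)).1 hd.hasDerivWithinAt).eventually
        (lt_mem_nhds hp)
    obtain ⟨v, hv, hv2⟩ := (h5.and (Ioo_mem_nhdsGT (by linarith : t < s + Ω.L))).exists
    refine ⟨v, hv2, ?_⟩
    rw [slope_def_field, hft, sub_zero] at hv
    exact (div_pos_iff_of_pos_right (by linarith [hv2.1])).1 hv
  obtain ⟨v, hv, hfv⟩ := hpos
  by_contra hcon
  push Not at hcon
  have hu : u ∈ Ioo t (s + Ω.L) := ⟨h2, h3⟩
  obtain ⟨w, hw, hw0⟩ := (isPreconnected_Ioo (a := t) (b := s + Ω.L)).intermediate_value hu hv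
    hfc.continuousOn (show (0 : ℝ) ∈ Icc (f u) (f v) from ⟨hcon, hfv.le⟩)
  exact hne w hw hw0

/-! ### Monotonicity of the angle of a chord -/

variable (Ω) in
/-- The chord from `Γ s` to `Γ t` in the frame of the tangent at `Γ s`. -/
noncomputable def chordFrame (s t : ℝ) : ℂ := (Ω.Γ t - Ω.Γ s) / deriv Ω.Γ s

theorem tangent_ne_zero (s : ℝ) : deriv Ω.Γ s ≠ 0 := by
  intro h
  have := Ω.unit_speed s
  rw [h, norm_zero] at this
  exact zero_ne_one this

theorem div_tangent (s : ℝ) (w : ℂ) : w / deriv Ω.Γ s = (starRingEnd ℂ) (deriv Ω.Γ s) * w := by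
  rw [div_eq_iff (tangent_ne_zero s), mul_right_comm, ← Complex.normSq_eq_conj_mul_self,
    Complex.normSq_eq_norm_sq, Ω.unit_speed]
  simp

theorem chordFrame_im (s t : ℝ) : (Ω.chordFrame s t).im = cross (deriv Ω.Γ s) (Ω.Γ t - Ω.Γ s) := by
  rw [chordFrame, div_tangent, cross_eq_im]

theorem chordFrame_im_pos (hr : 8 ≤ r) {s t : ℝ} (h : s < t) (h' : t < s + Ω.L) :
    0 < (Ω.chordFrame s t).im := by
  rw [chordFrame_im]
  exact cross_tangent_chord_pos hr h h'

theorem arg_mem_Ioo_of_im_pos {z : ℂ} (hz : 0 < z.im) : Complex.arg z ∈ Ioo 0 Real.pi := by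
  refine ⟨lt_of_le_of_ne (Complex.arg_nonneg_iff.2 hz.le) fun h => ?_,
    lt_of_le_of_ne (Complex.arg_le_pi z) fun h => ?_⟩
  · have := (Complex.arg_eq_zero_iff.1 h.symm).2
    linarith
  · have := (Complex.arg_eq_pi_iff.1 h).2
    linarith

theorem outAngle_eq_arg (hr : 8 ≤ r) {s t : ℝ} (h : s < t) (h' : t < s + Ω.L) :
    Ω.outAngle s t = Complex.arg (Ω.chordFrame s t) := by
  rw [outAngle, Complex.angle_eq_abs_arg (sub_ne_zero.2 (boundary_ne s t h h').symm)
    (tangent_ne_zero s), abs_of_nonneg]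
  · rfl
  · exact Complex.arg_nonneg_iff.2 (chordFrame_im_pos hr h h').le

theorem outAngle_mem_Ioo (hr : 8 ≤ r) {s t : ℝ} (h : s < t) (h' : t < s + Ω.L) :
    Ω.outAngle s t ∈ Ioo 0 Real.pi := by
  rw [outAngle_eq_arg hr h h']
  exact arg_mem_Ioo_of_im_pos (chordFrame_im_pos hr h h')

/-- Both arguments lie in `(0, π)`, so the cross product has the sign of their difference. -/
theorem arg_lt_arg_of_cross_pos {z w : ℂ} (hz : 0 < z.im) (hw : 0 < w.im) (h : 0 < cross z w) :
    Complex.arg z < Complex.arg w := by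
  have hz' := arg_mem_Ioo_of_im_pos hz
  have hw' := arg_mem_Ioo_of_im_pos hw
  by_contra hcon
  push Not at hcon
  have h1 : Real.sin (Complex.arg w - Complex.arg z) ≤ 0 := by
    have := Real.sin_nonneg_of_nonneg_of_le_pi (x := Complex.arg z - Complex.arg w) (by linarith)
      (by linarith [hz'.2, hw'.1])
    rw [← neg_sub, Real.sin_neg] at this
    linarith
  have h2 : cross z w = ‖z‖ * ‖w‖ * Real.sin (Complex.arg w - Complex.arg z) := by
    rw [Real.sin_sub, cross, ← Complex.norm_mul_cos_arg z, ← Complex.norm_mul_sin_arg z,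
      ← Complex.norm_mul_cos_arg w, ← Complex.norm_mul_sin_arg w]
    ring
  have h3 := mul_nonpos_of_nonneg_of_nonpos (mul_nonneg (norm_nonneg z) (norm_nonneg w)) h1
  linarith

/-- Passing to the tangent frame is a rotation and preserves the cross product of the two chords,
which is positive by `cross_chord_chord_pos`. -/
theorem outAngle_strictMono (hr : 8 ≤ r) {s t u : ℝ} (h1 : s < t) (h2 : t < u)
    (h3 : u < s + Ω.L) : Ω.outAngle s t < Ω.outAngle s u := by
  rw [outAngle_eq_arg hr h1 (h2.trans h3), outAngle_eq_arg hr (h1.trans h2) h3]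
  refine arg_lt_arg_of_cross_pos (chordFrame_im_pos hr h1 (h2.trans h3))
    (chordFrame_im_pos hr (h1.trans h2) h3) ?_
  have e : cross (Ω.chordFrame s t) (Ω.chordFrame s u) = cross (Ω.Γ t - Ω.Γ s) (Ω.Γ u - Ω.Γ s) := by
    have hn : (deriv Ω.Γ s).re * (deriv Ω.Γ s).re + (deriv Ω.Γ s).im * (deriv Ω.Γ s).im = 1 := by
      rw [← Complex.normSq_apply, Complex.normSq_eq_norm_sq, Ω.unit_speed, one_pow]
    rw [chordFrame, chordFrame, div_tangent, div_tangent]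
    generalize Ω.Γ t - Ω.Γ s = V
    generalize Ω.Γ u - Ω.Γ s = W
    simp only [cross, Complex.mul_re, Complex.mul_im, Complex.conj_re, Complex.conj_im]
    linear_combination (V.re * W.im - V.im * W.re) * hn
  rw [e]
  exact cross_chord_chord_pos hr h1 h2 h3

theorem outAngle_lt_iff (hr : 8 ≤ r) {s t u : ℝ} (h1 : s < t) (h1' : t < s + Ω.L) (h2 : s < u)
    (h2' : u < s + Ω.L) : Ω.outAngle s t < Ω.outAngle s u ↔ t < u := by
  refine ⟨fun h => ?_, fun h => outAngle_strictMono hr h1 h h2'⟩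
  by_contra hcon
  rcases (not_lt.1 hcon).eq_or_lt with h3 | h3
  · rw [h3] at h
    exact lt_irrefl _ h
  · exact lt_asymm h (outAngle_strictMono hr h2 h3 h1')

theorem outAngle_inj (hr : 8 ≤ r) {s t u : ℝ} (h1 : s < t) (h1' : t < s + Ω.L) (h2 : s < u)
    (h2' : u < s + Ω.L) (h : Ω.outAngle s t = Ω.outAngle s u) : t = u := by
  rcases lt_trichotomy t u with h3 | h3 | h3
  · exact absurd h (outAngle_strictMono hr h1 h3 h2').ne
  · exact h3
  · exact absurd h (outAngle_strictMono hr h2 h3 h1').ne'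

/-- Lifting the source by one period turns an incoming chord into an outgoing one, so facts about
outgoing angles cover both. -/
theorem inAngle_eq (s' s : ℝ) : Ω.inAngle s' s = Real.pi - Ω.outAngle s (s' + Ω.L) := by
  rw [inAngle, outAngle, Ω.periodic s', ← InnerProductGeometry.angle_neg_left, neg_sub]

theorem continuousOn_outAngle (hr : 8 ≤ r) (s : ℝ) :
    ContinuousOn (Ω.outAngle s) (Ioo s (s + Ω.L)) := by
  have h : ContinuousOn (fun t => Complex.arg (Ω.chordFrame s t)) (Ioo s (s + Ω.L)) := by
    intro t ht
    refine ContinuousAt.continuousWithinAt ?_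
    have h1 : ContinuousAt (Ω.chordFrame s) t :=
      (((continuous_boundary hr).sub continuous_const).div_const _).continuousAt
    exact (Complex.continuousAt_arg (Or.inr (chordFrame_im_pos hr ht.1 ht.2).ne')).comp h1
  exact h.congr fun t ht => outAngle_eq_arg hr ht.1 ht.2

/-- Dividing by `t - s` makes the chord tend to the tangent from both sides. To the right of `s` the
factor is positive and the angle itself tends to `0`; to the left it is negative and the angle tends
to `π`. -/
theorem tendsto_arg_chordFrame_smul (hr : 8 ≤ r) (s : ℝ) :
    Tendsto (fun t => Complex.arg ((((t - s)⁻¹ : ℝ) : ℂ) * Ω.chordFrame s t)) (𝓝[≠] s) (𝓝 0) := by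
  have h1 := (hasDerivAt_boundary (Ω := Ω) hr s).tendsto_slope
  have h2 : Tendsto (fun t => ((((t - s)⁻¹ : ℝ) : ℂ) * Ω.chordFrame s t)) (𝓝[≠] s) (𝓝 1) := by
    have := h1.div_const (deriv Ω.Γ s)
    rw [div_self (tangent_ne_zero s)] at this
    refine this.congr fun t => ?_
    rw [slope, vsub_eq_sub, chordFrame, Complex.real_smul, mul_div_assoc]
  have h3 := (Complex.continuousAt_arg Complex.one_mem_slitPlane).tendsto.comp h2
  rwa [Complex.arg_one] at h3

theorem exists_outAngle_eq (hr : 8 ≤ r) (s : ℝ) {α : ℝ} (hα : α ∈ Ioo 0 Real.pi) :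
    ∃ t, s < t ∧ t < s + Ω.L ∧ Ω.outAngle s t = α := by
  have hL := Ω.L_pos
  have hlim := tendsto_arg_chordFrame_smul (Ω := Ω) hr s
  obtain ⟨t₁, ht₁, h1⟩ : ∃ t ∈ Ioo s (s + Ω.L), Ω.outAngle s t < α := by
    have h1 := (hlim.mono_left (nhdsWithin_mono s (fun t (ht : t ∈ Ioi s) => ne_of_gt ht))).eventually
      (gt_mem_nhds hα.1)
    obtain ⟨t, ht, ht2⟩ := (h1.and (Ioo_mem_nhdsGT (by linarith : s < s + Ω.L))).exists
    refine ⟨t, ht2, ?_⟩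
    rw [outAngle_eq_arg hr ht2.1 ht2.2]
    rwa [Complex.arg_real_mul _ (by
      have := ht2.1
      rw [inv_pos]
      linarith)] at ht
  -- Angles near `π` occur for endpoints just before `s`, lifted by one period.
  obtain ⟨t₂, ht₂, h2⟩ : ∃ t ∈ Ioo s (s + Ω.L), α < Ω.outAngle s t := by
    have h1 := (hlim.mono_left (nhdsWithin_mono s (fun t (ht : t ∈ Iio s) => ne_of_lt ht))).eventually
      (lt_mem_nhds (by linarith [hα.2] : α - Real.pi < 0))
    obtain ⟨t, ht, ht2⟩ := (h1.and (Ioo_mem_nhdsLT (by linarith : s - Ω.L < s))).exists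
    have hI : t + Ω.L ∈ Ioo s (s + Ω.L) := ⟨by linarith [ht2.1], by linarith [ht2.2]⟩
    refine ⟨t + Ω.L, hI, ?_⟩
    have him := chordFrame_im_pos hr hI.1 hI.2
    rw [outAngle_eq_arg hr hI.1 hI.2]
    have e : Ω.chordFrame s (t + Ω.L) = Ω.chordFrame s t := by
      rw [chordFrame, chordFrame, Ω.periodic]
    rw [e] at him ⊢
    have e2 : (((t - s)⁻¹ : ℝ) : ℂ) * Ω.chordFrame s t =
        (((s - t)⁻¹ : ℝ) : ℂ) * (-Ω.chordFrame s t) := by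
      rw [← neg_sub s t, inv_neg]
      push_cast
      ring
    rw [e2, Complex.arg_real_mul _ (by
      have := ht2.2
      rw [inv_pos]
      linarith), Complex.arg_neg_eq_arg_sub_pi_of_im_pos him] at ht
    linarith
  obtain ⟨t, ht, h⟩ := (isPreconnected_Ioo (a := s) (b := s + Ω.L)).intermediate_value ht₁ ht₂
    (continuousOn_outAngle hr s) (show α ∈ Icc _ _ from ⟨h1.le, h2.le⟩)
  exact ⟨t, ht.1, ht.2, h⟩

/-! ### The billiard map -/

theorem exists_next (hr : 8 ≤ r) {a b : ℝ} (h : a < b) (h' : b < a + Ω.L) :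
    ∃ c, b < c ∧ c < b + Ω.L ∧ Ω.inAngle a b = Ω.outAngle b c := by
  have h1 := outAngle_mem_Ioo (Ω := Ω) hr h' (by linarith : a + Ω.L < b + Ω.L)
  obtain ⟨c, hc1, hc2, hc3⟩ := exists_outAngle_eq (Ω := Ω) hr b
    (α := Real.pi - Ω.outAngle b (a + Ω.L)) ⟨by linarith [h1.2], by linarith [h1.1]⟩
  exact ⟨c, hc1, hc2, by rw [inAngle_eq, hc3]⟩

theorem exists_prev (hr : 8 ≤ r) {b c : ℝ} (h : b < c) (h' : c < b + Ω.L) :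
    ∃ a, a < b ∧ b < a + Ω.L ∧ Ω.inAngle a b = Ω.outAngle b c := by
  have h1 := outAngle_mem_Ioo (Ω := Ω) hr h h'
  obtain ⟨a, ha1, ha2, ha3⟩ := exists_outAngle_eq (Ω := Ω) hr b
    (α := Real.pi - Ω.outAngle b c) ⟨by linarith [h1.2], by linarith [h1.1]⟩
  refine ⟨a - Ω.L, by linarith, by linarith, ?_⟩
  rw [inAngle_eq, sub_add_cancel, ha3, sub_sub_cancel]

theorem next_unique (hr : 8 ≤ r) {a b c c' : ℝ} (h1 : b < c) (h1' : c < b + Ω.L) (h2 : b < c')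
    (h2' : c' < b + Ω.L) (h : Ω.inAngle a b = Ω.outAngle b c) (h' : Ω.inAngle a b = Ω.outAngle b c') :
    c = c' :=
  outAngle_inj hr h1 h1' h2 h2' (h.symm.trans h')

theorem prev_unique (hr : 8 ≤ r) {a a' b c : ℝ} (h1 : a < b) (h1' : b < a + Ω.L) (h2 : a' < b)
    (h2' : b < a' + Ω.L) (h : Ω.inAngle a b = Ω.outAngle b c) (h' : Ω.inAngle a' b = Ω.outAngle b c) :
    a = a' := by
  have h3 := h.trans h'.symm
  rw [inAngle_eq, inAngle_eq] at h3
  have := outAngle_inj (Ω := Ω) hr h1' (by linarith) h2' (by linarith) (by linarith :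
    Ω.outAngle b (a + Ω.L) = Ω.outAngle b (a' + Ω.L))
  linarith

/-- Each chord determines its successor and its predecessor, so reflection is a permutation of the
phase space; its integer powers give the orbit in both time directions. -/
theorem exists_isOrbit (hr : 8 ≤ r) {a b : ℝ} (h : a < b) (h' : b < a + Ω.L) :
    ∃ s, Ω.IsOrbit s ∧ s 0 = a ∧ s 1 = b := by
  let Ph := {p : ℝ × ℝ // p.1 < p.2 ∧ p.2 < p.1 + Ω.L}
  have hnext : ∀ p : Ph, ∃ p' : Ph, p'.1.1 = p.1.2 ∧ Ω.inAngle p.1.1 p.1.2 = Ω.outAngle p.1.2 p'.1.2 := by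
    intro p
    obtain ⟨c, h1, h2, h3⟩ := exists_next (Ω := Ω) hr p.2.1 p.2.2
    exact ⟨⟨(p.1.2, c), h1, h2⟩, rfl, h3⟩
  choose next hn1 hn2 using hnext
  have hbij : Function.Bijective next := by
    refine ⟨fun p p' hpp => ?_, fun p => ?_⟩
    · have e1 : p.1.2 = p'.1.2 := by rw [← hn1, ← hn1, hpp]
      have h1 := hn2 p
      have h2 := hn2 p'
      rw [← hpp, ← e1] at h2
      have e2 := prev_unique hr p.2.1 p.2.2 (by rw [e1]; exact p'.2.1) (by rw [e1]; exact p'.2.2) h1 h2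
      exact Subtype.ext (Prod.ext e2 e1)
    · obtain ⟨a, h1, h2, h3⟩ := exists_prev (Ω := Ω) hr p.2.1 p.2.2
      refine ⟨⟨(a, p.1.1), h1, h2⟩, ?_⟩
      have e1 := hn1 ⟨(a, p.1.1), h1, h2⟩
      have e2 := hn2 ⟨(a, p.1.1), h1, h2⟩
      simp only [] at e1 e2
      have e3 := (next ⟨(a, p.1.1), h1, h2⟩).2
      rw [e1] at e3
      exact Subtype.ext (Prod.ext e1 (next_unique hr e3.1 e3.2 p.2.1 p.2.2 e2 h3))
  let E : Equiv.Perm Ph := Equiv.ofBijective next hbij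
  let p₀ : Ph := ⟨(a, b), h, h'⟩
  have hE : ∀ k : ℤ, (E ^ (k + 1)) p₀ = next ((E ^ k) p₀) := by
    intro k
    rw [add_comm, zpow_one_add, Equiv.Perm.mul_apply]
    rfl
  have hE1 : ∀ k : ℤ, ((E ^ (k + 1)) p₀).1.1 = ((E ^ k) p₀).1.2 := fun k => by rw [hE, hn1]
  refine ⟨fun k => ((E ^ k) p₀).1.1, ⟨fun k => ?_, fun k => ?_⟩, ?_, ?_⟩
  · simp only [hE1]
    exact ((E ^ k) p₀).2
  · have h1 := hn2 ((E ^ (k - 1)) p₀)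
    rw [← hE, ← hE1, sub_add_cancel, ← hE1] at h1
    exact h1
  · simp [p₀]
  · have := hE1 0
    rw [zero_add] at this
    simp only [this]
    simp [p₀]

theorem IsPeriodicOrbit.nat_shift {q : ℕ} {s : ℤ → ℝ} (h : Ω.IsPeriodicOrbit 1 q s) (n : ℕ) (k : ℤ) :
    s (k + n * q) = s k + n * Ω.L := by
  induction n with
  | zero => simp
  | succ n ih =>
    have := h.2 (k + n * q)
    rw [ih] at this
    rw [show k + ((n + 1 : ℕ) : ℤ) * q = k + n * q + q by push_cast; ring, this]
    push_cast
    ring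

/-- Two consecutive impacts determine the forward orbit; negative times are reached by adding
periods. -/
theorem IsPeriodicOrbit.ext (hr : 8 ≤ r) {q : ℕ} (hq : 0 < q) {s t : ℤ → ℝ}
    (hs : Ω.IsPeriodicOrbit 1 q s) (ht : Ω.IsPeriodicOrbit 1 q t) (h0 : s 0 = t 0) (h1 : s 1 = t 1) :
    s = t := by
  have hnat : ∀ n : ℕ, s n = t n ∧ s (n + 1) = t (n + 1) := by
    intro n
    induction n with
    | zero => exact ⟨by simpa using h0, by simpa using h1⟩
    | succ n ih =>
      have a := hs.1.2 ((n : ℤ) + 1)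
      have b := ht.1.2 ((n : ℤ) + 1)
      have c := hs.1.1 ((n : ℤ) + 1)
      have d := ht.1.1 ((n : ℤ) + 1)
      rw [add_sub_cancel_right] at a b
      rw [← ih.1, ← ih.2] at b
      rw [← ih.2] at d
      push_cast
      exact ⟨ih.2, next_unique hr c.1 c.2 d.1 d.2 a b⟩
  funext k
  have hk : k + (k.natAbs : ℕ) * q = ((k + (k.natAbs : ℕ) * q).toNat : ℕ) := by
    have : (1 : ℤ) ≤ q := by exact_mod_cast hq
    have : 0 ≤ k + (k.natAbs : ℕ) * q := by
      have : -k ≤ k.natAbs := by omega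
      nlinarith [Int.natCast_nonneg k.natAbs]
    omega
  have e1 := hs.nat_shift k.natAbs k
  have e2 := ht.nat_shift k.natAbs k
  rw [hk] at e1 e2
  have := (hnat (k + (k.natAbs : ℕ) * q).toNat).1
  linarith

end Table
end Billiard

/-! ### Caustics and the induced map of the boundary. -/

namespace Billiard
open Set Filter Topology
namespace Table

variable {r : ℕ} {Ω : Table r}

theorem cross_tangent_boundary_nonneg (hr : 8 ≤ r) (s t : ℝ) :
    0 ≤ cross (deriv Ω.Γ s) (Ω.Γ t - Ω.Γ s) := by
  have hL := Ω.L_pos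
  obtain ⟨t', ht', he⟩ : ∃ t' ∈ Ico s (s + Ω.L), Ω.Γ t = Ω.Γ t' := Ω.periodic.exists_mem_Ico hL t s
  rw [he]
  rcases ht'.1.eq_or_lt with h | h
  · rw [← h, sub_self]
    simp [cross]
  · exact (cross_tangent_chord_pos hr h ht'.2).le

/-- The convex hull lies in the closed half-plane of the tangent. An interior point can be pushed
slightly towards the tangent line without leaving the hull, so it is strictly inside the half-plane.
-/
theorem cross_tangent_pos_of_mem_domain (hr : 8 ≤ r) (s : ℝ) {u : ℂ} (hu : u ∈ Ω.domain) :
    0 < cross (deriv Ω.Γ s) (u - Ω.Γ s) := by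
  have hconv : Convex ℝ {z : ℂ | 0 ≤ cross (deriv Ω.Γ s) (z - Ω.Γ s)} := by
    intro z hz w hw a b ha hb hab
    simp only [mem_ofPred_eq] at *
    have e : (a • z + b • w) - Ω.Γ s = (a : ℂ) * (z - Ω.Γ s) + (b : ℂ) * (w - Ω.Γ s) := by
      have : (a : ℂ) + b = 1 := by exact_mod_cast hab
      rw [Complex.real_smul, Complex.real_smul]
      linear_combination (Ω.Γ s) * this
    rw [e, cross_add_right, cross_real_mul_right, cross_real_mul_right]
    positivity
  have hsub : convexHull ℝ (range Ω.Γ) ⊆ {z : ℂ | 0 ≤ cross (deriv Ω.Γ s) (z - Ω.Γ s)} := by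
    refine convexHull_min ?_ hconv
    rintro _ ⟨t, rfl⟩
    exact cross_tangent_boundary_nonneg hr s t
  obtain ⟨ε, hε, hball⟩ := Metric.isOpen_iff.1 isOpen_interior u hu
  have hmem : u - ((ε / 2 : ℝ) : ℂ) * (Complex.I * deriv Ω.Γ s) ∈ Metric.ball u ε := by
    rw [Metric.mem_ball, dist_eq_norm, sub_sub_cancel_left, norm_neg, norm_mul, norm_mul,
      Ω.unit_speed, Complex.norm_I, Complex.norm_real, Real.norm_of_nonneg (by positivity)]
    linarith
  have h1 := hsub (interior_subset (hball hmem))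
  simp only [mem_ofPred_eq] at h1
  have hn : cross (deriv Ω.Γ s) (Complex.I * deriv Ω.Γ s) = 1 := by
    have : (deriv Ω.Γ s).re * (deriv Ω.Γ s).re + (deriv Ω.Γ s).im * (deriv Ω.Γ s).im = 1 := by
      rw [← Complex.normSq_apply, Complex.normSq_eq_norm_sq, Ω.unit_speed, one_pow]
    simp [cross]
    linarith
  rw [sub_right_comm, cross_sub_right, cross_real_mul_right, hn] at h1
  linarith

/-- Through each boundary point there is a chord with the compact set `K` on its left, and
touching `K`. -/
theorem exists_tangentLeft (hr : 8 ≤ r) {K : Set ℂ} (hK : IsCompact K) (hne : K.Nonempty)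
    (hsub : K ⊆ Ω.domain) (s : ℝ) :
    ∃ t, s < t ∧ t < s + Ω.L ∧ TangentLeft K (Ω.Γ s) (Ω.Γ t) := by
  have hL := Ω.L_pos
  have hpos : ∀ u ∈ K, 0 < cross (deriv Ω.Γ s) (u - Ω.Γ s) := fun u hu =>
    cross_tangent_pos_of_mem_domain hr s (hsub hu)
  -- The least position of `K` relative to a direction, continuous in the direction. It is positive
  -- for chords ending just after `s` and negative for those ending just before `s + L`; a zero in
  -- between is a tangent chord.
  set B : ℂ → ℝ := fun w => sInf ((fun u => cross w (u - Ω.Γ s)) '' K) with hB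
  have hu_cont : ∀ w, Continuous fun u => cross w (u - Ω.Γ s) := fun w =>
    continuous_cross.comp (continuous_const.prodMk (continuous_id.sub continuous_const))
  have hBc : Continuous B := hK.continuous_sInf
    (continuous_cross.comp (continuous_fst.prodMk (continuous_snd.sub continuous_const)))
  have hatt : ∀ w, ∃ u ∈ K, cross w (u - Ω.Γ s) = B w := fun w =>
    (hK.image (hu_cont w)).sInf_mem (hne.image _)
  have hle : ∀ w, ∀ u ∈ K, B w ≤ cross w (u - Ω.Γ s) := fun w u hu =>
    csInf_le (hK.image (hu_cont w)).bddBelow ⟨u, hu, rfl⟩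
  have hBT : 0 < B (deriv Ω.Γ s) := by
    obtain ⟨u, hu, h⟩ := hatt (deriv Ω.Γ s)
    rw [← h]
    exact hpos u hu
  have hslope : ∀ᶠ t in 𝓝[≠] s, 0 < B (slope Ω.Γ s t) :=
    (hBc.continuousAt.tendsto.comp (hasDerivAt_boundary (Ω := Ω) hr s).tendsto_slope).eventually
      (lt_mem_nhds hBT)
  have hsl : ∀ t u, t ≠ s → cross (Ω.Γ t - Ω.Γ s) (u - Ω.Γ s) =
      (t - s) * cross (slope Ω.Γ s t) (u - Ω.Γ s) := by
    intro t u ht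
    rw [← cross_real_mul_left, slope, vsub_eq_sub, ← Complex.real_smul, smul_smul,
      mul_inv_cancel₀ (sub_ne_zero.2 ht), one_smul]
  obtain ⟨t₁, ht₁, h1⟩ : ∃ t ∈ Ioo s (s + Ω.L), 0 < B (Ω.Γ t - Ω.Γ s) := by
    obtain ⟨t, ht, ht2⟩ := ((hslope.filter_mono (nhdsWithin_mono s
      (fun t (ht : t ∈ Ioi s) => ne_of_gt ht))).and (Ioo_mem_nhdsGT (by linarith : s < s + Ω.L))).exists
    refine ⟨t, ht2, ?_⟩
    obtain ⟨u, hu, h⟩ := hatt (Ω.Γ t - Ω.Γ s)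
    rw [← h, hsl t u ht2.1.ne']
    exact mul_pos (sub_pos.2 ht2.1) (ht.trans_le (hle _ u hu))
  obtain ⟨t₂, ht₂, h2⟩ : ∃ t ∈ Ioo s (s + Ω.L), B (Ω.Γ t - Ω.Γ s) < 0 := by
    obtain ⟨t, ht, ht2⟩ := ((hslope.filter_mono (nhdsWithin_mono s
      (fun t (ht : t ∈ Iio s) => ne_of_lt ht))).and (Ioo_mem_nhdsLT (by linarith : s - Ω.L < s))).exists
    refine ⟨t + Ω.L, ⟨by linarith [ht2.1], by linarith [ht2.2]⟩, ?_⟩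
    rw [Ω.periodic]
    obtain ⟨u, hu⟩ := hne
    refine (hle _ u hu).trans_lt ?_
    rw [hsl t u ht2.2.ne]
    exact mul_neg_of_neg_of_pos (sub_neg.2 ht2.2) (ht.trans_le (hle _ u hu))
  obtain ⟨t, ht, h0⟩ := (isPreconnected_Ioo (a := s) (b := s + Ω.L)).intermediate_value ht₂ ht₁
    (hBc.comp ((continuous_boundary hr).sub continuous_const)).continuousOn
    (show (0 : ℝ) ∈ Icc _ _ from ⟨h2.le, h1.le⟩)
  simp only [Function.comp] at h0
  refine ⟨t, ht.1, ht.2, fun u hu => ?_, ?_⟩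
  · rw [← h0]
    exact hle _ u hu
  · obtain ⟨u, hu, h⟩ := hatt (Ω.Γ t - Ω.Γ s)
    exact ⟨u, hu, h.trans h0⟩

/-- Two nested chords cannot both touch the same set on their left. -/
theorem eq_of_tangentLeft_nested (hr : 8 ≤ r) {K : Set ℂ} (hsub : K ⊆ Ω.domain) {a b c e : ℝ}
    (hab : a ≤ b) (hbc : b < c) (hce : c ≤ e) (hea : e < a + Ω.L)
    (h1 : ∀ u ∈ K, 0 ≤ cross (Ω.Γ e - Ω.Γ a) (u - Ω.Γ a))
    (h2 : ∃ u ∈ K, cross (Ω.Γ c - Ω.Γ b) (u - Ω.Γ b) = 0) : a = b ∧ c = e := by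
  obtain ⟨u, hu, h0⟩ := h2
  have hl := h1 u hu
  have hb := cross_tangent_pos_of_mem_domain hr b (hsub hu)
  have hc := cross_tangent_pos_of_mem_domain hr c (hsub hu)
  have hbc1 := cross_tangent_chord_pos (Ω := Ω) hr hbc (by linarith)
  have hbc2 := cross_chord_tangent_pos (Ω := Ω) hr hbc (by linarith)
  have hB : 0 ≤ cross (Ω.Γ b - Ω.Γ a) (Ω.Γ e - Ω.Γ a) := by
    rcases hab.eq_or_lt with h | h
    · rw [h, sub_self]; simp [cross]
    · exact (cross_chord_chord_pos hr h (hbc.trans_le hce) hea).le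
  have hC : 0 ≤ cross (Ω.Γ c - Ω.Γ a) (Ω.Γ e - Ω.Γ a) := by
    rcases hce.eq_or_lt with h | h
    · rw [h, cross_self]
    · exact (cross_chord_chord_pos hr (hab.trans_lt hbc) h hea).le
  set β := cross (deriv Ω.Γ b) (u - Ω.Γ b) with hβ
  set δ := cross (deriv Ω.Γ b) (Ω.Γ c - Ω.Γ b) with hδ
  -- The touching point `u` lies on the line through `Γ b` and `Γ c` with barycentric parameter
  -- `β/δ`, and `key2` shows that `β < δ`. So `u` is strictly inside the inner chord, hence not on
  -- the left of the outer one unless the chords coincide.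
  have key1 : δ * cross (Ω.Γ e - Ω.Γ a) (u - Ω.Γ a) =
      -((δ - β) * cross (Ω.Γ b - Ω.Γ a) (Ω.Γ e - Ω.Γ a) + β * cross (Ω.Γ c - Ω.Γ a) (Ω.Γ e - Ω.Γ a)) := by
    rw [hβ, hδ]
    simp only [cross, Complex.sub_re, Complex.sub_im] at *
    linear_combination (-(deriv Ω.Γ b).re * ((Ω.Γ e).im - (Ω.Γ a).im) +
      (deriv Ω.Γ b).im * ((Ω.Γ e).re - (Ω.Γ a).re)) * (-h0)
  have key2 : δ * cross (deriv Ω.Γ c) (u - Ω.Γ c) =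
      (δ - β) * cross (Ω.Γ c - Ω.Γ b) (deriv Ω.Γ c) := by
    rw [hβ, hδ]
    simp only [cross, Complex.sub_re, Complex.sub_im] at *
    linear_combination ((deriv Ω.Γ b).re * (deriv Ω.Γ c).im -
      (deriv Ω.Γ b).im * (deriv Ω.Γ c).re) * h0
  have hδβ : 0 < δ - β := by
    have : 0 < (δ - β) * cross (Ω.Γ c - Ω.Γ b) (deriv Ω.Γ c) := by
      rw [← key2]
      positivity
    exact (pos_iff_pos_of_mul_pos this).2 hbc2
  have hnn : 0 ≤ δ * cross (Ω.Γ e - Ω.Γ a) (u - Ω.Γ a) := by positivity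
  have hz1 := mul_nonneg hδβ.le hB
  have hz2 := mul_nonneg hb.le hC
  have hB0 : (δ - β) * cross (Ω.Γ b - Ω.Γ a) (Ω.Γ e - Ω.Γ a) = 0 := by linarith
  have hC0 : β * cross (Ω.Γ c - Ω.Γ a) (Ω.Γ e - Ω.Γ a) = 0 := by linarith
  constructor
  · by_contra hne
    have := cross_chord_chord_pos (Ω := Ω) hr (lt_of_le_of_ne hab hne) (hbc.trans_le hce) hea
    exact (mul_pos hδβ this).ne' hB0
  · by_contra hne
    have := cross_chord_chord_pos (Ω := Ω) hr (hab.trans_lt hbc) (lt_of_le_of_ne hce hne) hea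
    exact (mul_pos hb this).ne' hC0

/-- The circle map induced on the boundary by a caustic of rotation number `1 / q`. -/
theorem exists_caustic_map (hr : 8 ≤ r) {q : ℕ} (hq : 0 < q) {K : Set ℂ}
    (hK : Ω.IsIntegrableRationalCaustic 1 q K) :
    ∃ σ : ℝ → ℝ, StrictMono σ ∧ Function.Surjective σ ∧ (∀ s, s < σ s ∧ σ s < s + Ω.L) ∧
      (∀ s, ∃ t, Ω.IsPeriodicOrbit 1 q t ∧ t 0 = s ∧ ∀ k, t (k + 1) = σ (t k)) ∧
      ∀ t, Ω.IsPeriodicOrbit 1 q t → t 1 = σ (t 0) := by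
  obtain ⟨⟨hKc, hKconv, hKint, hKsub, hKt⟩, hper⟩ := hK
  have hne : K.Nonempty := hKint.mono interior_subset
  choose σ hσ1 hσ2 hσ3 using exists_tangentLeft (Ω := Ω) hr hKc hne hKsub
  -- Two chords from the same point are nested.
  have huniq : ∀ s t, s < t → t < s + Ω.L → TangentLeft K (Ω.Γ s) (Ω.Γ t) → t = σ s := by
    intro s t h1 h2 h3
    rcases le_total t (σ s) with h | h
    · exact (eq_of_tangentLeft_nested hr hKsub le_rfl h1 h (hσ2 s) (hσ3 s).1 h3.2).2
    · exact (eq_of_tangentLeft_nested hr hKsub le_rfl (hσ1 s) h h2 h3.1 (hσ3 s).2).2.symm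
  have hmono : StrictMono σ := by
    intro a b hab
    by_contra hcon
    push Not at hcon
    have := (eq_of_tangentLeft_nested hr hKsub hab.le (hσ1 b) hcon (hσ2 a) (hσ3 a).1 (hσ3 b).2).1
    exact hab.ne this
  have horb : ∀ s, ∃ t, Ω.IsPeriodicOrbit 1 q t ∧ t 0 = s ∧ ∀ k, t (k + 1) = σ (t k) := by
    intro s
    obtain ⟨t, ht, h0, h1⟩ := exists_isOrbit (Ω := Ω) hr (hσ1 s) (hσ2 s)
    have htan : TangentLeft K (Ω.Γ (t 0)) (Ω.Γ (t 1)) := by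
      rw [h0, h1]
      exact hσ3 s
    refine ⟨t, hper t ht htan, h0, fun k => ?_⟩
    exact huniq _ _ (ht.1 k).1 (ht.1 k).2 (hKt t ht htan k)
  -- Started one period before `y`, the caustic orbit reaches `y` after `q` bounces.
  have hsurj : Function.Surjective σ := by
    intro y
    obtain ⟨t, ht, h0, h1⟩ := horb (y - Ω.L)
    have h2 := ht.2 0
    have h3 := h1 ((q : ℤ) - 1)
    refine ⟨t ((q : ℤ) - 1), ?_⟩
    rw [← h3, sub_add_cancel]
    rw [zero_add, h0] at h2
    rw [h2]
    push_cast
    ring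
  refine ⟨σ, hmono, hsurj, fun s => ⟨hσ1 s, hσ2 s⟩, horb, fun t ht => ?_⟩
  -- an orbit that starts above, or below, the invariant curve stays on the same side
  have hstep : ∀ k : ℤ, ∃ u, σ u = t k ∧ u < t k ∧ t k < u + Ω.L ∧
      Ω.outAngle (t k) (σ (t k)) = Real.pi - Ω.outAngle (t k) (u + Ω.L) := by
    intro k
    obtain ⟨u, hu⟩ := hsurj (t k)
    obtain ⟨w, hw, hw0, hw1⟩ := horb u
    have e1 : w 1 = t k := by rw [← hu, ← hw0]; simpa using hw1 0
    have e2 : w 2 = σ (t k) := by rw [← e1]; simpa using hw1 1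
    have h1 := hw.1.2 1
    norm_num at h1
    rw [hw0, e1, e2, inAngle_eq] at h1
    exact ⟨u, hu, hu ▸ hσ1 u, hu ▸ hσ2 u, h1.symm⟩
  have htk : ∀ k : ℤ, Ω.outAngle (t k) (t (k + 1)) = Real.pi - Ω.outAngle (t k) (t (k - 1) + Ω.L) := by
    intro k
    rw [← inAngle_eq]
    exact (ht.1.2 k).symm
  have hb : ∀ k : ℤ, t (k - 1) < t k ∧ t k < t (k - 1) + Ω.L := by
    intro k
    have := ht.1.1 (k - 1)
    rwa [sub_add_cancel] at this
  have horb0 := horb (t 0)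
  obtain ⟨w, hw, hw0, hw1⟩ := horb0
  -- The given orbit and the caustic orbit from the same point both complete one turn in `q`
  -- bounces; a strict order between them is therefore impossible.
  have hend : w q = t q := by
    have h1 := hw.2 0
    have h2 := ht.2 0
    rw [zero_add] at h1 h2
    rw [h1, h2, hw0]
  by_contra hcon
  rcases lt_or_gt_of_ne hcon with h | h
  -- If the orbit falls short of the caustic map, then at the next impact its source lies later than
  -- the caustic predecessor. The incoming chord is steeper, so the reflected angle is smaller and
  -- the orbit falls short again.
  · have hall : ∀ n : ℕ, t (n + 1) < σ (t n) := by
      intro n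
      induction n with
      | zero => simpa using h
      | succ n ih =>
        obtain ⟨u, hu1, hu2, hu3, hu4⟩ := hstep (n + 1)
        have h5 := htk (n + 1)
        have h6 := hb (n + 1)
        rw [add_sub_cancel_right] at h5 h6
        rw [← hu1] at ih
        have h7 := hmono.lt_iff_lt.1 ih
        have h8 := outAngle_strictMono (Ω := Ω) hr (s := t (n + 1)) (t := u + Ω.L) (u := t n + Ω.L)
          hu3 (by linarith) (by linarith)
        push_cast
        have h9 := ht.1.1 (n + 1)
        exact (outAngle_lt_iff hr h9.1 h9.2 (hσ1 _) (hσ2 _)).1 (by rw [h5, hu4]; linarith)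
    have hlt : ∀ n : ℕ, t (n + 1) < w (n + 1) := by
      intro n
      induction n with
      | zero =>
        have h1 : w 1 = σ (t 0) := by
          have := hw1 0
          rw [hw0] at this
          simpa using this
        simpa [h1] using h
      | succ n ih =>
        push_cast
        rw [hw1 (n + 1)]
        have := hall (n + 1)
        push_cast at this
        exact this.trans (hmono ih)
    obtain ⟨p, rfl⟩ : ∃ p, q = p + 1 := ⟨q - 1, by omega⟩
    have := hlt p
    push_cast at hend
    rw [hend] at this
    exact lt_irrefl _ this
  · have hall : ∀ n : ℕ, σ (t n) < t (n + 1) := by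
      intro n
      induction n with
      | zero => simpa using h
      | succ n ih =>
        obtain ⟨u, hu1, hu2, hu3, hu4⟩ := hstep (n + 1)
        have h5 := htk (n + 1)
        have h6 := hb (n + 1)
        rw [add_sub_cancel_right] at h5 h6
        rw [← hu1] at ih
        have h7 := hmono.lt_iff_lt.1 ih
        have h8 := outAngle_strictMono (Ω := Ω) hr (s := t (n + 1)) (t := t n + Ω.L) (u := u + Ω.L)
          (by linarith) (by linarith) (by linarith)
        push_cast
        have h9 := ht.1.1 (n + 1)
        exact (outAngle_lt_iff hr (hσ1 _) (hσ2 _) h9.1 h9.2).1 (by rw [h5, hu4]; linarith)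
    have hlt : ∀ n : ℕ, w (n + 1) < t (n + 1) := by
      intro n
      induction n with
      | zero =>
        have h1 : w 1 = σ (t 0) := by
          have := hw1 0
          rw [hw0] at this
          simpa using this
        simpa [h1] using h
      | succ n ih =>
        push_cast
        rw [hw1 (n + 1)]
        have := hall (n + 1)
        push_cast at this
        exact (hmono ih).trans this
    obtain ⟨p, rfl⟩ : ∃ p, q = p + 1 := ⟨q - 1, by omega⟩
    have := hlt p
    push_cast at hend
    rw [hend] at this
    exact lt_irrefl _ this

end Table
end Billiard

/-! ### The Lazutkin parameter and its inverse. -/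

namespace Billiard
open Set Filter Topology
namespace Table

variable {r : ℕ} {Ω : Table r}

theorem rho_pos (s : ℝ) : 0 < Ω.rho s := inv_pos.2 (curv_pos s)

theorem rho_rpow (s : ℝ) (p : ℝ) : Ω.rho s ^ p = Ω.curv s ^ (-p) := by
  rw [Real.rpow_neg (curv_pos s).le, ← Real.inv_rpow (curv_pos s).le]
  rfl

theorem contDiff_rho_rpow (hr : 8 ≤ r) (p : ℝ) : ContDiff ℝ 6 fun s => Ω.rho s ^ p := by
  simp only [rho_rpow]
  exact (contDiff_curv hr).rpow_const_of_ne fun s => (curv_pos s).ne'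

theorem rho_rpow_pos (p s : ℝ) : 0 < Ω.rho s ^ p := Real.rpow_pos_of_pos (rho_pos s) p

theorem rho_add_period (s : ℝ) : Ω.rho (s + Ω.L) = Ω.rho s := congrArg (·⁻¹) (curv_add_period s)

theorem integrable_rho_rpow (hr : 8 ≤ r) (p a b : ℝ) :
    IntervalIntegrable (fun s => Ω.rho s ^ p) MeasureTheory.volume a b :=
  (contDiff_rho_rpow hr p).continuous.intervalIntegrable _ _

theorem lazConst_pos (hr : 8 ≤ r) : 0 < Ω.lazConst :=
  inv_pos.2 (intervalIntegral.intervalIntegral_pos_of_pos (integrable_rho_rpow hr _ _ _)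
    (fun s => rho_rpow_pos _ s) Ω.L_pos)

theorem hasDerivAt_laz (hr : 8 ≤ r) (s : ℝ) :
    HasDerivAt Ω.laz (Ω.lazConst * Ω.rho s ^ (-(2 / 3) : ℝ)) s := by
  have hc := (contDiff_rho_rpow (Ω := Ω) hr (-(2 / 3))).continuous
  exact (intervalIntegral.integral_hasDerivAt_right (integrable_rho_rpow hr _ _ _)
    hc.aestronglyMeasurable.stronglyMeasurableAtFilter hc.continuousAt).const_mul _

theorem deriv_laz_pos (hr : 8 ≤ r) (s : ℝ) : 0 < Ω.lazConst * Ω.rho s ^ (-(2 / 3) : ℝ) :=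
  mul_pos (lazConst_pos hr) (rho_rpow_pos _ s)

theorem contDiff_laz (hr : 8 ≤ r) : ContDiff ℝ 7 Ω.laz := by
  rw [show (7 : WithTop ℕ∞) = 6 + 1 by norm_num, contDiff_succ_iff_deriv]
  refine ⟨fun s => (hasDerivAt_laz hr s).differentiableAt, by simp, ?_⟩
  rw [show deriv Ω.laz = _ from funext fun s => (hasDerivAt_laz hr s).deriv]
  exact contDiff_const.mul (contDiff_rho_rpow hr _)

theorem continuous_laz (hr : 8 ≤ r) : Continuous Ω.laz := (contDiff_laz hr).continuous

theorem strictMono_laz (hr : 8 ≤ r) : StrictMono Ω.laz :=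
  strictMono_of_hasDerivAt_pos (hasDerivAt_laz hr) (deriv_laz_pos hr)

theorem laz_add_period (hr : 8 ≤ r) (s : ℝ) : Ω.laz (s + Ω.L) = Ω.laz s + 1 := by
  have hper : Function.Periodic (fun t => Ω.rho t ^ (-(2 / 3) : ℝ)) Ω.L := fun t => by
    simp only [rho_add_period]
  have h1 := intervalIntegral.integral_add_adjacent_intervals
    (integrable_rho_rpow (Ω := Ω) hr (-(2 / 3)) 0 s) (integrable_rho_rpow hr (-(2 / 3)) s (s + Ω.L))
  have h2 := hper.intervalIntegral_add_eq s 0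
  rw [zero_add] at h2
  have h3 := lazConst_pos (Ω := Ω) hr
  rw [laz, ← h1, mul_add, h2]
  congr 1
  rw [lazConst] at h3 ⊢
  exact inv_mul_cancel₀ (inv_pos.1 h3).ne'

theorem surjective_laz (hr : 8 ≤ r) : Function.Surjective Ω.laz :=
  surjective_of_add_period (continuous_laz hr) one_pos (laz_add_period hr)

theorem laz_arc (hr : 8 ≤ r) (x : ℝ) : Ω.laz (Ω.arc x) = x :=
  Function.rightInverse_invFun (surjective_laz hr) x

theorem arc_laz (hr : 8 ≤ r) (s : ℝ) : Ω.arc (Ω.laz s) = s :=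
  Function.leftInverse_invFun (strictMono_laz hr).injective s

theorem strictMono_arc (hr : 8 ≤ r) : StrictMono Ω.arc := fun x y h => by
  rwa [← (strictMono_laz hr).lt_iff_lt, laz_arc hr, laz_arc hr]

theorem surjective_arc (hr : 8 ≤ r) : Function.Surjective Ω.arc := fun s => ⟨Ω.laz s, arc_laz hr s⟩

theorem continuous_arc (hr : 8 ≤ r) : Continuous Ω.arc :=
  (strictMono_arc hr).monotone.continuous_of_surjective (surjective_arc hr)

theorem arc_add_one (hr : 8 ≤ r) (x : ℝ) : Ω.arc (x + 1) = Ω.arc x + Ω.L := by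
  rw [← arc_laz hr (Ω.arc x + Ω.L), laz_add_period hr, laz_arc hr]

variable (Ω) in
/-- The derivative of the arc-length parameter with respect to the Lazutkin parameter. -/
noncomputable def arcSpeed (x : ℝ) : ℝ := (Ω.lazConst * Ω.rho (Ω.arc x) ^ (-(2 / 3) : ℝ))⁻¹

theorem arcSpeed_pos (hr : 8 ≤ r) (x : ℝ) : 0 < Ω.arcSpeed x := inv_pos.2 (deriv_laz_pos hr _)

theorem hasDerivAt_arc (hr : 8 ≤ r) (x : ℝ) : HasDerivAt Ω.arc (Ω.arcSpeed x) x :=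
  HasDerivAt.of_local_left_inverse (continuous_arc hr).continuousAt (hasDerivAt_laz hr _)
    (deriv_laz_pos hr _).ne' (Eventually.of_forall (laz_arc hr))

/-- Bootstrapping: the derivative of the inverse parameter is a `C^6` function of the inverse
itself, so each pass gains one order of smoothness, up to seven. -/
theorem contDiff_arc (hr : 8 ≤ r) : ContDiff ℝ 7 Ω.arc := by
  have key : ∀ n : ℕ, n ≤ 6 → ContDiff ℝ n Ω.arc → ContDiff ℝ (n + 1 : ℕ) Ω.arc := by
    intro n hn h
    push_cast
    rw [contDiff_succ_iff_deriv]
    refine ⟨fun s => (hasDerivAt_arc hr s).differentiableAt, by simp, ?_⟩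
    rw [show deriv Ω.arc = _ from funext fun s => (hasDerivAt_arc hr s).deriv]
    refine ContDiff.inv ?_ fun x => (deriv_laz_pos hr _).ne'
    exact contDiff_const.mul (((contDiff_rho_rpow hr _).of_le (by exact_mod_cast hn)).comp h)
  have h0 : ContDiff ℝ (0 : ℕ) Ω.arc := contDiff_zero.2 (continuous_arc hr)
  exact key 6 le_rfl (key 5 (by norm_num) (key 4 (by norm_num) (key 3 (by norm_num)
    (key 2 (by norm_num) (key 1 (by norm_num) (key 0 (by norm_num) h0))))))

theorem contDiff_arcSpeed (hr : 8 ≤ r) : ContDiff ℝ 6 Ω.arcSpeed :=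
  (contDiff_const.mul ((contDiff_rho_rpow hr _).comp ((contDiff_arc hr).of_le (by norm_num)))).inv
    fun _ => (deriv_laz_pos hr _).ne'

theorem arcSpeed_add_one (hr : 8 ≤ r) (x : ℝ) : Ω.arcSpeed (x + 1) = Ω.arcSpeed x := by
  rw [arcSpeed, arc_add_one hr, rho_add_period, arcSpeed]

/-- The Lazutkin density in terms of the curvature. -/
theorem mu_eq (hr : 8 ≤ r) (x : ℝ) : Ω.mu x = Ω.arcSpeed x * Ω.curv (Ω.arc x) / 2 := by
  have hC := (lazConst_pos (Ω := Ω) hr).ne'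
  have hκ := curv_pos (Ω := Ω) (Ω.arc x)
  rw [mu, arcSpeed, rho_rpow, rho_rpow, Real.rpow_neg hκ.le, neg_neg]
  have h3 : Ω.curv (Ω.arc x) ^ (1 / 3 : ℝ) * Ω.curv (Ω.arc x) ^ (2 / 3 : ℝ) = Ω.curv (Ω.arc x) := by
    rw [← Real.rpow_add hκ]
    norm_num
  have h1 := (Real.rpow_pos_of_pos hκ (1 / 3)).ne'
  have h2 := (Real.rpow_pos_of_pos hκ (2 / 3)).ne'
  field_simp
  linarith

theorem mu_pos (hr : 8 ≤ r) (x : ℝ) : 0 < Ω.mu x := by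
  rw [mu_eq hr]
  exact div_pos (mul_pos (arcSpeed_pos hr x) (curv_pos _)) two_pos

theorem contDiff_mu (hr : 8 ≤ r) : ContDiff ℝ 6 Ω.mu := by
  rw [show Ω.mu = _ from funext (mu_eq hr)]
  exact ((contDiff_arcSpeed hr).mul ((contDiff_curv hr).comp
    ((contDiff_arc hr).of_le (by norm_num)))).div_const _

theorem mu_add_one (hr : 8 ≤ r) (x : ℝ) : Ω.mu (x + 1) = Ω.mu x := by
  rw [mu, arc_add_one hr, rho_add_period, mu]

/-- The curvature along the Lazutkin parametrization is proportional to `(arc')^(-3/2)`. -/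
theorem two_mul_arcSpeed_mul_deriv_curv (hr : 8 ≤ r) (x : ℝ) :
    2 * Ω.arcSpeed x * deriv (fun y => Ω.curv (Ω.arc y)) x +
      3 * Ω.curv (Ω.arc x) * deriv Ω.arcSpeed x = 0 := by
  have hκ := fun y => curv_pos (Ω := Ω) (Ω.arc y)
  have hC := lazConst_pos (Ω := Ω) hr
  have ha := arcSpeed_pos (Ω := Ω) hr
  -- The defining property of the Lazutkin parameter: the cube of the speed times the square of the
  -- curvature is constant. Its logarithmic derivative is the claim.
  have hconst : ∀ y, Ω.arcSpeed y ^ 3 * Ω.curv (Ω.arc y) ^ 2 = (Ω.lazConst ^ 3)⁻¹ := by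
    intro y
    rw [arcSpeed, rho_rpow, neg_neg]
    have h3 : (Ω.curv (Ω.arc y) ^ (2 / 3 : ℝ)) ^ 3 = Ω.curv (Ω.arc y) ^ 2 := by
      rw [← Real.rpow_natCast, ← Real.rpow_mul (hκ y).le]
      norm_num
    have := (hκ y).ne'
    rw [inv_pow, mul_pow, h3]
    field_simp
  have h1 : HasDerivAt Ω.arcSpeed (deriv Ω.arcSpeed x) x :=
    ((contDiff_arcSpeed hr).differentiable (by norm_num) x).hasDerivAt
  have h2 : HasDerivAt (fun y => Ω.curv (Ω.arc y)) (deriv (fun y => Ω.curv (Ω.arc y)) x) x :=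
    (((contDiff_curv hr).comp ((contDiff_arc hr).of_le (by norm_num))).differentiable
      (by norm_num) x).hasDerivAt
  have h3 := ((h1.pow 3).mul (h2.pow 2)).unique
    ((hasDerivAt_const x ((Ω.lazConst ^ 3)⁻¹)).congr_of_eventuallyEq
      (Eventually.of_forall hconst))
  simp only [Pi.pow_apply] at h3
  push_cast at h3
  have h4 : Ω.arcSpeed x ^ 2 * Ω.curv (Ω.arc x) * (2 * Ω.arcSpeed x *
      deriv (fun y => Ω.curv (Ω.arc y)) x + 3 * Ω.curv (Ω.arc x) * deriv Ω.arcSpeed x) = 0 := by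
    linear_combination h3
  exact (mul_eq_zero.1 h4).resolve_left (mul_pos (pow_pos (ha x) 2) (hκ x)).ne'

end Table
end Billiard

/-! ### Divided differences, and periodic functions on a strip. -/

namespace Billiard
open Set Filter Topology

section LineMean

variable {E : Type*} [NormedAddCommGroup E] [NormedSpace ℝ E]

/-- The weighted mean of `F` over the segment with endpoints `p.1` and `p.1 + p.2`. -/
noncomputable def lineMean (w : ℝ → ℝ) (F : ℝ → E) (p : ℝ × ℝ) : E :=
  ∫ t in (0 : ℝ)..1, w t • F (p.1 + t * p.2)

theorem continuous_lineMean {w : ℝ → ℝ} {F : ℝ → E} (hw : Continuous w) (hF : Continuous F) :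
    Continuous (lineMean w F) :=
  intervalIntegral.continuous_parametric_intervalIntegral_of_continuous'
    (f := fun (p : ℝ × ℝ) t => w t • F (p.1 + t * p.2)) (by simp only [Function.uncurry_def]; fun_prop) 0 1

/-- Differentiating under the integral in the second variable brings down a factor `t`. Means with
continuous weights are thus stable under differentiation, which drives the induction for higher
smoothness. -/
theorem hasFDerivAt_lineMean {w : ℝ → ℝ} {F F' : ℝ → E} (hw : Continuous w)
    (hF : ∀ y, HasDerivAt F (F' y) y) (hF' : Continuous F') (p : ℝ × ℝ) :
    HasFDerivAt (lineMean w F)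
      ((ContinuousLinearMap.fst ℝ ℝ ℝ).smulRight (lineMean w F' p) +
        (ContinuousLinearMap.snd ℝ ℝ ℝ).smulRight (lineMean (fun t => w t * t) F' p)) p := by
  have hFc : Continuous F := continuous_iff_continuousAt.2 fun y => (hF y).continuousAt
  set D : ℝ × ℝ → ℝ → (ℝ × ℝ →L[ℝ] E) := fun p t => w t •
    (ContinuousLinearMap.fst ℝ ℝ ℝ + t • ContinuousLinearMap.snd ℝ ℝ ℝ).smulRight
      (F' (p.1 + t * p.2)) with hD
  have hDc : Continuous fun q : (ℝ × ℝ) × ℝ => D q.1 q.2 := by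
    have h1 : Continuous fun q : (ℝ × ℝ) × ℝ => F' (q.1.1 + q.2 * q.1.2) := by fun_prop
    have h2 : Continuous fun q : (ℝ × ℝ) × ℝ =>
        (ContinuousLinearMap.fst ℝ ℝ ℝ + q.2 • ContinuousLinearMap.snd ℝ ℝ ℝ) := by fun_prop
    exact (hw.comp continuous_snd).smul
      (isBoundedBilinearMap_smulRight.continuous.comp (h2.prodMk h1))
  -- The dominating function is a constant obtained by compactness.
  obtain ⟨M, hM⟩ := ((isCompact_closedBall p 1).prod (isCompact_Icc (a := (0 : ℝ)) (b := 1))).exists_bound_of_continuousOn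
    hDc.continuousOn
  have h := intervalIntegral.hasFDerivAt_integral_of_dominated_of_fderiv_le (𝕜 := ℝ)
    (μ := MeasureTheory.volume) (a := 0) (b := 1) (x₀ := p) (s := Metric.closedBall p 1) (bound := fun _ => M)
    (F := fun p t => w t • F (p.1 + t * p.2)) (F' := D)
    (Metric.closedBall_mem_nhds p one_pos)
    (Eventually.of_forall fun q => (by fun_prop : Continuous fun t => w t • F (q.1 + t * q.2)).aestronglyMeasurable)
    ((by fun_prop : Continuous fun t => w t • F (p.1 + t * p.2)).intervalIntegrable _ _)
    (hDc.comp (continuous_const.prodMk continuous_id)).aestronglyMeasurable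
    (Eventually.of_forall fun t ht q hq => hM (q, t) ⟨hq, by
      rw [uIoc_of_le zero_le_one] at ht
      exact Ioc_subset_Icc_self ht⟩)
    (by simp)
    (Eventually.of_forall fun t ht q hq => by
      have h1 : HasFDerivAt (fun q : ℝ × ℝ => q.1 + t * q.2)
          (ContinuousLinearMap.fst ℝ ℝ ℝ + t • ContinuousLinearMap.snd ℝ ℝ ℝ) q :=
        hasFDerivAt_fst.add (hasFDerivAt_snd.const_mul t)
      refine ((((hF _).hasFDerivAt).comp q h1).const_smul (w t)).congr_fderiv ?_
      ext <;> simp [hD])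
  have hDi : IntervalIntegrable (D p) MeasureTheory.volume 0 1 :=
    (hDc.comp (continuous_const.prodMk continuous_id)).intervalIntegrable _ _
  refine h.congr_fderiv ?_
  ext
  · rw [ContinuousLinearMap.comp_apply, ContinuousLinearMap.intervalIntegral_apply hDi]
    simp [hD, lineMean]
  · rw [ContinuousLinearMap.comp_apply, ContinuousLinearMap.intervalIntegral_apply hDi]
    simp [hD, lineMean, smul_smul]

theorem contDiff_lineMean {n : ℕ} : ∀ {w : ℝ → ℝ} {F : ℝ → E}, Continuous w → ContDiff ℝ n F →
    ContDiff ℝ n (lineMean w F) := by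
  induction n with
  | zero =>
    intro w F hw hF
    exact contDiff_zero.2 (continuous_lineMean hw hF.continuous)
  | succ n ih =>
    intro w F hw hF
    push_cast at hF ⊢
    obtain ⟨h1, -, h2⟩ := contDiff_succ_iff_deriv.1 hF
    refine contDiff_succ_iff_hasFDerivAt.2 ⟨_, ?_, fun p =>
      hasFDerivAt_lineMean hw (fun y => (h1 y).hasDerivAt) h2.continuous p⟩
    exact (contDiff_const.smulRight (ih hw h2)).add
      (contDiff_const.smulRight (ih (hw.mul continuous_id) h2))

theorem hasDerivAt_lineMean {w : ℝ → ℝ} {F F' : ℝ → E} (hw : Continuous w)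
    (hF : ∀ y, HasDerivAt F (F' y) y) (hF' : Continuous F') (x d : ℝ) :
    HasDerivAt (fun d => lineMean w F (x, d)) (lineMean (fun t => w t * t) F' (x, d)) d := by
  have h1 : HasDerivAt (fun d : ℝ => (x, d)) (0, 1) d := (hasDerivAt_const d x).prodMk (hasDerivAt_id d)
  refine ((hasFDerivAt_lineMean hw hF hF' (x, d)).comp_hasDerivAt d h1).congr_deriv ?_
  simp

theorem lineMean_zero [CompleteSpace E] (w : ℝ → ℝ) (F : ℝ → E) (x : ℝ) :
    lineMean w F (x, 0) = (∫ t in (0 : ℝ)..1, w t) • F x := by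
  simp [lineMean, intervalIntegral.integral_smul_const]

/-- The fundamental theorem of calculus. It provides a smooth extension of the difference quotient
through `d = 0`. -/
theorem smul_lineMean_one [CompleteSpace E] {F F' : ℝ → E} (hF : ∀ y, HasDerivAt F (F' y) y) (hF' : Continuous F')
    (x d : ℝ) : d • lineMean (fun _ => 1) F' (x, d) = F (x + d) - F x := by
  have h1 := intervalIntegral.smul_integral_comp_add_mul (a := 0) (b := 1) F' d x
  have h2 := intervalIntegral.integral_eq_sub_of_hasDerivAt (fun y _ => hF y)
    (hF'.intervalIntegrable x (x + d))
  simp only [mul_zero, add_zero, mul_one] at h1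
  rw [← h2, ← h1]
  simp [lineMean, mul_comm]

end LineMean

section Slices

/-- The mean value inequality on the segment from `0` to `d`; each use raises the order of vanishing
by one. -/
theorem abs_le_mul_pow_succ {u u' : ℝ → ℝ} {M δ : ℝ} {k : ℕ}
    (hu : ∀ d, |d| ≤ δ → HasDerivAt u (u' d) d) (h0 : u 0 = 0)
    (hb : ∀ d, |d| ≤ δ → |u' d| ≤ M * |d| ^ k) {d : ℝ} (hd : |d| ≤ δ) :
    |u d| ≤ M * |d| ^ (k + 1) := by
  have hM : 0 ≤ M ∨ d = 0 := by
    by_cases h : d = 0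
    · exact Or.inr h
    · refine Or.inl ?_
      have := (abs_nonneg _).trans (hb d hd)
      exact nonneg_of_mul_nonneg_left this (pow_pos (abs_pos.2 h) k)
  rcases hM with hM | rfl
  · have hle : ∀ y ∈ uIcc 0 d, |y| ≤ |d| := fun y hy => by
      simpa using abs_sub_left_of_mem_uIcc hy
    have := (convex_uIcc (0 : ℝ) d).norm_image_sub_le_of_norm_hasDerivWithin_le (f := u) (f' := u')
      (C := M * |d| ^ k) (fun y hy => (hu y ((hle y hy).trans hd)).hasDerivWithinAt)
      (fun y hy => (hb y ((hle y hy).trans hd)).trans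
        (mul_le_mul_of_nonneg_left (pow_le_pow_left₀ (abs_nonneg y) (hle y hy) k) hM))
      left_mem_uIcc right_mem_uIcc
    simpa [h0, pow_succ, mul_assoc] using this
  · simp [h0]

/-- The strip `|d| < 1` in the `(x, d)`-plane. -/
def strip : Set (ℝ × ℝ) := {p | |p.2| < 1}

theorem isOpen_strip : IsOpen strip := isOpen_lt (by fun_prop) continuous_const

theorem mem_strip {x d : ℝ} (h : |d| ≤ 1 / 2) : (x, d) ∈ strip :=
  show |d| < 1 by linarith

/-- The partial derivative with respect to the first variable. -/
noncomputable def dfst (F : ℝ × ℝ → ℝ) (p : ℝ × ℝ) : ℝ := fderiv ℝ F p (1, 0)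

/-- The partial derivative with respect to the second variable. -/
noncomputable def dsnd (F : ℝ × ℝ → ℝ) (p : ℝ × ℝ) : ℝ := fderiv ℝ F p (0, 1)

variable {F : ℝ × ℝ → ℝ} {n : ℕ}

theorem contDiffOn_dsnd (hF : ContDiffOn ℝ (n + 1 : ℕ) F strip) : ContDiffOn ℝ n (dsnd F) strip :=
  (hF.fderiv_of_isOpen isOpen_strip (by exact_mod_cast le_rfl)).clm_apply contDiffOn_const

theorem contDiffOn_dfst (hF : ContDiffOn ℝ (n + 1 : ℕ) F strip) : ContDiffOn ℝ n (dfst F) strip :=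
  (hF.fderiv_of_isOpen isOpen_strip (by exact_mod_cast le_rfl)).clm_apply contDiffOn_const

theorem hasFDerivAt_of_strip (hF : ContDiffOn ℝ (n + 1 : ℕ) F strip) {p : ℝ × ℝ} (hp : p ∈ strip) :
    HasFDerivAt F (fderiv ℝ F p) p :=
  ((hF.contDiffAt (isOpen_strip.mem_nhds hp)).differentiableAt (by simp)).hasFDerivAt

theorem hasDerivAt_snd (hF : ContDiffOn ℝ (n + 1 : ℕ) F strip) {x d : ℝ} (hp : (x, d) ∈ strip) :
    HasDerivAt (fun d => F (x, d)) (dsnd F (x, d)) d :=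
  (hasFDerivAt_of_strip hF hp).comp_hasDerivAt d
    ((hasDerivAt_const d x).prodMk (hasDerivAt_id d))

theorem hasDerivAt_fst (hF : ContDiffOn ℝ (n + 1 : ℕ) F strip) {x d : ℝ} (hp : (x, d) ∈ strip) :
    HasDerivAt (fun x => F (x, d)) (dfst F (x, d)) x :=
  (hasFDerivAt_of_strip hF hp).comp_hasDerivAt x
    ((hasDerivAt_id x).prodMk (hasDerivAt_const x d))

theorem fderiv_add_one (hF : ∀ x d, F (x + 1, d) = F (x, d)) (x d : ℝ) :
    fderiv ℝ F (x + 1, d) = fderiv ℝ F (x, d) := by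
  have h : (fun p : ℝ × ℝ => F (p + (1, 0))) = F := by
    funext p
    obtain ⟨x, d⟩ := p
    simpa using hF x d
  have := fderiv_comp_add_right (𝕜 := ℝ) (f := F) (x := (x, d)) (1, 0)
  rw [h] at this
  rw [this]
  simp

/-- Compactness of one period in `x`; the bound `1/2` keeps `d` in a compact part of the strip. -/
theorem exists_bound_of_periodic (hF : ContinuousOn F strip) (hper : ∀ x d, F (x + 1, d) = F (x, d)) :
    ∃ M, 0 ≤ M ∧ ∀ x d, |d| ≤ 1 / 2 → |F (x, d)| ≤ M := by
  obtain ⟨M, hM⟩ := ((isCompact_Icc (a := (0 : ℝ)) (b := 1)).prod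
    (isCompact_Icc (a := -(1 / 2 : ℝ)) (b := 1 / 2))).exists_bound_of_continuousOn
    (hF.mono fun p hp => mem_strip (x := p.1) (abs_le.2 hp.2))
  refine ⟨M, (norm_nonneg _).trans (hM (0, 0) (by norm_num)), fun x d hd => ?_⟩
  have hp : Function.Periodic (fun x => F (x, d)) 1 := fun x => hper x d
  obtain ⟨y, hy, he⟩ := hp.exists_mem_Ico₀ one_pos x
  rw [he]
  exact hM (y, d) ⟨Ico_subset_Icc_self hy, abs_le.1 hd⟩

theorem exists_lipschitz_of_periodic (hF : ContDiffOn ℝ (n + 1 : ℕ) F strip)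
    (hper : ∀ x d, F (x + 1, d) = F (x, d)) :
    ∃ M, 0 ≤ M ∧ ∀ x y d, |d| ≤ 1 / 2 → |F (y, d) - F (x, d)| ≤ M * |y - x| := by
  obtain ⟨M, hM0, hM⟩ := exists_bound_of_periodic (contDiffOn_dfst hF).continuousOn
    (fun x d => by rw [dfst, fderiv_add_one hper, dfst])
  refine ⟨M, hM0, fun x y d hd => ?_⟩
  exact convex_univ.norm_image_sub_le_of_norm_hasDerivWithin_le (f := fun x => F (x, d))
    (fun z _ => (hasDerivAt_fst hF (mem_strip hd)).hasDerivWithinAt) (fun z _ => hM z d hd)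
    (mem_univ x) (mem_univ y)

end Slices
end Billiard

/-! ### Taylor estimates at `d = 0`, uniform in `x`. -/

namespace Billiard
open Set Filter Topology

theorem chain_three_bound {u₀ u₁ u₂ u₃ : ℝ → ℝ} {M δ : ℝ}
    (h0 : ∀ d, |d| ≤ δ → HasDerivAt u₀ (u₁ d) d) (h1 : ∀ d, |d| ≤ δ → HasDerivAt u₁ (u₂ d) d)
    (h2 : ∀ d, |d| ≤ δ → HasDerivAt u₂ (u₃ d) d) (z0 : u₀ 0 = 0) (z1 : u₁ 0 = 0) (z2 : u₂ 0 = 0)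
    (hb : ∀ d, |d| ≤ δ → |u₃ d| ≤ M) {d : ℝ} (hd : |d| ≤ δ) :
    |u₀ d| ≤ M * |d| ^ 3 ∧ |u₁ d| ≤ M * |d| ^ 2 := by
  have b2 : ∀ d, |d| ≤ δ → |u₂ d| ≤ M * |d| ^ 1 := fun d hd =>
    abs_le_mul_pow_succ (k := 0) h2 z2 (fun d hd => by simpa using hb d hd) hd
  have b1 : ∀ d, |d| ≤ δ → |u₁ d| ≤ M * |d| ^ 2 := fun d hd => abs_le_mul_pow_succ h1 z1 b2 hd
  exact ⟨abs_le_mul_pow_succ h0 z0 b1 hd, b1 d hd⟩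

/-- Bounds on the derivative in `x` come from Taylor estimates of differences in `x`, so mixed
partial derivatives never have to be interchanged. -/
theorem abs_dfst_le {F : ℝ × ℝ → ℝ} {n : ℕ} (hF : ContDiffOn ℝ (n + 1 : ℕ) F strip) {x d C : ℝ}
    (hd : |d| ≤ 1 / 2) (hC : 0 ≤ C) (h : ∀ y, |F (y, d) - F (x, d)| ≤ C * |y - x|) :
    |dfst F (x, d)| ≤ C :=
  (hasDerivAt_fst hF (mem_strip hd)).le_of_lip' hC (Eventually.of_forall h)

/-- Near `d = 0`, a periodic function with `2`-jet `d` in the variable `d` behaves like `d`, and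
its even part is of fourth order. -/
theorem exists_two_jet_bound {g : ℝ × ℝ → ℝ} (hg : ContDiffOn ℝ (6 : ℕ) g strip)
    (hper : ∀ x d, g (x + 1, d) = g (x, d)) (h0 : ∀ x, g (x, 0) = 0)
    (h1 : ∀ x, dsnd g (x, 0) = 1) (h2 : ∀ x, dsnd (dsnd g) (x, 0) = 0) :
    ∃ M, 0 ≤ M ∧ ∀ x d, |d| ≤ 1 / 2 →
      |g (x, d) - d| ≤ M * |d| ^ 3 ∧ |dsnd g (x, d) - 1| ≤ M * |d| ^ 2 ∧
      |dfst g (x, d)| ≤ M * |d| ^ 3 ∧ |g (x, d) + g (x, -d)| ≤ M * |d| ^ 4 ∧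
      |dfst g (x, d) + dfst g (x, -d)| ≤ M * |d| ^ 4 ∧
      |dsnd g (x, d) - dsnd g (x, -d)| ≤ M * |d| ^ 3 := by
  have hperd : ∀ {F : ℝ × ℝ → ℝ}, (∀ x d, F (x + 1, d) = F (x, d)) →
      ∀ x d, dsnd F (x + 1, d) = dsnd F (x, d) := fun hF x d => by
    rw [dsnd, fderiv_add_one hF, dsnd]
  set g₁ := dsnd g with hg₁
  set g₂ := dsnd g₁ with hg₂
  set g₃ := dsnd g₂ with hg₃
  set g₄ := dsnd g₃ with hg₄
  have c1 : ContDiffOn ℝ (5 : ℕ) g₁ strip := contDiffOn_dsnd hg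
  have c2 : ContDiffOn ℝ (4 : ℕ) g₂ strip := contDiffOn_dsnd c1
  have c3 : ContDiffOn ℝ (3 : ℕ) g₃ strip := contDiffOn_dsnd c2
  have c4 : ContDiffOn ℝ (2 : ℕ) g₄ strip := contDiffOn_dsnd c3
  have p1 := hperd hper
  have p2 := hperd p1
  have p3 := hperd p2
  have p4 := hperd p3
  obtain ⟨M3, hM3, b3⟩ := exists_bound_of_periodic c3.continuousOn p3
  obtain ⟨M4, hM4, b4⟩ := exists_bound_of_periodic c4.continuousOn p4
  obtain ⟨L3, hL3, l3⟩ := exists_lipschitz_of_periodic c3 p3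
  obtain ⟨L4, hL4, l4⟩ := exists_lipschitz_of_periodic c4 p4
  have D0 : ∀ x d, |d| ≤ 1 / 2 → HasDerivAt (fun d => g (x, d)) (g₁ (x, d)) d :=
    fun x d hd => hasDerivAt_snd hg (mem_strip hd)
  have D1 : ∀ x d, |d| ≤ 1 / 2 → HasDerivAt (fun d => g₁ (x, d)) (g₂ (x, d)) d :=
    fun x d hd => hasDerivAt_snd c1 (mem_strip hd)
  have D2 : ∀ x d, |d| ≤ 1 / 2 → HasDerivAt (fun d => g₂ (x, d)) (g₃ (x, d)) d :=
    fun x d hd => hasDerivAt_snd c2 (mem_strip hd)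
  have D3 : ∀ x d, |d| ≤ 1 / 2 → HasDerivAt (fun d => g₃ (x, d)) (g₄ (x, d)) d :=
    fun x d hd => hasDerivAt_snd c3 (mem_strip hd)
  have hneg : ∀ {F F' : ℝ × ℝ → ℝ}, (∀ x d, |d| ≤ 1 / 2 → HasDerivAt (fun d => F (x, d)) (F' (x, d)) d) →
      ∀ x d, |d| ≤ 1 / 2 → HasDerivAt (fun d => F (x, -d)) (-F' (x, -d)) d := by
    intro F F' h x d hd
    exact ((h x (-d) (by rwa [abs_neg])).comp d (hasDerivAt_neg d)).congr_deriv (by ring)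
  have N0 := hneg D0
  have N1 := hneg D1
  have N2 := hneg D2
  have N3 := hneg D3
  -- the even part and its derivatives
  have E0 : ∀ x d, |d| ≤ 1 / 2 →
      HasDerivAt (fun d => g (x, d) + g (x, -d)) (g₁ (x, d) - g₁ (x, -d)) d :=
    fun x d hd => (D0 x d hd).add (N0 x d hd)
  have E1 : ∀ x d, |d| ≤ 1 / 2 →
      HasDerivAt (fun d => g₁ (x, d) - g₁ (x, -d)) (g₂ (x, d) + g₂ (x, -d)) d :=
    fun x d hd => ((D1 x d hd).sub (N1 x d hd)).congr_deriv (sub_neg_eq_add _ _)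
  have E2 : ∀ x d, |d| ≤ 1 / 2 →
      HasDerivAt (fun d => g₂ (x, d) + g₂ (x, -d)) (g₃ (x, d) - g₃ (x, -d)) d :=
    fun x d hd => (D2 x d hd).add (N2 x d hd)
  have E3 : ∀ x d, |d| ≤ 1 / 2 →
      HasDerivAt (fun d => g₃ (x, d) - g₃ (x, -d)) (g₄ (x, d) + g₄ (x, -d)) d :=
    fun x d hd => ((D3 x d hd).sub (N3 x d hd)).congr_deriv (sub_neg_eq_add _ _)
  have A : ∀ x d, |d| ≤ 1 / 2 → |g (x, d) - d| ≤ M3 * |d| ^ 3 ∧ |g₁ (x, d) - 1| ≤ M3 * |d| ^ 2 :=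
    fun x d hd => chain_three_bound (u₀ := fun d => g (x, d) - d) (u₁ := fun d => g₁ (x, d) - 1)
      (u₂ := fun d => g₂ (x, d)) (u₃ := fun d => g₃ (x, d))
      (fun d hd => (D0 x d hd).sub (hasDerivAt_id d)) (fun d hd => (D1 x d hd).sub_const 1) (D2 x)
      (by simp [h0]) (by simp [h1]) (h2 x) (b3 x) hd
  -- The `2`-jet in `d` does not depend on `x`, so a difference in `x` has vanishing `2`-jet, and
  -- its third derivative is Lipschitz in `x`.
  have B : ∀ x d, |d| ≤ 1 / 2 → |dfst g (x, d)| ≤ L3 * |d| ^ 3 := fun x d hd => by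
    refine abs_dfst_le hg hd (by positivity) fun y => ?_
    have := (chain_three_bound (u₀ := fun d => g (y, d) - g (x, d))
      (u₁ := fun d => g₁ (y, d) - g₁ (x, d)) (u₂ := fun d => g₂ (y, d) - g₂ (x, d))
      (u₃ := fun d => g₃ (y, d) - g₃ (x, d)) (fun d hd => (D0 y d hd).sub (D0 x d hd))
      (fun d hd => (D1 y d hd).sub (D1 x d hd)) (fun d hd => (D2 y d hd).sub (D2 x d hd))
      (by simp [h0]) (by simp [h1]) (by simp [h2]) (l3 x y) hd).1
    linarith
  have C : ∀ x d, |d| ≤ 1 / 2 → |g₁ (x, d) - g₁ (x, -d)| ≤ (2 * M4) * |d| ^ 3 := fun x d hd =>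
    (chain_three_bound (E1 x) (E2 x) (E3 x) (by simp) (by simp [h2]) (by simp)
      (fun d hd => (abs_add_le _ _).trans (by
        have := b4 x d hd
        have := b4 x (-d) (by rwa [abs_neg])
        linarith)) hd).1
  -- The even part vanishes at zero with its first three derivatives, the odd ones by symmetry and
  -- the others by the jet.
  have C' : ∀ x d, |d| ≤ 1 / 2 → |g (x, d) + g (x, -d)| ≤ (2 * M4) * |d| ^ 4 := fun x d hd =>
    abs_le_mul_pow_succ (E0 x) (by simp [h0]) (C x) hd
  have hdneg : ∀ x d, |d| ≤ 1 / 2 →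
      HasDerivAt (fun x => g (x, d) + g (x, -d)) (dfst g (x, d) + dfst g (x, -d)) x :=
    fun x d hd => (hasDerivAt_fst hg (mem_strip hd)).add
      (hasDerivAt_fst hg (mem_strip (by rwa [abs_neg])))
  have D : ∀ x d, |d| ≤ 1 / 2 → |dfst g (x, d) + dfst g (x, -d)| ≤ (2 * L4) * |d| ^ 4 := fun x d hd => by
    refine (hdneg x d hd).le_of_lip' (by positivity) (Eventually.of_forall fun y => ?_)
    have hb : ∀ d, |d| ≤ 1 / 2 → |(g₄ (y, d) + g₄ (y, -d)) - (g₄ (x, d) + g₄ (x, -d))| ≤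
        2 * L4 * |y - x| := by
      intro d hd
      have e1 := l4 x y d hd
      have e2 := l4 x y (-d) (by rwa [abs_neg])
      have := abs_add_le (g₄ (y, d) - g₄ (x, d)) (g₄ (y, -d) - g₄ (x, -d))
      rw [show (g₄ (y, d) + g₄ (y, -d)) - (g₄ (x, d) + g₄ (x, -d)) =
        (g₄ (y, d) - g₄ (x, d)) + (g₄ (y, -d) - g₄ (x, -d)) by ring]
      linarith
    have key : ∀ d, |d| ≤ 1 / 2 → |(g₁ (y, d) - g₁ (y, -d)) - (g₁ (x, d) - g₁ (x, -d))| ≤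
        2 * L4 * |y - x| * |d| ^ 3 := fun d hd =>
      (chain_three_bound (fun d hd => (E1 y d hd).sub (E1 x d hd))
        (fun d hd => (E2 y d hd).sub (E2 x d hd)) (fun d hd => (E3 y d hd).sub (E3 x d hd))
        (by simp) (by simp [h2]) (by simp) hb hd).1
    have := abs_le_mul_pow_succ (fun d hd => (E0 y d hd).sub (E0 x d hd)) (by simp [h0]) key hd
    simp only [Pi.sub_apply] at this
    rw [Real.norm_eq_abs, Real.norm_eq_abs]
    exact this.trans_eq (by ring)
  refine ⟨M3 + L3 + 2 * M4 + 2 * L4, by positivity, fun x d hd => ⟨(A x d hd).1.trans ?_,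
    (A x d hd).2.trans ?_, (B x d hd).trans ?_, (C' x d hd).trans ?_, (D x d hd).trans ?_,
    (C x d hd).trans ?_⟩⟩ <;> gcongr <;> linarith

/-- The `2`-jet at `0` of `p / √(p² + q²)` when `p 0 = 0`. -/
theorem hasDerivAt_div_sqrt {p q p' q' : ℝ → ℝ} (hp : ∀ d, HasDerivAt p (p' d) d)
    (hq : ∀ d, HasDerivAt q (q' d) d) {p'' q'' : ℝ} (hp' : HasDerivAt p' p'' 0)
    (hq' : HasDerivAt q' q'' 0) (h0 : p 0 = 0) (hpos : 0 < q 0) (h : q 0 * p'' = 2 * p' 0 * q' 0) :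
    ∃ f' : ℝ → ℝ, f' 0 = p' 0 / q 0 ∧ HasDerivAt f' 0 0 ∧
      ∀ᶠ d in 𝓝 0, HasDerivAt (fun d => p d / √(p d ^ 2 + q d ^ 2)) (f' d) d := by
  set m : ℝ → ℝ := fun d => p d ^ 2 + q d ^ 2 with hm
  have hmd : ∀ d, HasDerivAt m (2 * p d * p' d + 2 * q d * q' d) d := fun d =>
    (((hp d).pow 2).add ((hq d).pow 2)).congr_deriv (by simp)
  have hm0 : 0 < m 0 := by rw [hm]; simp only [h0]; positivity
  have hs0 : √(m 0) = q 0 := by rw [hm]; simp [h0, Real.sqrt_sq hpos.le]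
  have hsq : ∀ d, 0 < m d → HasDerivAt (fun d => √(m d)) ((p d * p' d + q d * q' d) / √(m d)) d := by
    intro d hd
    refine ((hmd d).sqrt hd.ne').congr_deriv ?_
    have := (Real.sqrt_pos.2 hd).ne'
    field_simp
  -- The quotient rule, after cancelling the two terms `p^2 p'` in the numerator.
  refine ⟨fun d => q d * (q d * p' d - p d * q' d) / √(m d) ^ 3, ?_, ?_, ?_⟩
  · simp only [hs0, h0]
    field_simp
    ring
  -- Since `p 0 = 0`, this second derivative is `(q p'' - 2 p' q') / q^2`, which vanishes by `h`.
  · have hA := ((hq 0).mul (((hq 0).mul hp').sub ((hp 0).mul hq'))).div ((hsq 0 hm0).pow 3)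
      (by simp only [Pi.pow_apply, hs0]; positivity)
    refine hA.congr_deriv ?_
    simp only [Pi.mul_apply, Pi.sub_apply, Pi.pow_apply, hs0, h0]
    field_simp
    push_cast
    linear_combination (q 0) ^ 4 * h
  · filter_upwards [(hmd 0).continuousAt.eventually (lt_mem_nhds hm0)] with d hd
    refine ((hp d).div (hsq d hd) (Real.sqrt_pos.2 hd).ne').congr_deriv ?_
    have h1 := (Real.sqrt_pos.2 hd).ne'
    have h2 : √(m d) ^ 2 = p d ^ 2 + q d ^ 2 := Real.sq_sqrt hd.le
    field_simp
    linear_combination p' d * h2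

end Billiard

/-! ### The smooth model of the reflection angle. -/

namespace Billiard
open Set Filter Topology

theorem norm_eq_sqrt_cross {u : ℂ} (hu : ‖u‖ = 1) (z : ℂ) :
    ‖z‖ = √(cross u z ^ 2 + ((starRingEnd ℂ) u * z).re ^ 2) := by
  rw [cross_eq_im, add_comm, ← Complex.norm_eq_sqrt_sq_add_sq, norm_mul, RCLike.norm_conj, hu, one_mul]

namespace Table

variable {r : ℕ} {Ω : Table r}

variable (Ω) in
/-- The velocity of the boundary point in the Lazutkin parametrization. -/
noncomputable def velocity (x : ℝ) : ℂ := Ω.arcSpeed x * deriv Ω.Γ (Ω.arc x)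

variable (Ω) in
/-- The divided difference of the boundary curve in the Lazutkin parametrization. -/
noncomputable def secant : ℝ × ℝ → ℂ := lineMean (fun _ => 1) Ω.velocity

variable (Ω) in
/-- The sine of the angle at parameter `x` towards the parameter `x + d`, divided by the Lazutkin
density and extended smoothly through `d = 0`. -/
noncomputable def sineModel (p : ℝ × ℝ) : ℝ :=
  cross (deriv Ω.Γ (Ω.arc p.1)) (Ω.secant p) / (Ω.mu p.1 * ‖Ω.secant p‖)

theorem contDiff_tangent_arc (hr : 8 ≤ r) : ContDiff ℝ 7 fun x => deriv Ω.Γ (Ω.arc x) :=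
  (contDiff_tangent hr).comp (contDiff_arc hr)

theorem contDiff_velocity (hr : 8 ≤ r) : ContDiff ℝ 6 Ω.velocity :=
  (Complex.ofRealCLM.contDiff.comp (contDiff_arcSpeed hr)).mul
    ((contDiff_tangent_arc hr).of_le (by norm_num))

theorem contDiff_secant (hr : 8 ≤ r) : ContDiff ℝ (6 : ℕ) Ω.secant :=
  contDiff_lineMean continuous_const (contDiff_velocity hr)

theorem hasDerivAt_boundary_arc (hr : 8 ≤ r) (x : ℝ) :
    HasDerivAt (fun x => Ω.Γ (Ω.arc x)) (Ω.velocity x) x := by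
  refine ((hasDerivAt_boundary hr (Ω.arc x)).scomp x (hasDerivAt_arc hr x)).congr_deriv ?_
  rw [velocity, Complex.real_smul]

theorem smul_secant (hr : 8 ≤ r) (x d : ℝ) :
    d • Ω.secant (x, d) = Ω.Γ (Ω.arc (x + d)) - Ω.Γ (Ω.arc x) :=
  smul_lineMean_one (hasDerivAt_boundary_arc hr) (contDiff_velocity hr).continuous x d

theorem secant_zero (x : ℝ) : Ω.secant (x, 0) = Ω.velocity x := by
  rw [secant, lineMean_zero]
  simp

/-- For `0 < |d| < 1` the two boundary points differ because the curve is simple; at `d = 0` the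
secant is the nonzero velocity. -/
theorem secant_ne_zero (hr : 8 ≤ r) {x d : ℝ} (hd : |d| < 1) : Ω.secant (x, d) ≠ 0 := by
  intro h
  have h1 := smul_secant (Ω := Ω) hr x d
  rw [h, smul_zero] at h1
  have hmono := strictMono_arc (Ω := Ω) hr
  have h2 := arc_add_one (Ω := Ω) hr
  rw [abs_lt] at hd
  rcases lt_trichotomy d 0 with hneg | rfl | hpos
  · refine boundary_ne _ _ (hmono (by linarith : x + d < x)) ?_ (sub_eq_zero.1 h1.symm)
    rw [← h2]
    exact hmono (by linarith)
  · rw [secant_zero, velocity] at h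
    exact mul_ne_zero (Complex.ofReal_ne_zero.2 (arcSpeed_pos hr x).ne') (tangent_ne_zero _) h
  · refine boundary_ne _ _ (hmono (by linarith : x < x + d)) ?_ (sub_eq_zero.1 h1.symm).symm
    rw [← h2]
    exact hmono (by linarith)

theorem velocity_add_one (hr : 8 ≤ r) (x : ℝ) : Ω.velocity (x + 1) = Ω.velocity x := by
  rw [velocity, arcSpeed_add_one hr, arc_add_one hr, tangent_add_period, velocity]

theorem secant_add_one (hr : 8 ≤ r) (x d : ℝ) : Ω.secant (x + 1, d) = Ω.secant (x, d) := by
  refine intervalIntegral.integral_congr fun t _ => ?_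
  simp only [add_right_comm x 1, velocity_add_one hr]

theorem sineModel_add_one (hr : 8 ≤ r) (x d : ℝ) : Ω.sineModel (x + 1, d) = Ω.sineModel (x, d) := by
  simp only [sineModel, secant_add_one hr, arc_add_one hr, tangent_add_period, mu_add_one hr]

theorem contDiffOn_sineModel (hr : 8 ≤ r) : ContDiffOn ℝ (6 : ℕ) Ω.sineModel strip := by
  intro p hp
  refine ContDiffAt.contDiffWithinAt ?_
  have hs := (contDiff_secant (Ω := Ω) hr).contDiffAt (x := p)
  have hne : Ω.secant p ≠ 0 := secant_ne_zero (x := p.1) hr hp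
  refine ContDiffAt.div ?_ ((((contDiff_mu hr).comp contDiff_fst).contDiffAt).mul (hs.norm ℝ hne))
    (mul_ne_zero (mu_pos hr _).ne' (norm_ne_zero_iff.2 hne))
  exact contDiff_cross.contDiffAt.comp p
    (ContDiffAt.prodMk (((contDiff_tangent_arc hr).of_le (by norm_num)).comp contDiff_fst).contDiffAt hs)

/-- The sine of the angle of a chord, in terms of the smooth model. -/
theorem sin_outAngle_eq (hr : 8 ≤ r) {x d t : ℝ} (hd : |d| < 1) (h : Ω.arc x < t)
    (h' : t < Ω.arc x + Ω.L) (he : Ω.Γ t = Ω.Γ (Ω.arc (x + d))) :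
    |d| * Real.sin (Ω.outAngle (Ω.arc x) t) = d * (Ω.mu x * Ω.sineModel (x, d)) := by
  rw [outAngle_eq_arg hr h h', Complex.sin_arg, chordFrame_im, he, ← smul_secant hr, Complex.real_smul,
    cross_real_mul_right]
  have hn : ‖Ω.chordFrame (Ω.arc x) t‖ = |d| * ‖Ω.secant (x, d)‖ := by
    rw [chordFrame, norm_div, Ω.unit_speed, div_one, he, ← smul_secant hr, norm_smul, Real.norm_eq_abs]
  rw [hn, sineModel]
  have h1 := norm_ne_zero_iff.2 (secant_ne_zero (Ω := Ω) (x := x) hr hd)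
  have h2 := (mu_pos (Ω := Ω) hr x).ne'
  -- At `d = 0` the target would be the starting point itself, which the range of `t` excludes.
  have hd0 : d ≠ 0 := by
    rintro rfl
    rw [add_zero] at he
    exact boundary_ne _ _ h h' he.symm
  have h3 := abs_ne_zero.2 hd0
  field_simp

theorem sineModel_pos_step (hr : 8 ≤ r) {x d : ℝ} (h0 : 0 < d) (h1 : d < 1) :
    Real.sin (Ω.outAngle (Ω.arc x) (Ω.arc (x + d))) = Ω.mu x * Ω.sineModel (x, d) := by
  have hmono := strictMono_arc (Ω := Ω) hr
  have := sin_outAngle_eq (Ω := Ω) hr (x := x) (d := d) (by rwa [abs_of_pos h0])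
    (hmono (by linarith)) (by rw [← arc_add_one hr]; exact hmono (by linarith)) rfl
  rw [abs_of_pos h0] at this
  exact mul_left_cancel₀ h0.ne' this

/-- The incoming chord is treated as an outgoing one with negative step; the length of the chord
carries `|d|`, and this produces the minus sign. -/
theorem sineModel_neg_step (hr : 8 ≤ r) {x d : ℝ} (h0 : 0 < d) (h1 : d < 1) :
    Real.sin (Ω.inAngle (Ω.arc (x - d)) (Ω.arc x)) = -(Ω.mu x * Ω.sineModel (x, -d)) := by
  have hmono := strictMono_arc (Ω := Ω) hr
  have := sin_outAngle_eq (Ω := Ω) hr (x := x) (d := -d) (t := Ω.arc (x - d) + Ω.L)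
    (by rwa [abs_neg, abs_of_pos h0]) (by rw [← arc_add_one hr]; exact hmono (by linarith))
    (by linarith [hmono (by linarith : x - d < x)]) (by rw [Ω.periodic, sub_eq_add_neg])
  rw [abs_neg, abs_of_pos h0] at this
  rw [inAngle_eq, Real.sin_pi_sub]
  refine mul_left_cancel₀ h0.ne' (this.trans (by ring))

/-- Equal angles of incidence and reflection, in terms of the smooth model. -/
theorem sineModel_reflection (hr : 8 ≤ r) {x d d' : ℝ} (h0 : 0 < d) (h1 : d < 1) (h0' : 0 < d')
    (h1' : d' < 1)
    (h : Ω.inAngle (Ω.arc (x - d')) (Ω.arc x) = Ω.outAngle (Ω.arc x) (Ω.arc (x + d))) :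
    Ω.sineModel (x, d) + Ω.sineModel (x, -d') = 0 := by
  have h2 := sineModel_pos_step (Ω := Ω) (x := x) hr h0 h1
  have h3 := sineModel_neg_step (Ω := Ω) (x := x) hr h0' h1'
  rw [h, h2] at h3
  refine mul_left_cancel₀ (mu_pos (Ω := Ω) hr x).ne' ?_
  linear_combination h3

theorem sineModel_zero (x : ℝ) : Ω.sineModel (x, 0) = 0 := by
  rw [sineModel, secant_zero, velocity, cross_real_mul_right, cross_self]
  simp

/-- The `2`-jet of the model at `d = 0`: the choice of the Lazutkin parameter makes the second
derivative vanish. -/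
theorem sineModel_jet (hr : 8 ≤ r) (x : ℝ) :
    dsnd Ω.sineModel (x, 0) = 1 ∧ dsnd (dsnd Ω.sineModel) (x, 0) = 0 := by
  have hV6 := contDiff_velocity (Ω := Ω) hr
  have hV5 : ContDiff ℝ 5 (deriv Ω.velocity) := by
    rw [show (6 : WithTop ℕ∞) = 5 + 1 by norm_num] at hV6
    exact (contDiff_succ_iff_deriv.1 hV6).2.2
  have hV : ∀ y, HasDerivAt Ω.velocity (deriv Ω.velocity y) y := fun y =>
    ((contDiff_velocity hr).differentiable (by norm_num) y).hasDerivAt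
  have hV' : ∀ y, HasDerivAt (deriv Ω.velocity) (deriv (deriv Ω.velocity) y) y := fun y =>
    (hV5.differentiable (by norm_num) y).hasDerivAt
  have hV5c : Continuous (deriv (deriv Ω.velocity)) := by
    rw [show (5 : WithTop ℕ∞) = 4 + 1 by norm_num] at hV5
    exact (contDiff_succ_iff_deriv.1 hV5).2.2.continuous
  have ha := arcSpeed_pos (Ω := Ω) hr x
  set T := deriv Ω.Γ (Ω.arc x) with hT
  set a := Ω.arcSpeed x with hadef
  set κ := Ω.curv (Ω.arc x) with hκ
  -- the derivatives of the velocity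
  have hT' : ∀ y, HasDerivAt (fun y => deriv Ω.Γ (Ω.arc y))
      (Ω.arcSpeed y * (Ω.curv (Ω.arc y) * Complex.I * deriv Ω.Γ (Ω.arc y))) y := fun y => by
    refine ((hasDerivAt_tangent hr (Ω.arc y)).scomp y (hasDerivAt_arc hr y)).congr_deriv ?_
    rw [Complex.real_smul]
  have hA' : ∀ y, HasDerivAt Ω.arcSpeed (deriv Ω.arcSpeed y) y := fun y =>
    ((contDiff_arcSpeed hr).differentiable (by norm_num) y).hasDerivAt
  have hA'' : HasDerivAt (deriv Ω.arcSpeed) (deriv (deriv Ω.arcSpeed) x) x := by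
    have := contDiff_arcSpeed (Ω := Ω) hr
    rw [show (6 : WithTop ℕ∞) = 5 + 1 by norm_num] at this
    exact ((contDiff_succ_iff_deriv.1 this).2.2.differentiable (by norm_num) x).hasDerivAt
  have hK' : HasDerivAt (fun y => Ω.curv (Ω.arc y)) (deriv (fun y => Ω.curv (Ω.arc y)) x) x :=
    (((contDiff_curv hr).comp ((contDiff_arc hr).of_le (by norm_num))).differentiable
      (by norm_num) x).hasDerivAt
  -- With `a` the speed and `κ` the curvature, the velocity is `aT` and the tangent satisfies `T' =
  -- iaκT`.
  have e1 : ∀ y, deriv Ω.velocity y = (deriv Ω.arcSpeed y + Ω.arcSpeed y ^ 2 * Ω.curv (Ω.arc y) *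
      Complex.I) * deriv Ω.Γ (Ω.arc y) := fun y => by
    refine ((hA' y).ofReal_comp.mul (hT' y)).deriv.trans ?_
    ring
  have e2 : deriv (deriv Ω.velocity) x = (deriv (deriv Ω.arcSpeed) x - a ^ 3 * κ ^ 2 +
      (3 * a * deriv Ω.arcSpeed x * κ + a ^ 2 * deriv (fun y => Ω.curv (Ω.arc y)) x) * Complex.I) * T := by
    rw [show deriv Ω.velocity = _ from funext e1]
    have h2 := ((hA''.ofReal_comp.add ((((hA' x).ofReal_comp.pow 2).mul hK'.ofReal_comp).mul_const
      Complex.I)).mul (hT' x)).deriv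
    refine h2.trans ?_
    simp only [Pi.add_apply, Pi.mul_apply, Pi.pow_apply, ← hT, ← hadef, ← hκ]
    push_cast
    ring_nf
    rw [Complex.I_sq]
    ring
  have hTT : (starRingEnd ℂ) T * T = 1 := by
    rw [← Complex.normSq_eq_conj_mul_self, Complex.normSq_eq_norm_sq, hT, Ω.unit_speed]
    simp
  have hconj : ∀ z : ℂ, (starRingEnd ℂ) T * (z * T) = z := fun z => by
    linear_combination z * hTT
  -- Normal and tangential components of the secant; the sine of the angle is `p / √(p² + q²)`.
  set p : ℝ → ℝ := fun d => cross T (Ω.secant (x, d)) with hp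
  set q : ℝ → ℝ := fun d => ((starRingEnd ℂ) T * Ω.secant (x, d)).re with hq
  set S₁ : ℝ → ℂ := fun d => lineMean (fun t => 1 * t) (deriv Ω.velocity) (x, d) with hS₁
  have hs : ∀ d, HasDerivAt (fun d => Ω.secant (x, d)) (S₁ d) d := fun d =>
    hasDerivAt_lineMean continuous_const hV hV5.continuous x d
  have hs' : HasDerivAt S₁ (lineMean (fun t => 1 * t * t) (deriv (deriv Ω.velocity)) (x, 0)) 0 :=
    hasDerivAt_lineMean (by fun_prop) hV' hV5c x 0
  have himm : ∀ {f : ℝ → ℂ} {f' : ℂ} {d : ℝ}, HasDerivAt f f' d →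
      HasDerivAt (fun d => cross T (f d)) (cross T f') d := fun h => by
    simpa [cross] using HasDerivAt.cross (hasDerivAt_const _ T) h
  have hree : ∀ {f : ℝ → ℂ} {f' : ℂ} {d : ℝ}, HasDerivAt f f' d →
      HasDerivAt (fun d => ((starRingEnd ℂ) T * f d).re) ((starRingEnd ℂ) T * f').re d := fun h =>
    Complex.reCLM.hasFDerivAt.comp_hasDerivAt _ (h.const_mul _)
  -- The weights `1/2` and `1/3` are the Taylor coefficients of a divided difference.
  have i1 : ∫ t in (0 : ℝ)..1, 1 * t = 1 / 2 := by simp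
  have i2 : ∫ t in (0 : ℝ)..1, 1 * t * t = 1 / 3 := by
    simp only [one_mul, ← sq, integral_pow]
    norm_num
  have s0 : Ω.secant (x, 0) = a * T := secant_zero x
  have s1 : S₁ 0 = ((1 / 2 : ℝ) : ℂ) * deriv Ω.velocity x := by
    rw [hS₁]
    simp only
    rw [lineMean_zero, i1, Complex.real_smul]
  have s2 : lineMean (fun t => 1 * t * t) (deriv (deriv Ω.velocity)) (x, 0) =
      ((1 / 3 : ℝ) : ℂ) * deriv (deriv Ω.velocity) x := by
    rw [lineMean_zero, i2, Complex.real_smul]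
  have p0 : p 0 = 0 := by simp only [hp, s0, cross_real_mul_right, cross_self, mul_zero]
  have q0 : q 0 = a := by simp only [hq, s0, hconj, Complex.ofReal_re]
  have p1 : cross T (S₁ 0) = a ^ 2 * κ / 2 := by
    rw [s1, cross_real_mul_right, cross_eq_im, e1, hconj]
    simp [← Complex.ofReal_pow, ← Complex.ofReal_mul]
    ring
  have q1 : ((starRingEnd ℂ) T * S₁ 0).re = deriv Ω.arcSpeed x / 2 := by
    rw [s1, mul_left_comm, Complex.re_ofReal_mul, e1, hconj]
    simp [← Complex.ofReal_pow, ← Complex.ofReal_mul]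
    ring
  have p2 : cross T (lineMean (fun t => 1 * t * t) (deriv (deriv Ω.velocity)) (x, 0)) =
      (3 * a * deriv Ω.arcSpeed x * κ + a ^ 2 * deriv (fun y => Ω.curv (Ω.arc y)) x) / 3 := by
    have : (deriv (deriv Ω.arcSpeed) x - a ^ 3 * κ ^ 2 +
      (3 * a * deriv Ω.arcSpeed x * κ + a ^ 2 * deriv (fun y => Ω.curv (Ω.arc y)) x) * Complex.I : ℂ) =
      ((deriv (deriv Ω.arcSpeed) x - a ^ 3 * κ ^ 2 : ℝ) : ℂ) +
      ((3 * a * deriv Ω.arcSpeed x * κ + a ^ 2 * deriv (fun y => Ω.curv (Ω.arc y)) x : ℝ) : ℂ) * Complex.I := by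
      push_cast
      ring
    rw [s2, cross_real_mul_right, cross_eq_im, e2, hconj, this]
    simp only [Complex.add_im, Complex.ofReal_im, Complex.mul_im, Complex.ofReal_re, Complex.I_im,
      Complex.I_re]
    ring
  obtain ⟨f', hf0, hf1, hf2⟩ := hasDerivAt_div_sqrt (p := p) (q := q) (fun d => himm (hs d))
    (fun d => hree (hs d)) (himm hs') (hree hs') p0 (by rw [q0]; exact ha) (by
      rw [q0, p1, q1, p2]
      -- The condition for a vanishing second derivative is `a²/6` times the Lazutkin relation `2aκ'
      -- + 3κa' = 0`.
      linear_combination (a ^ 2 / 6) * two_mul_arcSpeed_mul_deriv_curv hr x)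
  rw [p1, q0] at hf0
  have hμ : Ω.mu x = a * κ / 2 := mu_eq hr x
  have hμ0 := mu_pos (Ω := Ω) hr x
  have hmodel : (fun d => Ω.sineModel (x, d)) = fun d => (Ω.mu x)⁻¹ * (p d / √(p d ^ 2 + q d ^ 2)) := by
    funext d
    rw [sineModel, norm_eq_sqrt_cross (Ω.unit_speed (Ω.arc x))]
    simp only [hp, hq, ← hT]
    rw [inv_mul_eq_div, div_div, mul_comm (Ω.mu x)]
  have hc1 : ContDiffOn ℝ (5 : ℕ) (dsnd Ω.sineModel) strip := contDiffOn_dsnd (contDiffOn_sineModel hr)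
  have hstrip : ∀ᶠ d in 𝓝 (0 : ℝ), (x, d) ∈ strip :=
    (isOpen_strip.preimage (by fun_prop : Continuous fun d : ℝ => (x, d))).mem_nhds
      (mem_strip (by norm_num))
  have hev : ∀ᶠ d in 𝓝 (0 : ℝ), dsnd Ω.sineModel (x, d) = (Ω.mu x)⁻¹ * f' d := by
    filter_upwards [hf2, hstrip] with d hd hd'
    have h1 := hasDerivAt_snd (contDiffOn_sineModel (Ω := Ω) hr) hd'
    rw [hmodel] at h1
    exact h1.unique (hd.const_mul _)
  constructor
  · rw [hev.self_of_nhds, hf0]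
    have := curv_pos (Ω := Ω) (Ω.arc x)
    rw [← hκ] at this
    rw [hμ]
    field_simp
  · have h1 := hasDerivAt_snd hc1 hstrip.self_of_nhds
    have h2 := (hf1.const_mul (Ω.mu x)⁻¹).congr_of_eventuallyEq hev
    rw [h1.unique h2, mul_zero]

end Table
end Billiard

/-! ### Sequences with slowly varying steps. -/

namespace Billiard
open Set Filter Topology

theorem abs_sub_le_of_step_le {u : ℕ → ℝ} {c : ℝ} {n : ℕ} (h : ∀ k, k < n → |u (k + 1) - u k| ≤ c) :
    ∀ k ≤ n, |u k - u 0| ≤ k * c := by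
  intro k hk
  induction k with
  | zero => simp
  | succ k ih =>
    have h1 := ih (by omega)
    have h2 := h k hk
    have h3 := abs_add_le (u (k + 1) - u k) (u k - u 0)
    rw [sub_add_sub_cancel] at h3
    push_cast
    linarith

/-- If the mean of `u` over `range q` is `m` and `u` varies slowly, then `u` is close to `m`. -/
theorem abs_sub_mean_le {u : ℕ → ℝ} {c m : ℝ} {q : ℕ} (hq : 0 < q) (hc : 0 ≤ c)
    (h : ∀ k, k + 1 < q → |u (k + 1) - u k| ≤ c) (hm : ∑ k ∈ Finset.range q, u k = q * m)
    {k : ℕ} (hk : k < q) : |u k - m| ≤ q * c := by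
  have hq' : (0 : ℝ) < q := by exact_mod_cast hq
  have hpair : ∀ i j, i ≤ j → j < q → |u j - u i| ≤ q * c := by
    intro i j hij hj
    have := abs_sub_le_of_step_le (u := fun n => u (i + n)) (c := c) (n := j - i)
      (fun n hn => h (i + n) (by omega)) (j - i) le_rfl
    simp only [add_zero, Nat.add_sub_cancel' hij] at this
    refine this.trans ?_
    gcongr
    exact_mod_cast (Nat.sub_le j i).trans hj.le
  have hpair' : ∀ j ∈ Finset.range q, |u k - u j| ≤ q * c := by
    intro j hj
    rcases le_total j k with h' | h'
    · exact hpair j k h' hk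
    · rw [abs_sub_comm]
      exact hpair k j h' (Finset.mem_range.1 hj)
  have h1 : q * (u k - m) = ∑ j ∈ Finset.range q, (u k - u j) := by
    rw [Finset.sum_sub_distrib, hm, Finset.sum_const, Finset.card_range, nsmul_eq_mul]
    ring
  have h2 : |(q : ℝ) * (u k - m)| ≤ q * (q * c) := by
    rw [h1]
    refine (Finset.abs_sum_le_sum_abs _ _).trans ((Finset.sum_le_sum hpair').trans ?_)
    simp
  rw [abs_mul, abs_of_pos hq'] at h2
  exact le_of_mul_le_mul_left h2 hq'

/-- A sequence that advances by `1` in `q` steps, and whose small steps change slowly, is close to an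
arithmetic progression. -/
theorem abs_step_sub_le {x : ℤ → ℝ} {q : ℕ} {M δ : ℝ} (hq : 0 < q) (hM : 0 ≤ M)
    (hx : ∀ k, x (k + q) = x k + 1) (hpos : ∀ k, x k < x (k + 1))
    (hstep : ∀ k, x (k + 1) - x k ≤ δ →
      |(x (k + 2) - x (k + 1)) - (x (k + 1) - x k)| ≤ M * (x (k + 1) - x k) ^ 4)
    (hδ : 2 / q ≤ δ) (hqM : 16 * M ≤ q ^ 2) (k : ℤ) :
    x (k + 1) - x k ≤ 2 / q ∧
    |(x (k + 2) - x (k + 1)) - (x (k + 1) - x k)| ≤ 16 * M / q ^ 4 ∧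
    |x (k + 1) - x k - 1 / q| ≤ 16 * M / q ^ 3 := by
  have hq' : (0 : ℝ) < q := by exact_mod_cast hq
  have hsum : ∀ k, ∑ j ∈ Finset.range q, (x (k + j + 1) - x (k + j)) = 1 := by
    intro k
    have := Finset.sum_range_sub (fun j : ℕ => x (k + j)) q
    push_cast at this
    simp only [← add_assoc] at this
    rw [this, hx]
    simp
  -- Some step does not exceed the mean `1/q`; the estimate is started there.
  obtain ⟨j₀, -, hj₀⟩ : ∃ j ∈ Finset.range q, x (0 + j + 1) - x (0 + j) ≤ 1 / (q : ℝ) := by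
    refine Finset.exists_le_of_sum_le (Finset.nonempty_range_iff.2 hq.ne') ?_
    rw [hsum 0]
    simp [hq'.ne']
  rw [zero_add] at hj₀
  have hfour : ∀ k, x (k + 1) - x k ≤ 2 / q →
      |(x (k + 2) - x (k + 1)) - (x (k + 1) - x k)| ≤ 16 * M / q ^ 4 := by
    intro k hk
    refine (hstep k (hk.trans hδ)).trans ?_
    have : (x (k + 1) - x k) ^ 4 ≤ (2 / q) ^ 4 :=
      pow_le_pow_left₀ (sub_pos.2 (hpos k)).le hk 4
    calc M * (x (k + 1) - x k) ^ 4 ≤ M * (2 / q) ^ 4 := by gcongr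
      _ = 16 * M / q ^ 4 := by
        rw [div_pow]
        ring
  -- The hypothesis `hqM` keeps the growth per bounce below `1/q^2`, hence below `1/q` over a full
  -- turn.
  have hcube : 16 * M / (q : ℝ) ^ 4 ≤ 1 / q ^ 2 := by
    rw [div_le_div_iff₀ (by positivity) (by positivity)]
    nlinarith [pow_pos hq' 2]
  have hsmall : ∀ n : ℕ, n ≤ q → 1 / (q : ℝ) + n * (1 / (q : ℝ) ^ 2) ≤ 2 / (q : ℝ) := by
    intro n hn
    have hn' : (n : ℝ) ≤ q := by exact_mod_cast hn
    have h1 : (n : ℝ) * (1 / (q : ℝ) ^ 2) ≤ q * (1 / (q : ℝ) ^ 2) := by gcongr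
    have h2 : (q : ℝ) * (1 / (q : ℝ) ^ 2) = 1 / q := by field_simp
    have h3 : 2 / (q : ℝ) = 1 / q + 1 / q := by ring
    linarith
  -- Bootstrap: as long as the steps stay below `2/q`, the step law applies and the growth bound
  -- extends by one bounce.
  have hgrow : ∀ n : ℕ, n ≤ q → x (j₀ + n + 1) - x (j₀ + n) ≤ 1 / q + n * (1 / q ^ 2) := by
    intro n hn
    induction n with
    | zero => simpa using hj₀
    | succ n ih =>
      have h1 := ih (by omega)
      have h2 := hsmall n (by omega)
      have h3 := (abs_le.1 ((hfour (j₀ + n) (h1.trans h2)).trans hcube)).2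
      push_cast
      rw [show (j₀ : ℤ) + (n + 1) + 1 = j₀ + n + 2 by ring, ← add_assoc]
      linarith
  have hper : ∀ (m : ℕ) k, x (k + m * q) = x k + m := by
    intro m
    induction m with
    | zero => simp
    | succ m ih =>
      intro k
      push_cast
      rw [show k + ((m : ℤ) + 1) * q = (k + m * q) + q by ring, hx, ih]
      ring
  -- Within one period of `j₀` every residue class modulo `q` occurs, so periodicity carries the
  -- bound to all bounces.
  have hall : ∀ k, x (k + 1) - x k ≤ 2 / q := by
    intro k
    obtain ⟨m, n, hn, hk⟩ : ∃ m : ℤ, ∃ n : ℕ, n ≤ q ∧ k = j₀ + n + m * q := by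
      refine ⟨(k - j₀) / q, ((k - j₀) % q).toNat, ?_, ?_⟩
      · have := Int.emod_lt_of_pos (k - j₀) (by exact_mod_cast hq : (0 : ℤ) < q)
        omega
      · rw [Int.toNat_of_nonneg (Int.emod_nonneg _ (by exact_mod_cast hq.ne'))]
        linarith [Int.mul_ediv_add_emod (k - j₀) q]
    have hper' : ∀ k, x (k + m * q) = x k + m := by
      intro k
      obtain ⟨p, rfl | rfl⟩ := m.eq_nat_or_neg
      · exact_mod_cast hper p k
      · have := hper p (k + -p * q)
        rw [show k + -(p : ℤ) * q + p * q = k by ring] at this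
        push_cast
        linarith
    rw [hk, add_right_comm, hper', hper', add_sub_add_right_eq_sub]
    exact (hgrow n hn).trans (hsmall n hn)
  refine ⟨hall k, hfour k (hall k), ?_⟩
  have h1 := abs_sub_mean_le (u := fun n : ℕ => x (k + n + 1) - x (k + n)) (c := 16 * M / q ^ 4)
    (m := 1 / q) hq (by positivity) (fun n _ => by
      have := hfour (k + n) (hall _)
      push_cast
      rwa [show k + ((n : ℤ) + 1) + 1 = k + n + 2 by ring, ← add_assoc k])
    (by rw [hsum k]; field_simp) hq
  simp only [Nat.cast_zero, add_zero] at h1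
  refine h1.trans_eq ?_
  field_simp

/-- The variation of a closed nearly integrable second order recursion is nearly constant. -/
theorem abs_variation_le {ξ : ℕ → ℝ} {q : ℕ} {C : ℝ} (hq : 0 < q) (hC : 0 ≤ C)
    (h : ∀ k, k + 1 < q → |(ξ (k + 2) - ξ (k + 1)) - (ξ (k + 1) - ξ k)| ≤
      C * (|ξ (k + 1)| / q ^ 4 + |ξ (k + 1) - ξ k| / q ^ 3))
    (hper : ξ q = ξ 0) (hqC : 4 * C ≤ q ^ 2) {k : ℕ} (hk : k < q) :
    |ξ (k + 1) - ξ k| ≤ 2 * C * |ξ 0| / q ^ 3 := by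
  have hq' : (0 : ℝ) < q := by exact_mod_cast hq
  -- The largest increment `Z` is bounded in terms of itself; the increments have mean zero because
  -- the sequence closes up.
  obtain ⟨m, hm, hmax⟩ := Finset.exists_max_image (Finset.range q) (fun k => |ξ (k + 1) - ξ k|)
    (Finset.nonempty_range_iff.2 hq.ne')
  set Z := |ξ (m + 1) - ξ m| with hZ
  have hle : ∀ k < q, |ξ (k + 1) - ξ k| ≤ Z := fun k hk => hmax k (Finset.mem_range.2 hk)
  have hZ0 : 0 ≤ Z := abs_nonneg _
  have hξ : ∀ k ≤ q, |ξ k| ≤ |ξ 0| + q * Z := by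
    intro k hk
    have h1 := abs_sub_le_of_step_le hle k hk
    have h2 := abs_add_le (ξ k - ξ 0) (ξ 0)
    rw [sub_add_cancel] at h2
    have h3 : (k : ℝ) * Z ≤ q * Z := by gcongr
    linarith
  have h1 := abs_sub_mean_le (u := fun k => ξ (k + 1) - ξ k)
    (c := C * ((|ξ 0| + q * Z) / q ^ 4 + Z / q ^ 3)) (m := 0) hq (by positivity)
    (fun k hk => (h k hk).trans (by
      have := hξ (k + 1) (by omega)
      have := hle k (by omega)
      gcongr))
    (by rw [Finset.sum_range_sub, hper]; simp) (Finset.mem_range.1 hm)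
  rw [sub_zero, ← hZ] at h1
  have h2 : q * (C * ((|ξ 0| + q * Z) / q ^ 4 + Z / q ^ 3)) =
      C * |ξ 0| / q ^ 3 + 2 * C / q ^ 2 * Z := by
    field_simp
    ring
  -- This is where `4C ≤ q²` enters: half of `Z` is absorbed in the left-hand side.
  have h3 : 2 * C / (q : ℝ) ^ 2 ≤ 1 / 2 := by
    rw [div_le_div_iff₀ (by positivity) two_pos]
    linarith
  have h4 : 2 * C / (q : ℝ) ^ 2 * Z ≤ 1 / 2 * Z := by gcongr
  have h5 : Z ≤ 2 * (C * |ξ 0| / q ^ 3) := by linarith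
  exact (hle k hk).trans (h5.trans_eq (by ring))

end Billiard

/-! ### The reflection law for short chords. -/

namespace Billiard
open Set Filter Topology

theorem exists_pos_le_of_periodic {f : ℝ → ℝ} (hc : Continuous f) (hper : ∀ x, f (x + 1) = f x)
    (hpos : ∀ x, 0 < f x) : ∃ m, 0 < m ∧ ∀ x, m ≤ f x := by
  obtain ⟨y, -, hy⟩ := (isCompact_Icc (a := (0 : ℝ)) (b := 1)).exists_isMinOn ⟨0, by simp⟩ hc.continuousOn
  refine ⟨f y, hpos y, fun x => ?_⟩
  obtain ⟨z, hz, he⟩ := Function.Periodic.exists_mem_Ico₀ (f := f) (c := 1) hper one_pos x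
  rw [he]
  exact hy (Ico_subset_Icc_self hz)

theorem exists_lipschitz_snd_of_periodic {F : ℝ × ℝ → ℝ} {n : ℕ} (hF : ContDiffOn ℝ (n + 1 : ℕ) F strip)
    (hper : ∀ x d, F (x + 1, d) = F (x, d)) :
    ∃ M, 0 ≤ M ∧ ∀ x d d', |d| ≤ 1 / 2 → |d'| ≤ 1 / 2 → |F (x, d) - F (x, d')| ≤ M * |d - d'| := by
  obtain ⟨M, hM0, hM⟩ := exists_bound_of_periodic (contDiffOn_dsnd hF).continuousOn
    (fun x d => by rw [dsnd, fderiv_add_one hper, dsnd])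
  refine ⟨M, hM0, fun x d d' hd hd' => ?_⟩
  have hconv : Convex ℝ {d : ℝ | |d| ≤ 1 / 2} := by
    have : {d : ℝ | |d| ≤ 1 / 2} = Icc (-(1 / 2)) (1 / 2) := by
      ext d
      change |d| ≤ 1 / 2 ↔ d ∈ Icc _ _
      rw [mem_Icc, abs_le]
    rw [this]
    exact convex_Icc _ _
  exact hconv.norm_image_sub_le_of_norm_hasDerivWithin_le (f := fun d => F (x, d))
    (fun z hz => (hasDerivAt_snd hF (mem_strip hz)).hasDerivWithinAt) (fun z hz => hM x z hz) hd' hd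

namespace Table

variable {r : ℕ} {Ω : Table r}

theorem exists_sineModel_bound (hr : 8 ≤ r) : ∃ M, 0 ≤ M ∧ ∀ x d, |d| ≤ 1 / 2 →
      |Ω.sineModel (x, d) - d| ≤ M * |d| ^ 3 ∧ |dsnd Ω.sineModel (x, d) - 1| ≤ M * |d| ^ 2 ∧
      |dfst Ω.sineModel (x, d)| ≤ M * |d| ^ 3 ∧ |Ω.sineModel (x, d) + Ω.sineModel (x, -d)| ≤ M * |d| ^ 4 ∧
      |dfst Ω.sineModel (x, d) + dfst Ω.sineModel (x, -d)| ≤ M * |d| ^ 4 ∧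
      |dsnd Ω.sineModel (x, d) - dsnd Ω.sineModel (x, -d)| ≤ M * |d| ^ 3 :=
  exists_two_jet_bound (contDiffOn_sineModel hr) (sineModel_add_one hr) sineModel_zero
    (fun x => (sineModel_jet hr x).1) (fun x => (sineModel_jet hr x).2)

/-- For short chords the tangential component of the secant is close to the speed, uniformly. This
excludes the obtuse branch when an angle is recovered from its sine. -/
theorem exists_inAngle_le (hr : 8 ≤ r) : ∃ δ, 0 < δ ∧ ∀ x d, 0 < d → d ≤ δ →
    Ω.inAngle (Ω.arc (x - d)) (Ω.arc x) ≤ Real.pi / 2 := by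
  set R : ℝ × ℝ → ℝ := fun p => ((starRingEnd ℂ) (deriv Ω.Γ (Ω.arc p.1)) * Ω.secant p).re with hR
  have hRc : ContDiff ℝ (6 : ℕ) R := by
    refine Complex.reCLM.contDiff.comp (ContDiff.mul ?_ (contDiff_secant hr))
    exact Complex.conjCLE.contDiff.comp (((contDiff_tangent_arc hr).of_le (by norm_num)).comp contDiff_fst)
  have hRper : ∀ x d, R (x + 1, d) = R (x, d) := fun x d => by
    simp only [hR, secant_add_one hr, arc_add_one hr, tangent_add_period]
  obtain ⟨K, hK, hlip⟩ := exists_lipschitz_snd_of_periodic hRc.contDiffOn hRper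
  obtain ⟨a, ha, hale⟩ := exists_pos_le_of_periodic (contDiff_arcSpeed (Ω := Ω) hr).continuous
    (arcSpeed_add_one hr) (arcSpeed_pos hr)
  have hR0 : ∀ x, R (x, 0) = Ω.arcSpeed x := by
    intro x
    have hTT : (starRingEnd ℂ) (deriv Ω.Γ (Ω.arc x)) * deriv Ω.Γ (Ω.arc x) = 1 := by
      rw [← Complex.normSq_eq_conj_mul_self, Complex.normSq_eq_norm_sq, Ω.unit_speed]
      simp
    simp only [hR, secant_zero, velocity]
    rw [mul_left_comm, hTT, mul_one, Complex.ofReal_re]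
  refine ⟨min (1 / 2) (a / (K + 1)), by positivity, fun x d h0 hd => ?_⟩
  have hd1 : d ≤ 1 / 2 := hd.trans (min_le_left _ _)
  have hd2 : d * (K + 1) ≤ a := by
    rw [← le_div_iff₀ (by positivity)]
    exact hd.trans (min_le_right _ _)
  have hpos : 0 ≤ R (x, -d) := by
    have h1 := hlip x (-d) 0 (by rwa [abs_neg, abs_of_pos h0]) (by norm_num)
    rw [sub_zero, abs_neg, abs_of_pos h0, hR0] at h1
    have := hale x
    have := (abs_le.1 h1).1
    nlinarith
  rw [inAngle, InnerProductGeometry.angle, Real.arccos_le_pi_div_two]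
  refine div_nonneg ?_ (by positivity)
  have h1 := smul_secant (Ω := Ω) hr x (-d)
  rw [← sub_eq_add_neg] at h1
  rw [show Ω.Γ (Ω.arc x) - Ω.Γ (Ω.arc (x - d)) = (d : ℂ) * Ω.secant (x, -d) by
    rw [Complex.real_smul] at h1
    push_cast at h1
    linear_combination h1, real_inner_comm, Complex.inner, mul_assoc, Complex.re_ofReal_mul,
    mul_comm (Ω.secant _)]
  exact mul_nonneg h0.le hpos

/-- A short incoming chord is reflected into a short outgoing chord, uniformly. -/
theorem exists_step_lt (hr : 8 ≤ r) {η : ℝ} (h0 : 0 < η) (h1 : η < 1) :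
    ∃ δ, 0 < δ ∧ ∀ x d d', 0 < d' → d' ≤ δ → 0 < d → d < 1 →
      Ω.inAngle (Ω.arc (x - d')) (Ω.arc x) = Ω.outAngle (Ω.arc x) (Ω.arc (x + d)) → d < η := by
  have hmono := strictMono_arc (Ω := Ω) hr
  obtain ⟨M, hM, hb⟩ := exists_sineModel_bound (Ω := Ω) hr
  obtain ⟨δ₁, hδ₁, hin⟩ := exists_inAngle_le (Ω := Ω) hr
  have hrange : ∀ x d, 0 < d → d < 1 → Ω.arc x < Ω.arc (x + d) ∧ Ω.arc (x + d) < Ω.arc x + Ω.L :=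
    fun x d h h' => ⟨hmono (by linarith), by rw [← arc_add_one hr]; exact hmono (by linarith)⟩
  have hsc : Continuous fun x => Ω.mu x * Ω.sineModel (x, η) := by
    refine (contDiff_mu hr).continuous.mul ?_
    exact (contDiffOn_sineModel hr).continuousOn.comp_continuous
      (by fun_prop : Continuous fun x : ℝ => (x, η))
      (fun x => by simpa [strip, abs_of_pos h0] using h1)
  -- The least sine of the outgoing angle for the step `η`; it also bounds the angle from below.
  obtain ⟨m, hm, hmle⟩ := exists_pos_le_of_periodic hsc
    (fun x => by rw [mu_add_one hr, sineModel_add_one hr]) (fun x => by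
      rw [← sineModel_pos_step hr h0 h1]
      have := outAngle_mem_Ioo (Ω := Ω) hr (hrange x η h0 h1).1 (hrange x η h0 h1).2
      exact Real.sin_pos_of_pos_of_lt_pi this.1 this.2)
  obtain ⟨b, hbpos, hble⟩ := exists_pos_le_of_periodic (f := fun x => (Ω.mu x)⁻¹)
    ((contDiff_mu (Ω := Ω) hr).continuous.inv₀ fun x => (mu_pos hr x).ne')
    (fun x => by rw [mu_add_one hr]) (fun x => inv_pos.2 (mu_pos hr x))
  -- The three bounds make the incoming angle acute, put `d'` in the range of the jet estimates, and
  -- contradict the lower bound `m` for the angle by a factor two.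
  refine ⟨min δ₁ (min (1 / 2) (m * b / (4 * (1 + M)))), by positivity, ?_⟩
  intro x d d' hd' hd'δ hd hd1 hrefl
  have e1 : d' ≤ δ₁ := hd'δ.trans (min_le_left _ _)
  have e2 : d' ≤ 1 / 2 := hd'δ.trans ((min_le_right _ _).trans (min_le_left _ _))
  have e3 : d' * (4 * (1 + M)) ≤ m * b := by
    rw [← le_div_iff₀ (by positivity)]
    exact hd'δ.trans ((min_le_right _ _).trans (min_le_right _ _))
  by_contra hcon
  push Not at hcon
  set θ := Ω.inAngle (Ω.arc (x - d')) (Ω.arc x) with hθ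
  have hα : Ω.outAngle (Ω.arc x) (Ω.arc (x + η)) ≤ θ := by
    rw [hrefl]
    rcases hcon.eq_or_lt with h | h
    · rw [h]
    · exact (outAngle_strictMono hr (hrange x η h0 h1).1 (hmono (by linarith)) (hrange x d hd hd1).2).le
  have hmα : m ≤ Ω.outAngle (Ω.arc x) (Ω.arc (x + η)) :=
    (hmle x).trans (by
      rw [← sineModel_pos_step hr h0 h1]
      exact Real.sin_le (InnerProductGeometry.angle_nonneg _ _))
  have hsin : 2 / Real.pi * θ ≤ Real.sin θ :=
    Real.mul_le_sin (InnerProductGeometry.angle_nonneg _ _) (hin x d' hd' e1)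
  have hsin' : Real.sin θ = -(Ω.mu x * Ω.sineModel (x, -d')) :=
    sineModel_neg_step hr hd' (by linarith)
  rw [hsin'] at hsin
  have hg : -Ω.sineModel (x, -d') ≤ (1 + M) * d' := by
    have h2 := (hb x (-d') (by rwa [abs_neg, abs_of_pos hd'])).1
    rw [abs_neg, abs_of_pos hd'] at h2
    have h3 := (abs_le.1 h2).1
    have h4 : M * d' ^ 3 ≤ M * d' := by
      have : d' ^ 3 ≤ d' := pow_le_of_le_one hd'.le (by linarith) (by norm_num)
      gcongr
    linarith
  have hμb : Ω.mu x * b ≤ 1 := by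
    have := mul_le_mul_of_nonneg_left (hble x) (mu_pos (Ω := Ω) hr x).le
    rwa [mul_inv_cancel₀ (mu_pos (Ω := Ω) hr x).ne'] at this
  have h5 : m * b ≤ θ * b := by
    have := hmα.trans hα
    gcongr
  have h6 : θ ≤ 2 * (Ω.mu x * ((1 + M) * d')) := by
    have h7 : 2 / Real.pi * θ ≤ Ω.mu x * ((1 + M) * d') := by
      refine hsin.trans ?_
      have := mul_le_mul_of_nonneg_left hg (mu_pos (Ω := Ω) hr x).le
      linarith
    have h8 : (1 : ℝ) / 2 ≤ 2 / Real.pi := by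
      rw [div_le_div_iff₀ two_pos Real.pi_pos]
      linarith [Real.pi_le_four]
    have h9 : 0 ≤ θ := InnerProductGeometry.angle_nonneg _ _
    nlinarith
  have h7 : θ * b ≤ 2 * ((1 + M) * d') := by
    calc θ * b ≤ 2 * (Ω.mu x * ((1 + M) * d')) * b := by gcongr
      _ = 2 * ((1 + M) * d') * (Ω.mu x * b) := by ring
      _ ≤ 2 * ((1 + M) * d') * 1 := by gcongr
      _ = _ := mul_one _
  have : 0 < m * b := by positivity
  linarith

/-- Consecutive short chords have nearly the same length in the Lazutkin parameter. -/
theorem exists_step_sub_le (hr : 8 ≤ r) :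
    ∃ M δ, 0 ≤ M ∧ 0 < δ ∧ ∀ x d d', 0 < d' → d' ≤ δ → 0 < d → d < 1 →
      Ω.inAngle (Ω.arc (x - d')) (Ω.arc x) = Ω.outAngle (Ω.arc x) (Ω.arc (x + d)) →
        |d - d'| ≤ M * d' ^ 4 := by
  obtain ⟨M, hM, hb⟩ := exists_sineModel_bound (Ω := Ω) hr
  -- Chosen with `M η² ≤ 1/2`, so that on `[0, η]` the model minus the identity is a contraction
  -- with constant `1/2`.
  set η : ℝ := 1 / (2 * (1 + M)) with hη
  have hη0 : 0 < η := by positivity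
  have hη1 : η ≤ 1 / 2 := by
    rw [hη, div_le_div_iff₀ (by positivity) two_pos]
    linarith
  have hMη : M * η ^ 2 ≤ 1 / 2 := by
    have h1 : (1 + M) * η = 1 / 2 := by rw [hη]; field_simp
    nlinarith
  obtain ⟨δ, hδ, hstep⟩ := exists_step_lt (Ω := Ω) hr hη0 (by linarith)
  refine ⟨2 * M, min δ η, by positivity, by positivity, ?_⟩
  intro x d d' hd' hd'δ hd hd1 hrefl
  have hdη := hstep x d d' hd' (hd'δ.trans (min_le_left _ _)) hd hd1 hrefl
  have hd'η : d' ≤ η := hd'δ.trans (min_le_right _ _)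
  have hg := sineModel_reflection (Ω := Ω) hr hd hd1 hd' (by linarith) hrefl
  have he := (hb x d' (by rw [abs_of_pos hd']; linarith)).2.2.2.1
  rw [abs_of_pos hd'] at he
  have hlip : |(Ω.sineModel (x, d) - d) - (Ω.sineModel (x, d') - d')| ≤ 1 / 2 * |d - d'| := by
    have hle : ∀ z ∈ Icc 0 η, |z| ≤ 1 / 2 := fun z hz => by
      rw [abs_of_nonneg hz.1]
      exact hz.2.trans hη1
    refine (convex_Icc 0 η).norm_image_sub_le_of_norm_hasDerivWithin_le
      (f := fun d => Ω.sineModel (x, d) - d) (f' := fun d => dsnd Ω.sineModel (x, d) - 1)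
      (fun z hz => ((hasDerivAt_snd (contDiffOn_sineModel hr) (mem_strip (hle z hz))).sub
        (hasDerivAt_id z)).hasDerivWithinAt) (fun z hz => ?_) ⟨hd'.le, hd'η⟩ ⟨hd.le, hdη.le⟩
    refine ((hb x z (hle z hz)).2.1).trans (le_trans ?_ hMη)
    rw [abs_of_nonneg hz.1]
    have := hz.1
    have := hz.2
    gcongr
  -- The reflection law splits the change of step into the contracting part and the fourth-order
  -- even part of the model.
  have h1 : (d - d') = -((Ω.sineModel (x, d) - d) - (Ω.sineModel (x, d') - d')) -
      (Ω.sineModel (x, d') + Ω.sineModel (x, -d')) := by linear_combination hg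
  have h2 : |d - d'| ≤ 1 / 2 * |d - d'| + M * d' ^ 4 := by
    nth_rewrite 1 [h1]
    refine (abs_sub _ _).trans ?_
    rw [abs_neg]
    exact add_le_add hlip he
  linarith

/-- Periodic orbits of rotation number `1 / q` are nearly equidistributed in the Lazutkin
parameter. -/
theorem exists_periodic_orbit_bound (hr : 8 ≤ r) :
    ∃ C q₁, 0 ≤ C ∧ ∀ q : ℕ, q₁ ≤ q → 0 < q ∧ ∀ t, Ω.IsPeriodicOrbit 1 q t → ∀ k : ℤ,
      Ω.laz (t (k + 1)) - Ω.laz (t k) ≤ 2 / q ∧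
      |(Ω.laz (t (k + 2)) - Ω.laz (t (k + 1))) - (Ω.laz (t (k + 1)) - Ω.laz (t k))| ≤ C / q ^ 4 ∧
      |Ω.laz (t (k + 1)) - Ω.laz (t k) - 1 / q| ≤ C / q ^ 3 := by
  obtain ⟨M, δ, hM, hδ, hstep⟩ := exists_step_sub_le (Ω := Ω) hr
  -- The ceilings guarantee `2/q ≤ δ` and `16M ≤ q ≤ q²`, as `abs_step_sub_le` requires.
  refine ⟨16 * M, ⌈2 / δ⌉₊ + ⌈16 * M⌉₊ + 1, by positivity, fun q hq => ?_⟩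
  have hq0 : 0 < q := by omega
  have hq0' : (0 : ℝ) < q := by exact_mod_cast hq0
  have hq1 : 2 / δ ≤ q := (Nat.le_ceil _).trans (by exact_mod_cast (by omega : ⌈2 / δ⌉₊ ≤ q))
  have hq2 : 16 * M ≤ q := (Nat.le_ceil _).trans (by exact_mod_cast (by omega : ⌈16 * M⌉₊ ≤ q))
  have hq3 : (1 : ℝ) ≤ q := by exact_mod_cast hq0
  refine ⟨hq0, fun t ht k => ?_⟩
  have hmono := strictMono_laz (Ω := Ω) hr
  refine abs_step_sub_le (x := fun k => Ω.laz (t k)) (δ := δ) hq0 hM (fun k => ?_)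
    (fun k => hmono (ht.1.1 k).1) (fun k hk => ?_) ?_ ?_ k
  · simp only [ht.2 k, Nat.cast_one, one_mul, laz_add_period hr]
  · have hlt : ∀ k, Ω.laz (t (k + 1)) - Ω.laz (t k) < 1 := fun k => by
      have := hmono (ht.1.1 k).2
      rw [laz_add_period hr] at this
      linarith
    have h1 := ht.1.2 (k + 1)
    have h2 := (ht.1.1 (k + 1)).1
    have h3 := hlt (k + 1)
    rw [add_sub_cancel_right] at h1
    rw [show k + 1 + 1 = k + 2 by ring] at h1 h2 h3
    refine hstep (Ω.laz (t (k + 1))) _ _ (sub_pos.2 (hmono (ht.1.1 k).1)) hk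
      (sub_pos.2 (hmono h2)) h3 ?_
    rw [sub_sub_cancel, add_sub_cancel, arc_laz hr, arc_laz hr, arc_laz hr, h1]
  · rw [div_le_iff₀ hδ] at hq1
    rw [div_le_iff₀ hq0']
    linarith
  · nlinarith

/-- The linearized reflection law along short chords of nearly equal length. -/
theorem exists_linear_reflection_bound (hr : 8 ≤ r) {C₀ : ℝ} (hC₀ : 0 ≤ C₀) :
    ∃ C q₁, 0 ≤ C ∧ ∀ q : ℕ, q₁ ≤ q → ∀ x d d' ξ ζ ζ' : ℝ, 0 ≤ d → d ≤ 2 / q → 0 ≤ d' → d' ≤ 2 / q →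
      |d - d'| ≤ C₀ / q ^ 4 →
      dfst Ω.sineModel (x, d) * ξ + dsnd Ω.sineModel (x, d) * ζ +
        (dfst Ω.sineModel (x, -d') * ξ - dsnd Ω.sineModel (x, -d') * ζ') = 0 →
      |ζ - ζ'| ≤ C * (|ξ| / q ^ 4 + |ζ'| / q ^ 3) := by
  obtain ⟨M, hM, hb⟩ := exists_sineModel_bound (Ω := Ω) hr
  have hper := sineModel_add_one (Ω := Ω) hr
  have hc1 : ContDiffOn ℝ (5 : ℕ) (dfst Ω.sineModel) strip := contDiffOn_dfst (contDiffOn_sineModel hr)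
  have hc2 : ContDiffOn ℝ (5 : ℕ) (dsnd Ω.sineModel) strip := contDiffOn_dsnd (contDiffOn_sineModel hr)
  obtain ⟨K1, hK1, hl1⟩ := exists_lipschitz_snd_of_periodic hc1
    (fun x d => by rw [dfst, fderiv_add_one hper, dfst])
  obtain ⟨K2, hK2, hl2⟩ := exists_lipschitz_snd_of_periodic hc2
    (fun x d => by rw [dsnd, fderiv_add_one hper, dsnd])
  refine ⟨2 * ((K1 * C₀ + 16 * M) + (8 * M + K2 * C₀)), 4 + ⌈8 * M⌉₊, by positivity, fun q hq => ?_⟩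
  have hq4 : (4 : ℝ) ≤ q := by exact_mod_cast (by omega : 4 ≤ q)
  have hq0 : (0 : ℝ) < q := by linarith
  have hqM : 8 * M ≤ q := (Nat.le_ceil _).trans (by exact_mod_cast (by omega : ⌈8 * M⌉₊ ≤ q))
  intro x d d' ξ ζ ζ' hd hdq hd' hdq' hdd heq
  have hq2 : 2 / (q : ℝ) ≤ 1 / 2 := by
    rw [div_le_div_iff₀ hq0 two_pos]
    linarith
  have had : |d| ≤ 1 / 2 := by rw [abs_of_nonneg hd]; linarith
  have had' : |d'| ≤ 1 / 2 := by rw [abs_of_nonneg hd']; linarith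
  obtain ⟨-, -, -, -, hx, hs⟩ := hb x d' had'
  have hdd4 : d' ^ 4 ≤ 16 / (q : ℝ) ^ 4 := by
    calc d' ^ 4 ≤ (2 / (q : ℝ)) ^ 4 := by gcongr
      _ = 16 / (q : ℝ) ^ 4 := by rw [div_pow]; norm_num
  have hdd3 : d' ^ 3 ≤ 8 / (q : ℝ) ^ 3 := by
    calc d' ^ 3 ≤ (2 / (q : ℝ)) ^ 3 := by gcongr
      _ = 8 / (q : ℝ) ^ 3 := by rw [div_pow]; norm_num
  rw [abs_of_nonneg hd'] at hx hs
  -- For equal steps the even part of the `x`-derivative is `O(q^-4)`; the difference of the steps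
  -- costs another `C₀/q^4`.
  have hA : |dfst Ω.sineModel (x, d) + dfst Ω.sineModel (x, -d')| ≤ (K1 * C₀ + 16 * M) / q ^ 4 := by
    have h1 := hl1 x d d' had had'
    have h2 := abs_add_le (dfst Ω.sineModel (x, d) - dfst Ω.sineModel (x, d'))
      (dfst Ω.sineModel (x, d') + dfst Ω.sineModel (x, -d'))
    rw [← add_assoc, sub_add_cancel] at h2
    have h3 : K1 * |d - d'| ≤ K1 * (C₀ / q ^ 4) := by gcongr
    have h4 : M * d' ^ 4 ≤ M * (16 / q ^ 4) := by gcongr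
    calc _ ≤ K1 * (C₀ / q ^ 4) + M * (16 / q ^ 4) := by linarith
      _ = _ := by ring
  have hB : |dsnd Ω.sineModel (x, -d') - dsnd Ω.sineModel (x, d)| ≤ (8 * M + K2 * C₀) / q ^ 3 := by
    have h1 := hl2 x d d' had had'
    have h2 := abs_add_le (dsnd Ω.sineModel (x, d) - dsnd Ω.sineModel (x, d'))
      (dsnd Ω.sineModel (x, d') - dsnd Ω.sineModel (x, -d'))
    rw [sub_add_sub_cancel] at h2
    have h3 : K2 * |d - d'| ≤ K2 * (C₀ / q ^ 4) := by gcongr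
    have h4 : M * d' ^ 3 ≤ M * (8 / q ^ 3) := by gcongr
    have h5 : C₀ / (q : ℝ) ^ 4 ≤ C₀ / q ^ 3 := by
      gcongr
      · linarith
      · norm_num
    have h6 : K2 * (C₀ / (q : ℝ) ^ 4) ≤ K2 * (C₀ / q ^ 3) := by gcongr
    rw [abs_sub_comm]
    calc _ ≤ K2 * (C₀ / q ^ 3) + M * (8 / q ^ 3) := by linarith
      _ = _ := by ring
  have hD : 1 / 2 ≤ dsnd Ω.sineModel (x, d) := by
    have h1 := (abs_le.1 (hb x d had).2.1).1
    rw [abs_of_nonneg hd] at h1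
    have h2 : d ^ 2 ≤ 4 / (q : ℝ) ^ 2 := by
      calc d ^ 2 ≤ (2 / (q : ℝ)) ^ 2 := by gcongr
        _ = 4 / (q : ℝ) ^ 2 := by rw [div_pow]; norm_num
    have h3 : M * d ^ 2 ≤ M * (4 / q ^ 2) := by gcongr
    have h4 : M * (4 / (q : ℝ) ^ 2) ≤ 1 / 2 := by
      rw [mul_div_assoc', div_le_div_iff₀ (by positivity) two_pos]
      nlinarith
    linarith
  have hkey : dsnd Ω.sineModel (x, d) * (ζ - ζ') =
      -((dfst Ω.sineModel (x, d) + dfst Ω.sineModel (x, -d')) * ξ) +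
        (dsnd Ω.sineModel (x, -d') - dsnd Ω.sineModel (x, d)) * ζ' := by linear_combination heq
  have h1 : 1 / 2 * |ζ - ζ'| ≤ (K1 * C₀ + 16 * M) / q ^ 4 * |ξ| + (8 * M + K2 * C₀) / q ^ 3 * |ζ'| := by
    calc 1 / 2 * |ζ - ζ'| ≤ |dsnd Ω.sineModel (x, d)| * |ζ - ζ'| := by
          gcongr
          exact hD.trans (le_abs_self _)
      _ = |dsnd Ω.sineModel (x, d) * (ζ - ζ')| := (abs_mul _ _).symm
      _ ≤ |dfst Ω.sineModel (x, d) + dfst Ω.sineModel (x, -d')| * |ξ| +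
          |dsnd Ω.sineModel (x, -d') - dsnd Ω.sineModel (x, d)| * |ζ'| := by
          rw [hkey]
          refine (abs_add_le _ _).trans_eq ?_
          rw [abs_neg, abs_mul, abs_mul]
      _ ≤ _ := by gcongr
  have h2 : 0 ≤ (K1 * C₀ + 16 * M) * (|ζ'| / (q : ℝ) ^ 3) := by positivity
  have h3 : 0 ≤ (8 * M + K2 * C₀) * (|ξ| / (q : ℝ) ^ 4) := by positivity
  have h4 : (K1 * C₀ + 16 * M) / (q : ℝ) ^ 4 * |ξ| = (K1 * C₀ + 16 * M) * (|ξ| / (q : ℝ) ^ 4) := by ring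
  have h5 : (8 * M + K2 * C₀) / (q : ℝ) ^ 3 * |ζ'| = (8 * M + K2 * C₀) * (|ζ'| / (q : ℝ) ^ 3) := by ring
  rw [h4, h5] at h1
  linarith

end Table
end Billiard

/-! ### Uniqueness and `C¹` dependence of the periodic orbits. -/

namespace Billiard
open Set Filter Topology

/-- A continuous curve is `C^n` at `x` if its image under a `C^n` map that is nonsingular there is
`C^n`. -/
theorem contDiffAt_of_comp {E : Type*} [NormedAddCommGroup E] [NormedSpace ℝ E] [FiniteDimensional ℝ E]
    {f : E → E} {y : ℝ → E} {x : ℝ} {n : WithTop ℕ∞} (hn : n ≠ 0) (hf : ContDiffAt ℝ n f (y x))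
    (hinj : Function.Injective (fderiv ℝ f (y x))) (hy : ContinuousAt y x)
    (hfy : ContDiffAt ℝ n (fun t => f (y t)) x) : ContDiffAt ℝ n y x := by
  have : CompleteSpace E := FiniteDimensional.complete ℝ E
  set e : E ≃L[ℝ] E := (LinearEquiv.ofInjectiveEndo (fderiv ℝ f (y x) : E →ₗ[ℝ] E) hinj).toContinuousLinearEquiv
    with he
  have hf' : HasFDerivAt f (e : E →L[ℝ] E) (y x) := by
    refine (hf.differentiableAt hn).hasFDerivAt.congr_fderiv ?_
    ext v
    simp [he]
  -- Continuity keeps the curve where the local inverse is valid, so near `x` the curve is the local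
  -- inverse applied to its image.
  have h1 := (hf.to_localInverse hf' hn).comp x hfy
  refine h1.congr_of_eventuallyEq ?_
  filter_upwards [hy.eventually (hf.hasStrictFDerivAt' hf' hn).eventually_left_inverse] with t ht
  exact ht.symm

namespace Table

variable {r : ℕ} {Ω : Table r}

section Orbits

variable {q : ℕ} {K : Set ℂ}

/-- Every periodic orbit follows the caustic map, so its first impact already fixes the second. -/
theorem existsUnique_periodicOrbit (hr : 8 ≤ r) (hq : 0 < q) (hK : Ω.IsIntegrableRationalCaustic 1 q K)
    (s₀ : ℝ) : ∃! s : ℤ → ℝ, Ω.IsPeriodicOrbit 1 q s ∧ s 0 = s₀ := by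
  obtain ⟨σ, -, -, -, hex, huniq⟩ := exists_caustic_map hr hq hK
  obtain ⟨t, ht, h0, -⟩ := hex s₀
  refine ⟨t, ⟨ht, h0⟩, fun u hu => ?_⟩
  refine IsPeriodicOrbit.ext hr hq hu.1 ht (hu.2.trans h0.symm) ?_
  rw [huniq u hu.1, huniq t ht, hu.2, h0]

theorem orbit_spec (hr : 8 ≤ r) (hq : 0 < q)
    (hK : Ω.IsIntegrableRationalCaustic 1 q K) (x : ℝ) : Ω.IsPeriodicOrbit 1 q (Ω.orbit q x) ∧ Ω.orbit q x 0 = Ω.arc x :=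
  Classical.epsilon_spec (existsUnique_periodicOrbit hr hq hK (Ω.arc x)).exists

theorem orbitX_zero (hr : 8 ≤ r) (hq : 0 < q)
    (hK : Ω.IsIntegrableRationalCaustic 1 q K) (x : ℝ) : Ω.orbitX q 0 x = x := by
  rw [orbitX, (orbit_spec hr hq hK x).2, laz_arc hr]

theorem orbitX_add_period (hr : 8 ≤ r) (hq : 0 < q)
    (hK : Ω.IsIntegrableRationalCaustic 1 q K) (k : ℤ) (x : ℝ) : Ω.orbitX q (k + q) x = Ω.orbitX q k x + 1 := by
  rw [orbitX, (orbit_spec hr hq hK x).1.2 k, Nat.cast_one, one_mul, laz_add_period hr, orbitX]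

/-- A monotone surjection of the line is continuous, so the iterates of the caustic map are
continuous. The inverse function theorem needs this continuity to select the branch. -/
theorem continuous_orbitX (hr : 8 ≤ r) (hq : 0 < q)
    (hK : Ω.IsIntegrableRationalCaustic 1 q K) (k : ℕ) : Continuous (Ω.orbitX q k) := by
  obtain ⟨σ, hmono, hsurj, -, hex, huniq⟩ := exists_caustic_map hr hq hK
  have hσ : Continuous σ := hmono.monotone.continuous_of_surjective hsurj
  have hstep : ∀ x (k : ℕ), Ω.orbit q x (k + 1) = σ (Ω.orbit q x k) := by
    intro x
    obtain ⟨h1, h2⟩ := orbit_spec hr hq hK x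
    obtain ⟨t, ht, h3, h4⟩ := hex (Ω.arc x)
    have : Ω.orbit q x = t := IsPeriodicOrbit.ext hr hq h1 ht (h2.trans h3.symm)
      (by rw [huniq _ h1, huniq _ ht, h2, h3])
    intro k
    rw [this, h4]
  have : Continuous fun x => Ω.orbit q x k := by
    induction k with
    | zero =>
      simp only [Nat.cast_zero, (orbit_spec hr hq hK _).2]
      exact continuous_arc hr
    | succ k ih =>
      push_cast
      simp only [hstep]
      exact hσ.comp ih
  exact (continuous_laz hr).comp this

theorem orbitX_step (hr : 8 ≤ r) (hq : 0 < q)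
    (hK : Ω.IsIntegrableRationalCaustic 1 q K) (k : ℤ) (x : ℝ) :
    0 < Ω.orbitX q (k + 1) x - Ω.orbitX q k x ∧ Ω.orbitX q (k + 1) x - Ω.orbitX q k x < 1 := by
  have h := (orbit_spec hr hq hK x).1.1.1 k
  have h1 := strictMono_laz (Ω := Ω) hr h.1
  have h2 := strictMono_laz (Ω := Ω) hr h.2
  rw [laz_add_period hr] at h2
  exact ⟨sub_pos.2 h1, by unfold orbitX; linarith⟩

theorem orbitWeight_eq (hr : 8 ≤ r) (hq : 0 < q)
    (hK : Ω.IsIntegrableRationalCaustic 1 q K) (k : ℤ) (x : ℝ) : Ω.orbitWeight q k x =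
    Ω.sineModel (Ω.orbitX q k x, Ω.orbitX q (k + 1) x - Ω.orbitX q k x) := by
  obtain ⟨h1, h2⟩ := orbitX_step hr hq hK k x
  have h3 := sineModel_pos_step (Ω := Ω) (x := Ω.orbitX q k x) hr h1 h2
  rw [add_sub_cancel, orbitX, orbitX, arc_laz hr, arc_laz hr] at h3
  rw [orbitWeight, orbitAngle, h3]
  exact mul_div_cancel_left₀ _ (mu_pos hr _).ne'

theorem orbitX_reflection (hr : 8 ≤ r) (hq : 0 < q)
    (hK : Ω.IsIntegrableRationalCaustic 1 q K) (k : ℤ) (x : ℝ) :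
    Ω.sineModel (Ω.orbitX q (k + 1) x, Ω.orbitX q (k + 2) x - Ω.orbitX q (k + 1) x) +
      Ω.sineModel (Ω.orbitX q (k + 1) x, Ω.orbitX q k x - Ω.orbitX q (k + 1) x) = 0 := by
  obtain ⟨h1, h2⟩ := orbitX_step hr hq hK k x
  obtain ⟨h3, h4⟩ := orbitX_step hr hq hK (k + 1) x
  rw [show k + 1 + 1 = k + 2 by ring] at h3 h4
  have h5 := (orbit_spec hr hq hK x).1.1.2 (k + 1)
  rw [show k + 1 + 1 = k + 2 by ring, add_sub_cancel_right] at h5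
  rw [← neg_sub (Ω.orbitX q (k + 1) x) (Ω.orbitX q k x)]
  refine sineModel_reflection hr h3 h4 h1 h2 ?_
  rw [sub_sub_cancel, add_sub_cancel, orbitX, orbitX, orbitX, arc_laz hr, arc_laz hr, arc_laz hr, h5]

end Orbits

theorem hasDerivAt_sineModel (hr : 8 ≤ r) {b c : ℝ → ℝ} {b' c' τ : ℝ} (hb : HasDerivAt b b' τ)
    (hc : HasDerivAt c c' τ) (h : |c τ - b τ| < 1) :
    HasDerivAt (fun τ => Ω.sineModel (b τ, c τ - b τ))
      (dfst Ω.sineModel (b τ, c τ - b τ) * b' + dsnd Ω.sineModel (b τ, c τ - b τ) * (c' - b')) τ := by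
  have h1 := (hasFDerivAt_of_strip (n := 5) (contDiffOn_sineModel (Ω := Ω) hr) (p := (b τ, c τ - b τ)) h)
  refine (h1.comp_hasDerivAt τ (hb.prodMk (hc.sub hb))).congr_deriv ?_
  rw [show (b', c' - b') = b' • ((1 : ℝ), (0 : ℝ)) + (c' - b') • ((0 : ℝ), (1 : ℝ)) by simp, map_add,
    map_smul, map_smul, smul_eq_mul, smul_eq_mul, mul_comm b', mul_comm (c' - b')]
  rfl

/-- The steps of the periodic orbits of rotation number `1 / q` are short and nearly equal, and
so are the variations of such an orbit. -/
structure StableRotation (Ω : Table r) (q : ℕ) (C : ℝ) : Prop where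
  pos : 0 < q
  nonneg : 0 ≤ C
  four_mul_le : 4 * C ≤ (q : ℝ) ^ 2
  exists_caustic : ∃ K, Ω.IsIntegrableRationalCaustic 1 q K
  step_le : ∀ x (k : ℤ), Ω.orbitX q (k + 1) x - Ω.orbitX q k x ≤ 2 / q
  step_sub : ∀ x (k : ℤ), |Ω.orbitX q (k + 1) x - Ω.orbitX q k x - 1 / q| ≤ C / q ^ 3
  variation : ∀ x (k : ℤ) (a' b' c' : ℝ),
    dfst Ω.sineModel (Ω.orbitX q (k + 1) x, Ω.orbitX q (k + 2) x - Ω.orbitX q (k + 1) x) * b' +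
    dsnd Ω.sineModel (Ω.orbitX q (k + 1) x, Ω.orbitX q (k + 2) x - Ω.orbitX q (k + 1) x) * (c' - b') +
    (dfst Ω.sineModel (Ω.orbitX q (k + 1) x, Ω.orbitX q k x - Ω.orbitX q (k + 1) x) * b' +
    dsnd Ω.sineModel (Ω.orbitX q (k + 1) x, Ω.orbitX q k x - Ω.orbitX q (k + 1) x) * (a' - b')) = 0 →
      |(c' - b') - (b' - a')| ≤ C * (|b'| / q ^ 4 + |b' - a'| / q ^ 3)

theorem exists_stableRotation (hr : 8 ≤ r) : ∃ C q₁, ∀ q : ℕ, q₁ ≤ q →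
    (∃ K, Ω.IsIntegrableRationalCaustic 1 q K) → StableRotation Ω q C := by
  obtain ⟨C₀, q₁, hC₀, h⟩ := exists_periodic_orbit_bound (Ω := Ω) hr
  obtain ⟨C₁, q₂, hC₁, h'⟩ := exists_linear_reflection_bound (Ω := Ω) hr hC₀
  refine ⟨C₀ + C₁, q₁ + q₂ + ⌈4 * (C₀ + C₁)⌉₊, fun q hq hK => ?_⟩
  obtain ⟨hq0, h⟩ := h q (by omega)
  have h' := h' q (by omega)
  have hq1 : (1 : ℝ) ≤ q := by exact_mod_cast hq0
  have hq2 : 4 * (C₀ + C₁) ≤ q :=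
    (Nat.le_ceil _).trans (by exact_mod_cast (by omega : ⌈4 * (C₀ + C₁)⌉₊ ≤ q))
  obtain ⟨K, hK⟩ := hK
  refine ⟨hq0, by positivity, by nlinarith, ⟨K, hK⟩, fun x k => (h _ (orbit_spec hr hq0 hK x).1 k).1,
    fun x k => ((h _ (orbit_spec hr hq0 hK x).1 k).2.2).trans (by gcongr; linarith), ?_⟩
  intro x k a' b' c' heq
  have o1 := h _ (orbit_spec hr hq0 hK x).1 k
  have o2 := h _ (orbit_spec hr hq0 hK x).1 (k + 1)
  rw [show k + 1 + 1 = k + 2 by ring] at o2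
  have s1 := orbitX_step hr hq0 hK k x
  have s2 := orbitX_step hr hq0 hK (k + 1) x
  rw [show k + 1 + 1 = k + 2 by ring] at s2
  refine (h' (Ω.orbitX q (k + 1) x) (Ω.orbitX q (k + 2) x - Ω.orbitX q (k + 1) x)
    (Ω.orbitX q (k + 1) x - Ω.orbitX q k x) b' (c' - b') (b' - a') s2.1.le o2.1 s1.1.le o1.1 o1.2.1 ?_).trans
    (by gcongr; linarith)
  rw [neg_sub]
  linear_combination heq

namespace StableRotation

variable {q : ℕ} {C : ℝ}

variable (q) in
/-- The coordinates of a point of `ℝ^q`, followed by the first one shifted by `s`. -/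
def extend (hq : 0 < q) (s : ℝ) (y : Fin q → ℝ) (k : ℕ) : ℝ :=
  if h : k < q then y ⟨k, h⟩ else y ⟨0, hq⟩ + s

theorem contDiff_extend (hq : 0 < q) (s : ℝ) (k : ℕ) {n : WithTop ℕ∞} :
    ContDiff ℝ n fun y : Fin q → ℝ => extend q hq s y k := by
  unfold extend
  split_ifs
  · exact contDiff_apply ℝ ℝ _
  · exact (contDiff_apply ℝ ℝ _).add contDiff_const

theorem hasDerivAt_extend (hq : 0 < q) (s : ℝ) (y v : Fin q → ℝ) (k : ℕ) :
    HasDerivAt (fun τ : ℝ => extend q hq s (y + τ • v) k) (extend q hq 0 v k) 0 := by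
  have h : ∀ i, HasDerivAt (fun τ : ℝ => (y + τ • v) i) (v i) 0 := fun i => by
    simpa using ((hasDerivAt_id (0 : ℝ)).mul_const (v i)).const_add (y i)
  unfold extend
  split_ifs
  · exact h _
  · rw [add_zero]
    exact (h _).add_const s

variable (Ω) in
/-- The reflection laws at the impacts `1, …, q - 1`, together with the first impact point. -/
noncomputable def reflectionMap (hq : 0 < q) (y : Fin q → ℝ) (i : Fin q) : ℝ :=
  if i.1 = 0 then y i else
    Ω.sineModel (y i, extend q hq 1 y (i.1 + 1) - y i) +
      Ω.sineModel (y i, extend q hq 1 y (i.1 - 1) - y i)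

/-- The vector of the first `q` impacts solves a square system: its first entry is `x` and the
reflection laws at the other impacts hold. A kernel vector of the differential, closed up after `q`
entries, solves the linearized recursion with initial value zero; by stability its increments
vanish, so it is zero and the inverse function theorem applies. -/
theorem contDiffAt_orbitX (hr : 8 ≤ r) (hS : StableRotation Ω q C) (x : ℝ) (i : Fin q) :
    ContDiffAt ℝ 1 (Ω.orbitX q (i.1 : ℤ)) x := by
  have hq := hS.pos
  obtain ⟨K, hK⟩ := hS.exists_caustic
  set Y : ℝ → Fin q → ℝ := fun x i => Ω.orbitX q (i.1 : ℤ) x with hY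
  have hext : ∀ x, ∀ k ≤ q, extend q hq 1 (Y x) k = Ω.orbitX q (k : ℤ) x := by
    intro x k hk
    unfold extend
    split_ifs with h
    · rfl
    · obtain rfl : k = q := by omega
      have := orbitX_add_period hr hq hK 0 x
      rw [zero_add] at this
      rw [this]
      simp [hY]
  have habs : ∀ x (k : ℤ), |Ω.orbitX q (k + 1) x - Ω.orbitX q k x| < 1 := fun x k => by
    obtain ⟨h1, h2⟩ := orbitX_step hr hq hK k x
    rwa [abs_of_pos h1]
  have hfwd : ∀ x (i : Fin q), |extend q hq 1 (Y x) (i.1 + 1) - Y x i| < 1 := fun x i => by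
    rw [hext x _ i.2]
    exact_mod_cast habs x i.1
  have hbwd : ∀ x (i : Fin q), i.1 ≠ 0 → |extend q hq 1 (Y x) (i.1 - 1) - Y x i| < 1 := fun x i hi => by
    rw [hext x _ (by omega), abs_sub_comm]
    have := habs x (i.1 - 1 : ℕ)
    rwa [show ((i.1 - 1 : ℕ) : ℤ) + 1 = i.1 by omega] at this
  have hmodel : ∀ (i : Fin q) (k : ℕ), |extend q hq 1 (Y x) k - Y x i| < 1 →
      ContDiffAt ℝ 1 (fun y : Fin q → ℝ => Ω.sineModel (y i, extend q hq 1 y k - y i)) (Y x) := by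
    intro i k h
    have h1 : ContDiffAt ℝ 1 Ω.sineModel (Y x i, extend q hq 1 (Y x) k - Y x i) :=
      ((contDiffOn_sineModel hr).contDiffAt (isOpen_strip.mem_nhds h)).of_le (by norm_num)
    exact h1.comp (Y x) (ContDiffAt.prodMk (contDiff_apply ℝ ℝ i).contDiffAt
      ((contDiff_extend hq 1 k).sub (contDiff_apply ℝ ℝ i)).contDiffAt)
  have hG : ContDiffAt ℝ 1 (reflectionMap Ω hq) (Y x) := by
    refine contDiffAt_pi.2 fun i => ?_
    unfold reflectionMap
    split_ifs with hi
    · exact (contDiff_apply ℝ ℝ i).contDiffAt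
    · exact (hmodel i _ (hfwd x i)).add (hmodel i _ (hbwd x i hi))
  have hinj : Function.Injective (fderiv ℝ (reflectionMap Ω hq) (Y x)) := by
    refine (injective_iff_map_eq_zero _).2 fun v hv => ?_
    have hline : HasDerivAt (fun τ : ℝ => reflectionMap Ω hq (Y x + τ • v)) 0 0 := by
      have h1 : HasDerivAt (fun τ : ℝ => Y x + τ • v) v 0 := by
        simpa using ((hasDerivAt_id (0 : ℝ)).smul_const v).const_add (Y x)
      have h2 : HasFDerivAt (reflectionMap Ω hq) (fderiv ℝ (reflectionMap Ω hq) (Y x))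
          (Y x + (0 : ℝ) • v) := by
        rw [zero_smul, add_zero]
        exact (hG.differentiableAt (by norm_num)).hasFDerivAt
      exact (h2.comp_hasDerivAt 0 h1).congr_deriv hv
    have hcomp : ∀ i, HasDerivAt (fun τ : ℝ => reflectionMap Ω hq (Y x + τ • v) i) 0 0 :=
      hasDerivAt_pi.1 hline
    have hY0 : ∀ i k, |extend q hq 1 (Y x) k - Y x i| < 1 →
        |extend q hq 1 (Y x + (0 : ℝ) • v) k - (Y x + (0 : ℝ) • v) i| < 1 := by simp
    have hv : ∀ i, HasDerivAt (fun τ : ℝ => (Y x + τ • v) i) (v i) 0 := fun i => by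
      simpa using ((hasDerivAt_id (0 : ℝ)).mul_const (v i)).const_add (Y x i)
    -- Impacts close up with shift `1`, variations with shift `0`.
    set ξ : ℕ → ℝ := extend q hq 0 v with hξ
    have hξv : ∀ i : Fin q, ξ i.1 = v i := fun i => by simp [hξ, extend]
    have hξ0 : ξ 0 = 0 := by
      have := hcomp ⟨0, hq⟩
      simp only [reflectionMap, if_true] at this
      rw [show (0 : ℕ) = (⟨0, hq⟩ : Fin q).1 from rfl, hξv]
      exact (hv _).unique this
    have hξq : ξ q = ξ 0 := by simp [hξ, extend, hq]
    have hvar : ∀ k < q, |ξ (k + 1) - ξ k| ≤ 2 * C * |ξ 0| / q ^ 3 := fun k hk =>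
      abs_variation_le (ξ := ξ) hq hS.nonneg (fun k hk => by
      have h1 := hcomp ⟨k + 1, hk⟩
      simp only [reflectionMap, Nat.add_eq_zero_iff, one_ne_zero, and_false, if_false,
        Nat.add_sub_cancel] at h1
      have hb := hv ⟨k + 1, hk⟩
      have h2 := hasDerivAt_sineModel (Ω := Ω) hr hb (hasDerivAt_extend hq 1 (Y x) v (k + 1 + 1))
        (hY0 _ _ (hfwd x ⟨k + 1, hk⟩))
      have h3 := hasDerivAt_sineModel (Ω := Ω) hr hb (hasDerivAt_extend hq 1 (Y x) v k)
        (hY0 _ _ (hbwd x ⟨k + 1, hk⟩ (by simp)))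
      have h4 := (h2.add h3).unique h1
      simp only [zero_smul, add_zero, hext x _ (show k + 1 + 1 ≤ q from hk),
        hext x _ (show k ≤ q by omega)] at h4
      rw [← hξ, ← hξv] at h4
      have h5 := hS.variation x k (ξ k) (ξ (k + 1)) (ξ (k + 2))
      simp only [hY] at h4
      push_cast at h4
      rw [show (k : ℤ) + 1 + 1 = k + 2 by ring] at h4
      exact h5 h4) hξq hS.four_mul_le hk
    simp only [hξ0, abs_zero, mul_zero, zero_div, abs_nonpos_iff] at hvar
    have hzero : ∀ k ≤ q, ξ k = 0 := by
      intro k hk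
      induction k with
      | zero => exact hξ0
      | succ k ih => linarith [hvar k hk, ih (by omega)]
    funext i
    rw [← hξv i]
    exact hzero _ i.2.le
  have hcont : ContinuousAt Y x :=
    continuousAt_pi.2 fun i => (continuous_orbitX hr hq hK i.1).continuousAt
  have himage : ∀ x, reflectionMap Ω hq (Y x) = fun i => if i.1 = 0 then x else 0 := by
    intro x
    funext i
    unfold reflectionMap
    split_ifs with hi
    · simp only [hY, hi]
      exact orbitX_zero hr hq hK x
    · rw [hext x _ i.2, hext x _ (by omega)]
      have := orbitX_reflection hr hq hK ((i.1 - 1 : ℕ) : ℤ) x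
      rw [show ((i.1 - 1 : ℕ) : ℤ) + 1 = i.1 by omega,
        show ((i.1 - 1 : ℕ) : ℤ) + 2 = ((i.1 + 1 : ℕ) : ℤ) by omega] at this
      exact this
  have := contDiffAt_of_comp one_ne_zero hG hinj hcont (by
    simp only [himage]
    refine contDiffAt_pi.2 fun i => ?_
    split_ifs
    · exact contDiffAt_id
    · exact contDiffAt_const)
  exact contDiffAt_pi.1 this i

theorem contDiff_orbitX (hr : 8 ≤ r) (hS : StableRotation Ω q C) (k : ℤ) :
    ContDiff ℝ 1 (Ω.orbitX q k) := by
  obtain ⟨K, hK⟩ := hS.exists_caustic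
  have hq := hS.pos
  have hshift : ∀ (m : ℕ) (k : ℤ) x, Ω.orbitX q (k + m * q) x = Ω.orbitX q k x + m := by
    intro m
    induction m with
    | zero => simp
    | succ m ih =>
      intro k x
      push_cast
      rw [show k + ((m : ℤ) + 1) * q = (k + m * q) + q by ring, orbitX_add_period hr hq hK, ih]
      ring
  have hnat : ∀ k : ℕ, k < q → ContDiff ℝ 1 (Ω.orbitX q (k : ℤ)) := fun k hk =>
    contDiff_iff_contDiffAt.2 fun x => contDiffAt_orbitX hr hS x ⟨k, hk⟩
  have hq' : (0 : ℤ) < q := by exact_mod_cast hq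
  obtain ⟨j, hj⟩ := Int.eq_ofNat_of_zero_le (Int.emod_nonneg k hq'.ne')
  have hjq : j < q := by
    have := Int.emod_lt_of_pos k hq'
    omega
  have hk : k = j + (k / q) * q := by
    have := Int.mul_ediv_add_emod k q
    rw [hj] at this
    linarith
  obtain ⟨m, hm | hm⟩ := (k / q).eq_nat_or_neg
  · rw [hk, hm, show Ω.orbitX q (j + m * q) = _ from funext (hshift m j)]
    exact (hnat j hjq).add contDiff_const
  · have h1 : Ω.orbitX q k = fun x => Ω.orbitX q (j : ℤ) x - m := by
      funext x
      have := hshift m k x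
      rw [show k + m * q = j by rw [hm] at hk; linarith] at this
      linarith
    rw [h1]
    exact (hnat j hjq).sub contDiff_const

theorem contDiff_orbitWeight (hr : 8 ≤ r) (hS : StableRotation Ω q C) (k : ℤ) :
    ContDiff ℝ 1 (Ω.orbitWeight q k) := by
  obtain ⟨K, hK⟩ := hS.exists_caustic
  rw [show Ω.orbitWeight q k = _ from funext (orbitWeight_eq hr hS.pos hK k)]
  refine contDiff_iff_contDiffAt.2 fun x => ?_
  obtain ⟨h1, h2⟩ := orbitX_step hr hS.pos hK k x
  have h3 : ContDiffAt ℝ 1 Ω.sineModel (Ω.orbitX q k x, Ω.orbitX q (k + 1) x - Ω.orbitX q k x) :=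
    ((contDiffOn_sineModel hr).contDiffAt (isOpen_strip.mem_nhds (by
      change |Ω.orbitX q (k + 1) x - Ω.orbitX q k x| < 1
      rwa [abs_of_pos h1]))).of_le (by norm_num)
  exact h3.comp x ((contDiff_orbitX hr hS k).prodMk
    ((contDiff_orbitX hr hS (k + 1)).sub (contDiff_orbitX hr hS k))).contDiffAt

end StableRotation

end Table
end Billiard

/-! ### Uniform closeness of the periodic orbits to the rigid rotation. -/

namespace Billiard
open Set Filter Topology
namespace Table

variable {r : ℕ} {Ω : Table r}

/-- Differentiating the reflection laws shows that the derivatives of the impacts solve the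
linearized recursion. It starts at `1` and closes up because `x_q^q = x + 1`. -/
theorem StableRotation.variation_deriv (hr : 8 ≤ r) {q : ℕ} {C : ℝ} (hS : StableRotation Ω q C) (x : ℝ) :
    ∀ k < q, |deriv (Ω.orbitX q ((k + 1 : ℕ) : ℤ)) x - deriv (Ω.orbitX q (k : ℤ)) x| ≤ 2 * C / q ^ 3 := by
  obtain ⟨K, hK⟩ := hS.exists_caustic
  have hq := hS.pos
  have hd : ∀ k : ℤ, HasDerivAt (Ω.orbitX q k) (deriv (Ω.orbitX q k) x) x := fun k =>
    ((hS.contDiff_orbitX hr k).differentiable one_ne_zero x).hasDerivAt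
  have habs : ∀ k : ℤ, |Ω.orbitX q (k + 1) x - Ω.orbitX q k x| < 1 := fun k => by
    obtain ⟨h1, h2⟩ := orbitX_step hr hq hK k x
    rwa [abs_of_pos h1]
  have hvar : ∀ k : ℤ, |(deriv (Ω.orbitX q (k + 2)) x - deriv (Ω.orbitX q (k + 1)) x) -
      (deriv (Ω.orbitX q (k + 1)) x - deriv (Ω.orbitX q k) x)| ≤
      C * (|deriv (Ω.orbitX q (k + 1)) x| / q ^ 4 +
        |deriv (Ω.orbitX q (k + 1)) x - deriv (Ω.orbitX q k) x| / q ^ 3) := by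
    intro k
    refine hS.variation x k _ _ _ ?_
    have h1 := hasDerivAt_sineModel (Ω := Ω) hr (hd (k + 1)) (hd (k + 2)) (by
      have := habs (k + 1)
      rwa [show k + 1 + 1 = k + 2 by ring] at this)
    have h2 := hasDerivAt_sineModel (Ω := Ω) hr (hd (k + 1)) (hd k) (by
      rw [abs_sub_comm]
      exact habs k)
    exact (h1.add h2).unique ((hasDerivAt_const x 0).congr_of_eventuallyEq
      (Eventually.of_forall fun y => orbitX_reflection hr hq hK k y))
  have h0 : deriv (Ω.orbitX q 0) x = 1 := by
    rw [show Ω.orbitX q 0 = id from funext (orbitX_zero hr hq hK)]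
    exact deriv_id x
  have hend : deriv (Ω.orbitX q (q : ℤ)) x = deriv (Ω.orbitX q ((0 : ℕ) : ℤ)) x := by
    rw [show Ω.orbitX q (q : ℤ) = fun x => Ω.orbitX q 0 x + 1 from funext fun x => by
      rw [← orbitX_add_period hr hq hK, zero_add], deriv_add_const]
    rfl
  intro k hk
  have := abs_variation_le (ξ := fun k : ℕ => deriv (Ω.orbitX q (k : ℤ)) x) hq hS.nonneg
    (fun k _ => by
      push_cast
      exact hvar k) hend hS.four_mul_le hk
  simpa [h0] using this

/-- Errors `O(q^-3)` per bounce accumulate to `O(q^-2)` over at most `q` bounces; the weights are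
the model evaluated at a step, hence `1/q + O(q^-3)`. -/
theorem exists_nearRotation (hr : 8 ≤ r) (C : ℝ) : ∃ C' q₁, 0 ≤ C' ∧ ∀ q : ℕ, q₁ ≤ q → 0 ≤ C →
    StableRotation Ω q C → Ω.NearRotation C' q := by
  obtain ⟨M, hM, hb⟩ := exists_sineModel_bound (Ω := Ω) hr
  rcases lt_or_ge C 0 with hneg | hC
  · exact ⟨0, 0, le_rfl, fun q _ h => absurd h hneg.not_ge⟩
  -- A sum of nonnegative constants, so that each of the four estimates is covered by part of it.
  refine ⟨C + (2 * C * (1 + 8 * M + C) + (8 * M + C)) + (8 * M * (1 + 2 * C) + (1 + M) * (2 * C)), 4,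
    by positivity, fun q hq4 _ hS => ?_⟩
  obtain ⟨K, hK⟩ := hS.exists_caustic
  have hq := hS.pos
  have hqR : (0 : ℝ) < q := by exact_mod_cast hq
  have hq1 : (1 : ℝ) ≤ q := by exact_mod_cast hq
  have hq2 : 2 / (q : ℝ) ≤ 1 / 2 := by
    rw [div_le_div_iff₀ hqR two_pos]
    have : (4 : ℝ) ≤ q := by exact_mod_cast hq4
    linarith
  have hζ := hS.variation_deriv hr
  have hξ : ∀ x, ∀ k < q, |deriv (Ω.orbitX q (k : ℤ)) x - 1| ≤ 2 * C / q ^ 2 := by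
    intro x k hk
    have h1 := abs_sub_le_of_step_le (u := fun k : ℕ => deriv (Ω.orbitX q (k : ℤ)) x) (hζ x) k hk.le
    have h0 : deriv (Ω.orbitX q ((0 : ℕ) : ℤ)) x = 1 := by
      rw [show Ω.orbitX q ((0 : ℕ) : ℤ) = id from funext (orbitX_zero hr hq hK)]
      exact deriv_id x
    simp only [h0] at h1
    have hk' : (k : ℝ) ≤ q := by exact_mod_cast hk.le
    calc _ ≤ (k : ℝ) * (2 * C / q ^ 3) := h1
      _ ≤ q * (2 * C / q ^ 3) := by gcongr
      _ = 2 * C / q ^ 2 := by field_simp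
  have hstep : ∀ x (k : ℤ), |Ω.orbitX q (k + 1) x - Ω.orbitX q k x| ≤ 1 / 2 := fun x k => by
    rw [abs_of_pos (orbitX_step hr hq hK k x).1]
    exact (hS.step_le x k).trans hq2
  have hcube : ∀ x (k : ℤ), M * |Ω.orbitX q (k + 1) x - Ω.orbitX q k x| ^ 3 ≤ 8 * M / q ^ 3 := fun x k => by
    rw [abs_of_pos (orbitX_step hr hq hK k x).1]
    have h1 := (orbitX_step hr hq hK k x).1.le
    have h2 := hS.step_le x k
    calc M * (Ω.orbitX q (k + 1) x - Ω.orbitX q k x) ^ 3 ≤ M * (2 / (q : ℝ)) ^ 3 := by gcongr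
      _ = 8 * M / (q : ℝ) ^ 3 := by rw [div_pow]; ring
  have hweight : ∀ x (k : ℤ), |Ω.orbitWeight q k x - 1 / q| ≤ (8 * M + C) / q ^ 3 := by
    intro x k
    have h1 := (hb (Ω.orbitX q k x) _ (hstep x k)).1.trans (hcube x k)
    rw [← orbitWeight_eq hr hq hK] at h1
    have h2 := hS.step_sub x k
    have h3 := abs_add_le (Ω.orbitWeight q k x - (Ω.orbitX q (k + 1) x - Ω.orbitX q k x))
      (Ω.orbitX q (k + 1) x - Ω.orbitX q k x - 1 / q)
    rw [sub_add_sub_cancel] at h3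
    rw [add_div]
    linarith
  refine ⟨fun x k hk => ?_, fun x k _ => ?_, fun x k hk => ?_, fun x k hk => ?_⟩
  · have h1 := abs_sub_le_of_step_le (u := fun k : ℕ => Ω.orbitX q (k : ℤ) x - k / q) (c := C / q ^ 3)
      (n := q) (fun k _ => by
        have := hS.step_sub x k
        push_cast
        rwa [show Ω.orbitX q ((k : ℤ) + 1) x - ((k : ℝ) + 1) / q - (Ω.orbitX q k x - k / q) =
          Ω.orbitX q ((k : ℤ) + 1) x - Ω.orbitX q k x - 1 / q by ring]) k hk.le
    simp only [Nat.cast_zero, zero_div, sub_zero, orbitX_zero hr hq hK] at h1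
    have hk' : (k : ℝ) ≤ q := by exact_mod_cast hk.le
    rw [sub_right_comm]
    calc _ ≤ (k : ℝ) * (C / q ^ 3) := h1
      _ ≤ q * (C / q ^ 3) := by gcongr
      _ = C / q ^ 2 := by field_simp
      _ ≤ _ := by
        gcongr
        rw [add_assoc]
        exact le_add_of_nonneg_right (by positivity)
  · push_cast
    refine (hS.step_sub x k).trans ?_
    gcongr
    rw [add_assoc]
    exact le_add_of_nonneg_right (by positivity)
  · set ξ := deriv (Ω.orbitX q (k : ℤ)) x
    set w := Ω.orbitWeight q (k : ℤ) x
    have hw := hweight x k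
    have hw' : |w| ≤ (1 + 8 * M + C) / q := by
      have h1 := abs_add_le (w - 1 / q) (1 / (q : ℝ))
      rw [sub_add_cancel, abs_of_pos (by positivity : 0 < 1 / (q : ℝ))] at h1
      have h2 : (8 * M + C) / (q : ℝ) ^ 3 ≤ (8 * M + C) / q := by
        gcongr
        exact le_self_pow₀ hq1 (by norm_num)
      calc |w| ≤ (8 * M + C) / q + 1 / q := by linarith
        _ = _ := by ring
    have h3 := hξ x k hk
    calc |ξ * w - 1 / q| = |(ξ - 1) * w + (w - 1 / q)| := by ring_nf
      _ ≤ |ξ - 1| * |w| + |w - 1 / q| := by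
        rw [← abs_mul]
        exact abs_add_le _ _
      _ ≤ 2 * C / q ^ 2 * ((1 + 8 * M + C) / q) + (8 * M + C) / q ^ 3 := by gcongr
      _ = (2 * C * (1 + 8 * M + C) + (8 * M + C)) / q ^ 3 := by field_simp
      _ ≤ _ := by
        have : 0 ≤ 8 * M * (1 + 2 * C) + (1 + M) * (2 * C) := by positivity
        gcongr ?_ / _
        linarith
  -- By the chain rule there are two terms: the `x`-derivative of the model is cubic in the step,
  -- and the step derivative multiplies a variation that is already `O(q^-3)`.
  · have hd : ∀ k : ℤ, HasDerivAt (Ω.orbitX q k) (deriv (Ω.orbitX q k) x) x := fun k =>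
      ((hS.contDiff_orbitX hr k).differentiable one_ne_zero x).hasDerivAt
    have h1 := hasDerivAt_sineModel (Ω := Ω) hr (hd k) (hd (k + 1)) (by linarith [hstep x k])
    rw [show Ω.orbitWeight q (k : ℤ) = _ from funext (orbitWeight_eq hr hq hK k), h1.deriv]
    obtain ⟨-, h2, h3, -⟩ := hb (Ω.orbitX q k x) _ (hstep x k)
    replace h3 := h3.trans (hcube x k)
    have h4 : |dsnd Ω.sineModel (Ω.orbitX q k x, Ω.orbitX q (k + 1) x - Ω.orbitX q k x)| ≤ 1 + M := by
      have h5 : M * |Ω.orbitX q (k + 1) x - Ω.orbitX q k x| ^ 2 ≤ M * 1 := by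
        gcongr
        exact pow_le_one₀ (abs_nonneg _) (by linarith [hstep x k])
      have h6 := abs_add_le
        (dsnd Ω.sineModel (Ω.orbitX q k x, Ω.orbitX q (k + 1) x - Ω.orbitX q k x) - 1) 1
      rw [sub_add_cancel, abs_one] at h6
      linarith
    have h5 : |deriv (Ω.orbitX q (k : ℤ)) x| ≤ 1 + 2 * C := by
      have h6 := abs_add_le (deriv (Ω.orbitX q (k : ℤ)) x - 1) 1
      rw [sub_add_cancel, abs_one] at h6
      have h7 : 2 * C / (q : ℝ) ^ 2 ≤ 2 * C := div_le_self (by positivity) (one_le_pow₀ hq1)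
      have := hξ x k hk
      linarith
    have h6 := hζ x k hk
    push_cast at h6
    refine (abs_add_le _ _).trans ?_
    rw [abs_mul, abs_mul]
    calc _ ≤ 8 * M / (q : ℝ) ^ 3 * (1 + 2 * C) + (1 + M) * (2 * C / (q : ℝ) ^ 3) := by gcongr
      _ = (8 * M * (1 + 2 * C) + (1 + M) * (2 * C)) / (q : ℝ) ^ 3 := by ring
      _ ≤ _ := by
        have : 0 ≤ 2 * C * (1 + 8 * M + C) := by positivity
        gcongr ?_ / _
        linarith

end Table
end Billiard

/-! ### The theorem. -/

theorem theorem2 (r : ℕ) (hr : 8 ≤ r) (Ω : Billiard.Table r)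
    (qs : ℕ) (hqs : 2 ≤ qs) (hΩ : Ω.RationallyIntegrable qs)
    (γ₀ : ℝ) (hγ₀ : HasSum (fun k : ℕ => 1 / ((k : ℝ) + 2) ^ (γ₀ - 1)) (9 / 10))
    (γ : ℝ) (hγ : γ₀ ≤ γ) (hγ3 : γ < 3) :
    -- functions in `X^γ` are `C¹`
    (∀ f ∈ Billiard.XSpace γ, ContDiff ℝ 1 (Billiard.lift f)) ∧
    ∃ q₀ : ℕ,
      -- for `q ≥ q₀` the orbits entering the definition of `𝕃_q` are well defined and `C¹`
      (∀ q : ℕ, q₀ ≤ q →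
        (∀ s₀ : ℝ, ∃! s : ℤ → ℝ, Ω.IsPeriodicOrbit 1 q s ∧ s 0 = s₀) ∧
        ∀ k : ℤ, ContDiff ℝ 1 (Ω.orbitX q k) ∧ ContDiff ℝ 1 (Ω.orbitWeight q k)) ∧
      -- the map is invertible from `X^γ` to `h^γ`, with bounded inverse
      ∀ qbar : ℕ, q₀ ≤ qbar →
        ∃ T : Billiard.XSpace γ ≃ₗ[ℝ] Billiard.hSpace γ,
          (∀ f, (T f : Billiard.RSeq) = Ω.opI qbar f) ∧
          (∃ C : ℝ, ∀ f, Billiard.hNorm γ (T f) ≤ C * Billiard.XNorm γ f) ∧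
          ∃ C : ℝ, ∀ c, Billiard.XNorm γ (T.symm c) ≤ C * Billiard.hNorm γ c := by
  have h52 := Billiard.five_halves_lt_of_hasSum hγ₀
  refine ⟨fun f hf => Billiard.contDiff_lift (by linarith) hf, ?_⟩
  obtain ⟨C, q₁, hS⟩ := Billiard.Table.exists_stableRotation (Ω := Ω) hr
  obtain ⟨C', q₂, hC', hN⟩ := Billiard.Table.exists_nearRotation (Ω := Ω) hr C
  -- Only the caustics of rotation number `1/q` enter, with `q > q_*`.
  have hK : ∀ q, qs + 1 ≤ q → ∃ K, Ω.IsIntegrableRationalCaustic 1 q K := fun q hq =>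
    hΩ 1 q one_pos (by omega) (Nat.coprime_one_left q)
  have hS' : ∀ q, q₁ + q₂ + (qs + 1) ≤ q → Billiard.Table.StableRotation Ω q C := fun q hq =>
    hS q (by omega) (hK q (by omega))
  obtain ⟨q₃, hT⟩ := Billiard.Table.exists_forall_opI_invertible (Ω := Ω) hγ₀ hγ hγ3 hC'
    (q₁ := q₁ + q₂ + (qs + 1)) (fun q hq => hN q (by omega) (hS' q hq).nonneg (hS' q hq))
  refine ⟨q₁ + q₂ + (qs + 1) + q₃, fun q hq => ⟨fun s₀ => ?_, fun k => ?_⟩, fun qbar hq => hT qbar (by omega)⟩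
  · have hSq := hS' q (by omega)
    obtain ⟨K, hKq⟩ := hSq.exists_caustic
    exact Billiard.Table.existsUnique_periodicOrbit hr hSq.pos hKq s₀
  · have hSq := hS' q (by omega)
    exact ⟨hSq.contDiff_orbitX hr k, hSq.contDiff_orbitWeight hr k⟩
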